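/- Let $A$ be a commutative ring of finite Krull dimension $d$. For $m\ge 1$ let $E_m(A)\subseteq SL_m(A)$ be the subgroup generated by the elementary matrices $1+c\,e_{ij}$ ($i\ne j$, $c\in A$), and let $SL_m(A)/E_m(A)$ be the set of cosets $ME_m(A)$, pointed by the class of the identity. Let $Um_m(A)$ be the set of unimodular rows of length $m$ over $A$, on which $SL_m(A)$ acts on the right by matrix multiplication; the orbit sets $Um_m(A)/E_m(A)$ and $Um_m(A)/SL_m(A)$ are pointed by the class of $(1,0,\dots,0)$. For every $n\ge 2$ the sequence $$SL_n(A)/E_n(A)\to SL_{n+1}(A)/E_{n+1}(A)\to Um_{n+1}(A)/E_{n+1}(A)\to Um_{n+1}(A)/SL_{n+1}(A)\to 0,$$ whose maps are induced by $M\mapsto\begin{pmatrix}1&0\\0&M\end{pmatrix}$, by sending a matrix to its first row, and by the identity of $Um_{n+1}(A)$, respectively, is an exact sequence of pointed sets. If $n=d\ge 3$, it is an exact sequence of groups, in the following sense. The subgroups $E_n(A)\subseteq SL_n(A)$ and $E_{n+1}(A)\subseteq SL_{n+1}(A)$ are normal. Let $WMS_{n+1}(A)$ be the group with generators $wms(v)$,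 $v\in Um_{n+1}(A)$, and relations $wms(v)=wms(vg)$ for $g\in E_{n+1}(A)$ and $wms(1-x,v_2,\dots,v_{n+1})\,wms(x,v_2,\dots,v_{n+1})=wms(x(1-x),v_2,\dots,v_{n+1})$ whenever $(x,v_2,\dots,v_{n+1})$ and $(1-x,v_2,\dots,v_{n+1})$ are unimodular. The map $wms:Um_{n+1}(A)/E_{n+1}(A)\to WMS_{n+1}(A)$ is a bijection, and $Um_{n+1}(A)/E_{n+1}(A)$ is given the group structure transported along it. There is a group structure on $Um_{n+1}(A)/SL_{n+1}(A)$ such that, for these and the quotient group structures, the three maps above are group homomorphisms, the image of each of the first two is the kernel of the next one, and the last one is surjective. -/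

import Mathlib

namespace UnimodularRows

open Matrix

/-- The group `SL_n(A)`. -/
abbrev SL (n : ℕ) (A : Type*) [CommRing A] : Type _ := Matrix.SpecialLinearGroup (Fin n) A

/-- `E_n(A)`, the subgroup of `SL_n(A)` generated by the elementary matrices
`1 + c • e_{ij}` with `i ≠ j`. -/
def E (n : ℕ) (A : Type*) [CommRing A] : Subgroup (SL n A) :=
  Subgroup.closure {g | ∃ (i j : Fin n) (c : A), i ≠ j ∧ g.1 = Matrix.transvection i j c}

/-- `Um_n(A)`, the set of unimodular rows of length `n`. -/
def Um (n : ℕ) (A : Type*) [CommRing A] : Type _ := {v : Fin n → A // ∃ w : Fin n → A, v ⬝ᵥ w = 1}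

section
variable {n : ℕ} {A : Type*} [CommRing A]

/-- The right action of `SL_n(A)` on `Um_n(A)`, `(v, g) ↦ v g`. -/
def Um.act (v : Um n A) (g : SL n A) : Um n A :=
  ⟨v.1 ᵥ* g.1, by
    obtain ⟨w, hw⟩ := v.2
    refine ⟨(g⁻¹).1 *ᵥ w, ?_⟩
    have h : g.1 * (g⁻¹).1 = 1 := congrArg Subtype.val (mul_inv_cancel g)
    rw [← Matrix.dotProduct_mulVec, Matrix.mulVec_mulVec, h, Matrix.one_mulVec, hw]⟩

theorem Um.act_one (v : Um n A) : v.act 1 = v :=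
  Subtype.ext (Matrix.vecMul_one v.1)

theorem Um.act_mul (v : Um n A) (g h : SL n A) : v.act (g * h) = (v.act g).act h :=
  Subtype.ext (Matrix.vecMul_vecMul v.1 g.1 h.1).symm

/-- Two unimodular rows are equivalent when they lie in the same orbit of the subgroup `H`. -/
def Um.orbitSetoid (H : Subgroup (SL n A)) : Setoid (Um n A) where
  r v w := ∃ g ∈ H, v.act g = w
  iseqv :=
    { refl := fun v => ⟨1, H.one_mem, v.act_one⟩
      symm := by
        rintro v w ⟨g, hg, rfl⟩
        exact ⟨g⁻¹, H.inv_mem hg, by rw [← Um.act_mul, mul_inv_cancel, Um.act_one]⟩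
      trans := by
        rintro u v w ⟨g, hg, rfl⟩ ⟨h, hh, rfl⟩
        exact ⟨g * h, H.mul_mem hg hh, Um.act_mul u g h⟩ }

/-- The first row of a matrix in `SL_{n+1}(A)`. -/
def firstRow (g : SL (n + 1) A) : Um (n + 1) A :=
  ⟨g.1 0, fun i => (g⁻¹).1 i 0, by
    have h : g.1 * (g⁻¹).1 = 1 := congrArg Subtype.val (mul_inv_cancel g)
    simpa [Matrix.mul_apply, dotProduct] using congrFun (congrFun h 0) 0⟩

theorem firstRow_mul (g h : SL (n + 1) A) : firstRow (g * h) = (firstRow g).act h := rfl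

/-- The matrix `(1 0; 0 M)`. -/
def blockMatrix (M : Matrix (Fin n) (Fin n) A) : Matrix (Fin (n + 1)) (Fin (n + 1)) A :=
  Matrix.of (Fin.cons (Fin.cons 1 0) (fun i => Fin.cons 0 (M i)))

theorem blockMatrix_one : blockMatrix (1 : Matrix (Fin n) (Fin n) A) = 1 := by
  ext i j
  refine Fin.cases ?_ (fun i => ?_) i <;> refine Fin.cases ?_ (fun j => ?_) j <;>
    simp [blockMatrix, Matrix.one_apply, Fin.succ_ne_zero, (Fin.succ_ne_zero _).symm]

theorem blockMatrix_mul (M N : Matrix (Fin n) (Fin n) A) :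
    blockMatrix (M * N) = blockMatrix M * blockMatrix N := by
  ext i j
  refine Fin.cases ?_ (fun i => ?_) i <;> refine Fin.cases ?_ (fun j => ?_) j <;>
    simp [blockMatrix, Matrix.mul_apply, Fin.sum_univ_succ]

theorem det_blockMatrix (M : Matrix (Fin n) (Fin n) A) : (blockMatrix M).det = M.det := by
  have h : (blockMatrix M).submatrix Fin.succ Fin.succ = M := by
    ext i j
    simp [blockMatrix]
  rw [Matrix.det_succ_row_zero, Fin.sum_univ_succ]
  simp [blockMatrix] at h ⊢
  simp [h]

theorem blockMatrix_transvection (i j : Fin n) (c : A) :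
    blockMatrix (Matrix.transvection i j c) = Matrix.transvection i.succ j.succ c := by
  ext k l
  refine Fin.cases ?_ (fun k => ?_) k <;> refine Fin.cases ?_ (fun l => ?_) l <;>
    simp [blockMatrix, Matrix.transvection, Matrix.one_apply, Matrix.single_apply,
      Fin.succ_ne_zero, (Fin.succ_ne_zero _).symm]

/-- The homomorphism `SL_n(A) → SL_{n+1}(A)`, `M ↦ (1 0; 0 M)`. -/
def blockHom (n : ℕ) (A : Type*) [CommRing A] : SL n A →* SL (n + 1) A where
  toFun M := ⟨blockMatrix M.1, (det_blockMatrix M.1).trans M.2⟩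
  map_one' := Subtype.ext blockMatrix_one
  map_mul' M N := Subtype.ext (blockMatrix_mul M.1 N.1)

theorem blockHom_mem_E {g : SL n A} (hg : g ∈ E n A) : blockHom n A g ∈ E (n + 1) A := by
  have h : E n A ≤ (E (n + 1) A).comap (blockHom n A) := by
    refine (Subgroup.closure_le _).2 ?_
    rintro g ⟨i, j, c, hij, hg⟩
    refine Subgroup.subset_closure ⟨i.succ, j.succ, c, fun h => hij (Fin.succ_injective _ h), ?_⟩
    rw [← blockMatrix_transvection, ← hg]
    rfl
  exact h hg

end

section
variable (n : ℕ) (A : Type*) [CommRing A]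

/-- `SL_n(A)/E_n(A)`: the set of cosets `M E_n(A)`, that is, the orbits of the right action of
`E_n(A)` on `SL_n(A)`. It carries Mathlib's quotient group structure as soon as `E_n(A)` is
normal. -/
abbrev SLmodE : Type _ := SL n A ⧸ E n A

/-- `Um_n(A)/E_n(A)`. -/
def UmModE : Type _ := Quotient (Um.orbitSetoid (E n A))

/-- `Um_n(A)/SL_n(A)`. -/
def UmModSL : Type _ := Quotient (Um.orbitSetoid (⊤ : Subgroup (SL n A)))

variable {n A}

/-- The class of a unimodular row in `Um_n(A)/E_n(A)`. -/
def UmModE.mk (v : Um n A) : UmModE n A := Quotient.mk _ v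

/-- The class of a unimodular row in `Um_n(A)/SL_n(A)`. -/
def UmModSL.mk (v : Um n A) : UmModSL n A := Quotient.mk _ v

variable (n A)

/-- The unimodular row `(1, 0, …, 0)` of length `n + 1`. -/
def baseRow : Um (n + 1) A :=
  ⟨Fin.cons 1 0, Fin.cons 1 0, by simp [dotProduct, Fin.sum_univ_succ]⟩

/-- The map `SL_n(A)/E_n(A) → SL_{n+1}(A)/E_{n+1}(A)` induced by `M ↦ (1 0; 0 M)`. -/
def stabMap : SLmodE n A → SLmodE (n + 1) A :=
  Quotient.map' (blockHom n A) (by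
    intro a b h
    rw [QuotientGroup.leftRel_apply] at h ⊢
    rw [← map_inv, ← map_mul]
    exact blockHom_mem_E h)

/-- The map `SL_{n+1}(A)/E_{n+1}(A) → Um_{n+1}(A)/E_{n+1}(A)` sending a matrix to its first row. -/
def rowMap : SLmodE (n + 1) A → UmModE (n + 1) A :=
  Quotient.map' firstRow (by
    intro a b h
    rw [QuotientGroup.leftRel_apply] at h
    exact ⟨a⁻¹ * b, h, by rw [← firstRow_mul, mul_inv_cancel_left]⟩)

/-- The projection `Um_n(A)/E_n(A) → Um_n(A)/SL_n(A)`. -/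
def projMap : UmModE n A → UmModSL n A :=
  Quotient.map' id (by
    rintro a b ⟨g, _, h⟩
    exact ⟨g, Subgroup.mem_top g, h⟩)

/-- The relations of the universal weak Mennicke symbol on rows of length `n + 1`:
`wms(v) = wms(v g)` for `g` in `E_{n+1}(A)`, and
`wms(1 - x, v) wms(x, v) = wms(x (1 - x), v)` whenever `(x, v)` and `(1 - x, v)` are unimodular
(`(x (1 - x), v)` is then unimodular too). -/
def wmsRels : Set (FreeGroup (Um (n + 1) A)) :=
  {r | ∃ (v : Um (n + 1) A) (g : SL (n + 1) A), g ∈ E (n + 1) A ∧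
      r = FreeGroup.of v * (FreeGroup.of (v.act g))⁻¹} ∪
  {r | ∃ (x : A) (v : Fin n → A) (p q s : Um (n + 1) A),
      p.1 = Fin.cons (1 - x) v ∧ q.1 = Fin.cons x v ∧ s.1 = Fin.cons (x * (1 - x)) v ∧
      r = FreeGroup.of p * FreeGroup.of q * (FreeGroup.of s)⁻¹}

/-- `WMS_{n+1}(A)`: the group with generators `wms(v)`, for `v` in `Um_{n+1}(A)`, and the
relations of the universal weak Mennicke symbol. -/
abbrev WMS : Type _ := PresentedGroup (wmsRels n A)

/-- The map `wms : Um_{n+1}(A)/E_{n+1}(A) → WMS_{n+1}(A)`. -/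
def wmsMap : UmModE (n + 1) A → WMS n A :=
  Quotient.lift (fun v => PresentedGroup.of (rels := wmsRels n A) v) (by
    rintro a b ⟨g, hg, rfl⟩
    have h : PresentedGroup.mk (wmsRels n A)
        (FreeGroup.of a * (FreeGroup.of (a.act g))⁻¹) = 1 :=
      PresentedGroup.one_of_mem (Or.inl ⟨a, g, hg, rfl⟩)
    rw [map_mul, map_inv, mul_inv_eq_one] at h
    exact h)

end

/-- Exactness at `Y` of a sequence `X → Y → Z` of sets, where `Z` is pointed by `z`: the image of
the first map is the fibre of the second one over the base point. -/
def ExactAt {X Y Z : Type*} (f : X → Y) (g : Y → Z) (z : Z) : Prop :=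
  ∀ y, g y = z ↔ y ∈ Set.range f

end UnimodularRows

/-! The pointed-set statements are formal, apart from one point: a matrix with first row `(1,0,…,0)`
is an elementary matrix times a block matrix. Suslin's normality of `E_m(A)` for `m ≥ 3` then moves
the elementary factor to the other side (`exists_blockHom`).

For the group statement, only the stable range bound `n + 1`, deduced from dimension `n` by
Kronecker's theorem, is used. The product of the classes of `(x, v)` and `(y, w)` is built by hand.
Stable range allows `v` to be changed modulo `x` and `w` modulo `y` until the tails are comaximal.
The Chinese remainder theorem then gives `X` congruent to `x` modulo the entries of `v`, with `1 -
X` congruent to `y` modulo those of `w`. The product is the class of `(X(1-X), (1-X)v + Xw)`, called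
`fold X v w`.

Two admissible `X` differ by an element of the product of the two tail ideals, and
`fold_of_sub_mem_mul` shows that such a change is harmless. Independence of the tails
(`FoldEquiv.of_comax`) comes from linking two comaximal pairs through intermediate ones supplied by
stable range. Invariance under elementary operations is then checked on transvections. Associativity
is an interchange argument: the same product can be computed in the first or in the second
coordinate. Any two classes have representatives `(X, u)`, `(1-X, u)`, so the product obeys the weak
Mennicke relation and is determined by it; this identifies the group with `WMS`.

The deepest point is `cls_vecMul`: the class of `p g` is the class of the first row of `g` times
that of `p`. The block `H` of `g⁻¹` complementary to its first row and column has determinant `g₀₀`.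
After stable range adjustments, `H` becomes, modulo a suitable head, a diagonal matrix with a single
nontrivial entry times an elementary matrix, and the formula becomes a computation with rows. Hence
the row map is a homomorphism, the `SL`-orbits are the cosets of its image, and `Um/SL` is a
quotient group. -/

namespace UnimodularRows

open Matrix

/-! ### Elementary matrices and elementary equivalence of rows. -/

section RowEquiv

variable {m n : ℕ} {A : Type*} [CommRing A]

/-- Matrices that are products of elementary ones. -/
def IsElem (M : Matrix (Fin m) (Fin m) A) : Prop := ∃ g ∈ E m A, g.1 = M

theorem IsElem.one : IsElem (1 : Matrix (Fin m) (Fin m) A) := ⟨1, one_mem _, rfl⟩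

theorem IsElem.mul {M N : Matrix (Fin m) (Fin m) A} (hM : IsElem M) (hN : IsElem N) :
    IsElem (M * N) := by
  obtain ⟨g, hg, rfl⟩ := hM
  obtain ⟨h, hh, rfl⟩ := hN
  exact ⟨g * h, mul_mem hg hh, rfl⟩

theorem IsElem.transvection {i j : Fin m} (h : i ≠ j) (c : A) : IsElem (transvection i j c) :=
  ⟨⟨_, det_transvection_of_ne i j h c⟩, Subgroup.subset_closure ⟨i, j, c, h, rfl⟩, rfl⟩

theorem isElem_val {g : SL m A} : IsElem g.1 ↔ g ∈ E m A :=
  ⟨fun ⟨_, hh, e⟩ => Subtype.ext e ▸ hh, fun h => ⟨g, h, rfl⟩⟩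

theorem IsElem.blockMatrix {M : Matrix (Fin n) (Fin n) A} (hM : IsElem M) :
    IsElem (blockMatrix M) := by
  obtain ⟨g, hg, rfl⟩ := hM
  exact ⟨_, blockHom_mem_E hg, rfl⟩

/-- The inverse of a transvection is a transvection, so elementary matrices form the monoid
generated by transvections and no case for inverses is needed. -/
theorem IsElem.induction {P : Matrix (Fin m) (Fin m) A → Prop} (one : P 1)
    (mul : ∀ M N, P M → P N → P (M * N))
    (step : ∀ i j c, i ≠ j → P (Matrix.transvection i j c))
    {M : Matrix (Fin m) (Fin m) A} (hM : IsElem M) : P M := by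
  obtain ⟨g, hg, rfl⟩ := hM
  induction hg using Subgroup.closure_induction'' with
  | mem x hx => obtain ⟨i, j, c, hij, e⟩ := hx; rw [e]; exact step i j c hij
  | inv_mem x hx =>
    obtain ⟨i, j, c, hij, e⟩ := hx
    have h : x * ⟨Matrix.transvection i j (-c), det_transvection_of_ne i j hij (-c)⟩ = 1 := by
      apply Subtype.ext
      change x.1 * Matrix.transvection i j (-c) = 1
      rw [e, transvection_mul_transvection_same i j hij]
      simp
    have : (x⁻¹).1 = Matrix.transvection i j (-c) := by
      rw [inv_eq_of_mul_eq_one_right h]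
    rw [this]; exact step i j _ hij
  | one => exact one
  | mul x y _ _ hx hy => exact mul _ _ hx hy

theorem IsElem.map {B : Type*} [CommRing B] (f : A →+* B) {M : Matrix (Fin m) (Fin m) A}
    (hM : IsElem M) : IsElem (M.map f) := by
  refine hM.induction (P := fun M => IsElem (M.map f)) ?_ ?_ ?_
  · simpa using IsElem.one
  · intro M N h1 h2; rw [Matrix.map_mul]; exact h1.mul h2
  · intro i j c h
    have : (Matrix.transvection i j c).map f = Matrix.transvection i j (f c) := by
      simp [Matrix.transvection, Matrix.map_add, Matrix.map_one, Matrix.map_single]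
    rw [this]; exact .transvection h _

theorem IsElem.exists_lift {B : Type*} [CommRing B] (f : A →+* B) (hf : Function.Surjective f)
    {M : Matrix (Fin m) (Fin m) B} (hM : IsElem M) :
    ∃ N : Matrix (Fin m) (Fin m) A, IsElem N ∧ N.map f = M := by
  refine hM.induction (P := fun M => ∃ N : Matrix (Fin m) (Fin m) A, IsElem N ∧ N.map f = M)
    ⟨1, .one, by simp⟩ ?_ ?_
  · rintro _ _ ⟨M, h1, rfl⟩ ⟨N, h2, rfl⟩
    exact ⟨M * N, h1.mul h2, Matrix.map_mul⟩
  · intro i j c h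
    obtain ⟨c, rfl⟩ := hf c
    exact ⟨Matrix.transvection i j c, .transvection h _, by
      simp [Matrix.transvection, Matrix.map_add, Matrix.map_one, Matrix.map_single]⟩

theorem IsElem.exists_inv {M : Matrix (Fin m) (Fin m) A} (hM : IsElem M) :
    ∃ N, IsElem N ∧ M * N = 1 ∧ N * M = 1 := by
  obtain ⟨g, hg, rfl⟩ := hM
  exact ⟨_, ⟨g⁻¹, inv_mem hg, rfl⟩, congrArg Subtype.val (mul_inv_cancel g),
    congrArg Subtype.val (inv_mul_cancel g)⟩

theorem one_add_vecMulVec_mul (a b c d : Fin m → A) (h : b ⬝ᵥ c = 0) :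
    (1 + vecMulVec a b) * (1 + vecMulVec c d) = 1 + vecMulVec a b + vecMulVec c d := by
  have : vecMulVec a b * vecMulVec c d = 0 := by
    ext i j
    rw [vecMulVec_mul_vecMulVec]
    simp [vecMulVec_apply, h]
  rw [mul_add, add_mul (1 : Matrix (Fin m) (Fin m) A) (vecMulVec a b) (vecMulVec c d), this]
  simp

theorem transvection_eq_one_add_vecMulVec (i j : Fin m) (c : A) :
    transvection i j c = 1 + vecMulVec (Pi.single i c) (Pi.single j 1) := by
  ext a b
  simp only [transvection, Matrix.add_apply, Matrix.single_apply, vecMulVec_apply, Pi.single_apply]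
  split_ifs <;> simp_all

theorem transvection_eq_one_add_vecMulVec' (i j : Fin m) (c : A) :
    transvection i j c = 1 + vecMulVec (Pi.single i 1) (Pi.single j c) := by
  ext a b
  simp only [transvection, Matrix.add_apply, Matrix.single_apply, vecMulVec_apply, Pi.single_apply]
  split_ifs <;> simp_all

/-- A matrix `1 + ξ e_kᵗ` with `ξ_k = 0` is a product of elementary matrices. -/
theorem IsElem.one_add_col (ξ : Fin m → A) (k : Fin m) (h : ξ k = 0) :
    IsElem (1 + vecMulVec ξ (Pi.single k 1)) := by
  classical
  have key : ∀ s : Finset (Fin m),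
      IsElem (1 + vecMulVec (∑ i ∈ s, Pi.single i (ξ i)) (Pi.single k 1)) := by
    intro s
    induction s using Finset.induction_on with
    | empty => simpa using IsElem.one
    | insert i s his ih =>
      by_cases hik : i = k
      · rw [Finset.sum_insert his]; subst hik; simpa [h] using ih
      · have := ih.mul (.transvection hik (ξ i))
        rw [transvection_eq_one_add_vecMulVec, one_add_vecMulVec_mul _ _ _ _ (by simp [hik])]
          at this
        rwa [Finset.sum_insert his, add_vecMulVec, add_comm (vecMulVec (Pi.single i _) _),
          ← add_assoc]
  have := key Finset.univ
  rwa [Finset.univ_sum_single] at this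

/-- A matrix `1 + e_k η` with `η_k = 0` is a product of elementary matrices. -/
theorem IsElem.one_add_row (η : Fin m → A) (k : Fin m) (h : η k = 0) :
    IsElem (1 + vecMulVec (Pi.single k 1) η) := by
  classical
  have key : ∀ s : Finset (Fin m),
      IsElem (1 + vecMulVec (Pi.single k 1 : Fin m → A) (∑ i ∈ s, Pi.single i (η i))) := by
    intro s
    induction s using Finset.induction_on with
    | empty => simpa using IsElem.one
    | insert i s his ih =>
      by_cases hik : i = k
      · rw [Finset.sum_insert his]; subst hik; simpa [h] using ih
      · have := (IsElem.transvection (Ne.symm hik) (η i)).mul ih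
        rw [transvection_eq_one_add_vecMulVec', one_add_vecMulVec_mul _ _ _ _ (by simp [hik])]
          at this
        rwa [Finset.sum_insert his, vecMulVec_add, ← add_assoc]
  have := key Finset.univ
  rwa [Finset.univ_sum_single] at this

/-- Equivalence of rows under the action of `E_m(A)`. -/
def RowEquiv (p q : Fin m → A) : Prop := ∃ M, IsElem M ∧ p ᵥ* M = q

theorem RowEquiv.refl (p : Fin m → A) : RowEquiv p p := ⟨1, .one, vecMul_one p⟩

theorem RowEquiv.of_eq {p q : Fin m → A} (h : p = q) : RowEquiv p q := h ▸ .refl p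

theorem RowEquiv.trans {p q r : Fin m → A} (h : RowEquiv p q) (h' : RowEquiv q r) :
    RowEquiv p r := by
  obtain ⟨M, hM, rfl⟩ := h
  obtain ⟨N, hN, rfl⟩ := h'
  exact ⟨M * N, hM.mul hN, (vecMul_vecMul _ _ _).symm⟩

theorem RowEquiv.symm {p q : Fin m → A} (h : RowEquiv p q) : RowEquiv q p := by
  obtain ⟨M, hM, rfl⟩ := h
  obtain ⟨N, hN, h1, _⟩ := hM.exists_inv
  exact ⟨N, hN, by rw [vecMul_vecMul, h1, vecMul_one]⟩

theorem IsElem.rowEquiv {M : Matrix (Fin m) (Fin m) A} (hM : IsElem M) (p : Fin m → A) :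
    RowEquiv p (p ᵥ* M) := ⟨M, hM, rfl⟩

theorem vecMul_one_add_vecMulVec (p ξ η : Fin m → A) :
    p ᵥ* (1 + vecMulVec ξ η) = p + (p ⬝ᵥ ξ) • η := by
  rw [vecMul_add, vecMul_one, vecMul_vecMulVec]

theorem vecMul_transvection (p : Fin m → A) (i j : Fin m) (c : A) :
    p ᵥ* transvection i j c = p + Pi.single j (p i * c) := by
  rw [transvection_eq_one_add_vecMulVec', vecMul_one_add_vecMulVec, dotProduct_single, mul_one,
    ← Pi.single_smul, smul_eq_mul]

theorem RowEquiv.add_single_dot (p c : Fin m → A) (k : Fin m) (h : c k = 0) :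
    RowEquiv p (p + Pi.single k (p ⬝ᵥ c)) :=
  ⟨_, .one_add_col c k h, by
    rw [vecMul_one_add_vecMulVec, ← Pi.single_smul, smul_eq_mul, mul_one]⟩

theorem RowEquiv.add_single (p : Fin m → A) {i j : Fin m} (h : i ≠ j) (c : A) :
    RowEquiv p (p + Pi.single j (p i * c)) :=
  ⟨_, .transvection h c, vecMul_transvection p i j c⟩

theorem RowEquiv.add_smul (p c : Fin m → A) (k : Fin m) (h : c k = 0) :
    RowEquiv p (p + p k • c) :=
  ⟨_, .one_add_row c k h, by rw [vecMul_one_add_vecMulVec, dotProduct_single, mul_one]⟩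

/-! ### Rows with a distinguished first entry -/

theorem RowEquiv.cons_tail (x : A) {v w : Fin n → A} (h : RowEquiv v w) :
    RowEquiv (Fin.cons x v : Fin (n + 1) → A) (Fin.cons x w) := by
  obtain ⟨M, hM, rfl⟩ := h
  refine ⟨_, hM.blockMatrix, funext fun i => ?_⟩
  refine Fin.cases ?_ (fun j => ?_) i <;>
    simp [blockMatrix, vecMul, dotProduct, Fin.sum_univ_succ]

theorem RowEquiv.cons_add_smul (x : A) (v c : Fin n → A) :
    RowEquiv (Fin.cons x v : Fin (n + 1) → A) (Fin.cons x (v + x • c)) :=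
  (RowEquiv.add_smul _ (Fin.cons 0 c : Fin (n + 1) → A) 0 rfl).trans <| .of_eq <| by
    ext i; refine Fin.cases ?_ (fun j => ?_) i <;> simp

theorem RowEquiv.cons_add_dot (x : A) (v c : Fin n → A) :
    RowEquiv (Fin.cons x v : Fin (n + 1) → A) (Fin.cons (x + v ⬝ᵥ c) v) :=
  (RowEquiv.add_single_dot _ (Fin.cons 0 c : Fin (n + 1) → A) 0 rfl).trans <| .of_eq <| by
    ext i; refine Fin.cases ?_ (fun j => ?_) i <;> simp [dotProduct, Fin.sum_univ_succ]

theorem RowEquiv.cons_of_dvd {x : A} {v w : Fin n → A} (h : ∀ i, x ∣ w i - v i) :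
    RowEquiv (Fin.cons x v : Fin (n + 1) → A) (Fin.cons x w) := by
  choose c hc using h
  refine (RowEquiv.cons_add_smul x v c).trans (.of_eq ?_)
  congr 1; ext i; simp [← hc]

theorem mem_span_range_iff_exists_dotProduct {ι : Type*} [Fintype ι] {v : ι → A} {x : A} :
    x ∈ Ideal.span (Set.range v) ↔ ∃ c, v ⬝ᵥ c = x := by
  rw [Ideal.mem_span_range_iff_exists_fun]
  simp only [dotProduct, mul_comm]

theorem RowEquiv.cons_of_sub_mem {x y : A} {v : Fin n → A}
    (h : y - x ∈ Ideal.span (Set.range v)) :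
    RowEquiv (Fin.cons x v : Fin (n + 1) → A) (Fin.cons y v) := by
  obtain ⟨c, hc⟩ := mem_span_range_iff_exists_dotProduct.1 h
  refine (RowEquiv.cons_add_dot x v c).trans (.of_eq ?_)
  rw [hc]; simp

/-- Rows whose tails are equivalent modulo the head are equivalent. -/
theorem RowEquiv.cons_of_mod {x : A} {v w : Fin n → A}
    (h : RowEquiv (Ideal.Quotient.mk (Ideal.span {x}) ∘ v)
      (Ideal.Quotient.mk (Ideal.span {x}) ∘ w)) :
    RowEquiv (Fin.cons x v : Fin (n + 1) → A) (Fin.cons x w) := by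
  obtain ⟨M, hM, e⟩ := h
  obtain ⟨N, hN, rfl⟩ := hM.exists_lift _ Ideal.Quotient.mk_surjective
  refine (RowEquiv.cons_tail x (hN.rowEquiv v)).trans (.cons_of_dvd fun i => ?_)
  rw [← Ideal.mem_span_singleton, ← Ideal.Quotient.eq, RingHom.map_vecMul]
  exact (congrFun e i).symm

/-- If `p_l = 1 - q r` and `p_i = q a`, the factor `q` may be moved to another coordinate `j`. -/
theorem RowEquiv.shift {p : Fin m → A} {i j l : Fin m} (hij : i ≠ j) (hil : i ≠ l) (hjl : j ≠ l)
    {q r a : A} (hl : p l = 1 - q * r) (hi : p i = q * a) :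
    RowEquiv p (Function.update (Function.update p i a) j (q * p j)) := by
  -- Since `(q a) r + (1 - q r) a = a`, two moves add `a` to entry `j`. Adding `1 - q` times it to
  -- entry `i`, and subtracting the result from entry `j`, leaves `a + (1 - q) p_j` and `q p_j`. The
  -- surplus `(1 - q) p_j` in entry `i` is removed using `q r + (1 - q r) = 1` again.
  have h1 := (RowEquiv.add_single p hij r).trans (RowEquiv.add_single _ hjl.symm a)
  have h2 := (h1.trans (RowEquiv.add_single _ hij.symm (1 - q))).trans
    (RowEquiv.add_single _ hij (-1))
  have h3 := (h2.trans (RowEquiv.add_single _ hij.symm (-((1 - q) * r)))).trans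
    (RowEquiv.add_single _ hil.symm (-((1 - q) * p j)))
  refine h3.trans (.of_eq (funext fun k => ?_))
  by_cases hkj : k = j
  · subst hkj
    simp [hij, hij.symm, hil.symm, hjl.symm, hl, hi]
    ring
  by_cases hki : k = i
  · subst hki
    simp [hij, hij.symm, hil.symm, hjl.symm, hl, hi]
    ring
  simp [Pi.single_apply, hki, hkj]

theorem RowEquiv.shift_cons {x : A} {v : Fin n → A} {a b : Fin n} (hab : a ≠ b) {q r : A}
    (ha : v a = 1 - q * r) : RowEquiv (Fin.cons (q * x) v : Fin (n + 1) → A)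
      (Fin.cons x (Function.update v b (q * v b))) := by
  refine (RowEquiv.shift (i := 0) (j := b.succ) (l := a.succ) (q := q) (r := r) (a := x)
    (Fin.succ_ne_zero _).symm (Fin.succ_ne_zero _).symm (by simpa using hab.symm)
    (by simpa using ha) (by simp)).trans (.of_eq ?_)
  rw [Fin.update_cons_zero, ← Fin.cons_update, Fin.cons_succ]

theorem RowEquiv.swap_cons_cons (x y : A) (v : Fin n → A) :
    RowEquiv (Fin.cons x (Fin.cons y v : Fin (n + 1) → A) : Fin (n + 2) → A)
      (Fin.cons y (Fin.cons (-x) v : Fin (n + 1) → A)) := by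
  have h01 : (0 : Fin (n + 2)) ≠ 1 := Fin.zero_ne_one
  have h := ((RowEquiv.add_single (Fin.cons x (Fin.cons y v : Fin (n + 1) → A) : Fin (n + 2) → A)
    h01.symm 1).trans (.add_single _ h01 (-1))).trans (.add_single _ h01.symm 1)
  refine h.trans (.of_eq (funext fun i => ?_))
  refine Fin.cases ?_ (fun i => Fin.cases ?_ (fun i => ?_) i) i
  · simp
  · simp
  · have : (i.succ.succ : Fin (n + 2)) ≠ 1 := by
      rw [← Fin.succ_zero_eq_one]; exact fun e => Fin.succ_ne_zero i (Fin.succ_injective _ e)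
    simp [Pi.single_eq_of_ne this]

end RowEquiv

end UnimodularRows

namespace UnimodularRows

open Matrix

/-! ### Krull dimension, Kronecker's theorem and stable range. -/

section StableRange

variable {A : Type*} [CommRing A]

theorem eq_top_of_maximal {I : Ideal A} (h : ∀ M : Ideal A, M.IsMaximal → I ≤ M → False) :
    I = ⊤ := by
  by_contra hI
  obtain ⟨M, hM, hle⟩ := I.exists_le_maximal hI
  exact h M hM hle

/-- The localization at a minimal prime has only one prime, so `b` becomes nilpotent there. In
elementary terms: a prime avoiding both the powers of `b` and the complement of `p` would lie in
`p`, hence equal it, although `b ∈ p`. -/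
theorem exists_notMem_isNilpotent_mul {p : Ideal A} (hp : p ∈ minimalPrimes A) {b : A}
    (hb : b ∈ p) : ∃ y ∉ p, IsNilpotent (b * y) := by
  have hpp : p.IsPrime := hp.1.1
  by_cases h0 : (0 : A) ∈ Submonoid.powers b ⊔ p.primeCompl
  · obtain ⟨_, ⟨i, rfl⟩, y, hy, h⟩ := Submonoid.mem_sup.1 h0
    refine ⟨y, hy, i + 1, ?_⟩
    linear_combination (b * y ^ i) * h
  · obtain ⟨q, hq, _, hd⟩ := Ideal.exists_le_prime_disjoint (⊥ : Ideal A)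
      (Submonoid.powers b ⊔ p.primeCompl) (by
        rw [Set.disjoint_left]
        rintro x hx hx'
        rw [SetLike.mem_coe, Ideal.mem_bot] at hx
        exact h0 (hx ▸ hx'))
    have hqp : q ≤ p := fun x hx => by
      by_contra hxp
      exact Set.disjoint_left.1 hd hx
        ((le_sup_right : p.primeCompl ≤ Submonoid.powers b ⊔ p.primeCompl) hxp)
    exact (Set.disjoint_left.1 hd (hp.2 ⟨hq, bot_le⟩ hqp hb)
      ((le_sup_left : Submonoid.powers b ≤ Submonoid.powers b ⊔ p.primeCompl)
        (Submonoid.mem_powers b))).elim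

/-- Every chain of primes containing `I` can be prolonged downwards by a minimal prime below its
first member; the two differ because no minimal prime contains `I`. -/
theorem ringKrullDim_quotient_succ_le_of_not_le_minimalPrimes {I : Ideal A}
    (hI : ∀ p ∈ minimalPrimes A, ¬ I ≤ p) : ringKrullDim (A ⧸ I) + 1 ≤ ringKrullDim A := by
  by_cases hr' : I = ⊤
  · rw [hr', ringKrullDim_eq_bot_of_subsingleton]
    simp
  have : Nonempty (PrimeSpectrum.zeroLocus (R := A) I) := by
    rwa [Set.nonempty_coe_sort, Set.nonempty_iff_ne_empty, ne_eq,
      PrimeSpectrum.zeroLocus_empty_iff_eq_top]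
  have := Ideal.Quotient.nontrivial_iff.mpr hr'
  have := (Ideal.Quotient.mk I).domain_nontrivial
  rw [ringKrullDim_quotient, Order.krullDim_eq_iSup_length, ringKrullDim,
    Order.krullDim_eq_iSup_length, ← WithBot.coe_one, ← WithBot.coe_add,
    ENat.iSup_add, WithBot.coe_le_coe, iSup_le_iff]
  intro l
  obtain ⟨p, hp, hp'⟩ := Ideal.exists_minimalPrimes_le (J := l.head.1.asIdeal) bot_le
  let p' : PrimeSpectrum A := ⟨p, hp.1.1⟩
  have hp' : p' < l.head := lt_of_le_of_ne hp' fun h => hI p hp (by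
    have := l.head.2
    rw [← h] at this
    exact this)
  refine le_trans ?_ (le_iSup _ ((l.map Subtype.val (fun _ _ => id)).cons p' hp'))
  exact (Nat.cast_succ l.length).symm.le.trans
    (Nat.cast_le.2 ((RelSeries.cons_length (l.map Subtype.val fun _ _ => id) p' hp').ge))

/-- Kronecker's theorem in Krull dimension less than `k`. -/
theorem exists_mem_radical_span_add_smul (k : ℕ) : ∀ {A : Type*} [CommRing A],
    ringKrullDim A < k → ∀ (a : A) (b : Fin k → A),
      ∃ c : Fin k → A, a ∈ (Ideal.span (Set.range (b + a • c))).radical := by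
  induction k with
  | zero =>
    intro A _ h a b
    have hs : Subsingleton A := by
      by_contra hne
      rw [not_subsingleton_iff_nontrivial] at hne
      exact absurd ringKrullDim_nonneg_of_nontrivial (not_le.2 (by simpa using h))
    exact ⟨0, by rw [Subsingleton.elim a 0]; exact zero_mem _⟩
  | succ k ih =>
    intro A _ h a b
    -- The boundary ideal of `b 0`: that element together with everything that multiplies it into
    -- the nilradical. No minimal prime contains it, so the dimension drops in the quotient and
    -- induction applies.
    let N : Ideal A := Ideal.span {b 0} ⊔
      Submodule.comap (LinearMap.mulLeft A (b 0)) (nilradical A)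
    have hdim : ringKrullDim (A ⧸ N) < k := by
      have h1 : ringKrullDim (A ⧸ N) + 1 ≤ ringKrullDim A := by
        refine ringKrullDim_quotient_succ_le_of_not_le_minimalPrimes fun p hp hle => ?_
        obtain ⟨y, hy, hn⟩ := exists_notMem_isNilpotent_mul hp
          (hle (Ideal.mem_sup_left (Ideal.mem_span_singleton_self _)))
        exact hy (hle (Ideal.mem_sup_right hn))
      have h2 := lt_of_le_of_lt h1 h
      push_cast at h2
      exact lt_of_add_lt_add_right h2
    obtain ⟨c', hc'⟩ := ih hdim (Ideal.Quotient.mk N a) (fun i => Ideal.Quotient.mk N (b i.succ))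
    choose c hc using fun i => Ideal.Quotient.mk_surjective (I := N) (c' i)
    obtain ⟨m, hm⟩ := hc'
    have hm' : a ^ m ∈ Ideal.span (Set.range fun i => b i.succ + a * c i) ⊔ N := by
      have hr : (Ideal.Quotient.mk N '' Set.range fun i => b i.succ + a * c i) =
          Set.range ((fun i => Ideal.Quotient.mk N (b i.succ)) + Ideal.Quotient.mk N a • c') := by
        rw [← Set.range_comp]
        congr 1
        ext i
        simp [hc]
      rw [← Ideal.mem_quotient_iff_mem_sup, Ideal.map_span, map_pow, hr]
      exact hm
    obtain ⟨s, hs, t, ht, hst⟩ := Submodule.mem_sup.1 hm'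
    obtain ⟨r, hr, y, hy, rfl⟩ := Submodule.mem_sup.1 ht
    -- The first coefficient is the component of `a ^ m` that multiplies `b 0` into the nilradical.
    -- A prime containing `b 0 + a y` but not `a` contains `b 0` or `y`, hence both, and this puts
    -- `a ^ m` into it.
    refine ⟨Fin.cons y c, ?_⟩
    rw [Ideal.radical_eq_sInf, Ideal.mem_sInf]
    rintro P ⟨hle, hP⟩
    have h0 : b 0 + a * y ∈ P := hle (Ideal.subset_span ⟨0, by simp⟩)
    have h1 : b 0 * y ∈ P := nilradical_le_prime P hy
    have hs' : s ∈ P := by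
      refine (Ideal.span_le.2 ?_ : _ ≤ P) hs
      rintro _ ⟨i, rfl⟩
      exact hle (Ideal.subset_span ⟨i.succ, by simp⟩)
    by_contra ha
    have hby : b 0 ∈ P ∧ y ∈ P := by
      rcases hP.mem_or_mem h1 with h | h
      · exact ⟨h, (hP.mem_or_mem ((Ideal.add_mem_iff_right P h).1 h0)).resolve_left ha⟩
      · exact ⟨(Ideal.add_mem_iff_left P (P.mul_mem_left a h)).1 h0, h⟩
    refine ha (hP.mem_of_pow_mem m ?_)
    rw [← hst]
    refine P.add_mem hs' (P.add_mem ?_ hby.2)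
    exact (Ideal.span_singleton_le_iff_mem P).2 hby.1 hr

/-- The stable range condition `sr(A) ≤ N`, in a form relative to two ideals. -/
def StableRange (N : ℕ) (A : Type*) [CommRing A] : Prop :=
  ∀ (ι : Type) [Fintype ι], N ≤ Fintype.card ι → ∀ (a : ι → A) (J K : Ideal A),
    Ideal.span (Set.range a) ⊔ J ⊔ K = ⊤ →
      ∃ e ∈ J, ∃ c : ι → A, Ideal.span (Set.range (a + e • c)) ⊔ K = ⊤

/-- Write `1 = s + e + f` along the three ideals and apply Kronecker's theorem to `e + f`. Modulo
`K` the part `f` disappears, so a maximal ideal containing `K` and all `a + e c` contains `e + f`,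
then `e`, the entries of `a`, and `1`. -/
theorem stableRange_of_ringKrullDim_lt {N : ℕ} (h : ringKrullDim A < N) : StableRange N A := by
  intro ι _ hι a J K htop
  obtain ⟨t, ht, f, hf, htf⟩ := Submodule.mem_sup.1 ((Ideal.eq_top_iff_one _).1 htop)
  obtain ⟨s, hs, e, he, rfl⟩ := Submodule.mem_sup.1 ht
  let φ := Fintype.equivFin ι
  obtain ⟨c, hc⟩ := exists_mem_radical_span_add_smul (Fintype.card ι)
    (h.trans_le (by exact_mod_cast hι)) (e + f) (a ∘ φ.symm)
  refine ⟨e, he, c ∘ φ, eq_top_of_maximal fun M hM hle => ?_⟩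
  have hfM : f ∈ M := hle (Ideal.mem_sup_right hf)
  have hi : ∀ i, a i + e * c (φ i) ∈ M := fun i =>
    hle (Ideal.mem_sup_left (Ideal.subset_span ⟨i, by simp⟩))
  have hef : e + f ∈ M := by
    refine hM.isPrime.radical_le_iff.2 (Ideal.span_le.2 ?_) hc
    rintro _ ⟨j, rfl⟩
    have := M.add_mem (hi (φ.symm j)) (M.mul_mem_right (c j) hfM)
    simp only [Equiv.apply_symm_apply] at this
    simpa [add_mul, add_assoc] using this
  have heM : e ∈ M := (Ideal.add_mem_iff_left M hfM).1 hef
  have hsM : s ∈ M := by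
    refine (Ideal.span_le.2 ?_ : _ ≤ M) hs
    rintro _ ⟨i, rfl⟩
    exact (Ideal.add_mem_iff_left M (M.mul_mem_right _ heM)).1 (hi i)
  exact hM.ne_top ((Ideal.eq_top_iff_one M).2 (htf ▸ M.add_mem (M.add_mem hsM heM) hfM))

end StableRange

/-! ### Suslin's theorem: normality of the elementary subgroup. -/

section Normality

variable {m : ℕ} {A : Type*} [CommRing A]

theorem one_add_mul_eq_commutator {R : Type*} [Ring R] {P Q : R} (hP : P * P = 0)
    (hQ : Q * Q = 0) (h : Q * P = 0) : (1 + P) * (1 + Q) * (1 - P) * (1 - Q) = 1 + P * Q := by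
  have : (1 + P) * (1 + Q) * (1 - P) * (1 - Q) = 1 + P * Q - P * P + P * P * Q - Q * P - Q * Q
      + Q * P * Q - P * (Q * P) - P * (Q * Q) + P * (Q * P) * Q := by noncomm_ring
  rw [this]
  simp [hP, hQ, h]

/-- `1 + ξ η` is elementary if `η ξ = 0` and `η` has a zero entry. -/
theorem IsElem.one_add_vecMulVec_of_eq_zero {ξ η : Fin m → A} (h : η ⬝ᵥ ξ = 0) {k : Fin m}
    (hk : η k = 0) : IsElem (1 + vecMulVec ξ η) := by
  set ξ' : Fin m → A := ξ - Pi.single k (ξ k) with hξ'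
  have hξk : ξ' k = 0 := by simp [hξ']
  have hηξ : η ⬝ᵥ ξ' = 0 := by simp [hξ', dotProduct_sub, h, hk]
  let e : Fin m → A := Pi.single k 1
  have e1 : (e ⬝ᵥ e) = 1 := by simp [e]
  have e2 : e ⬝ᵥ ξ' = 0 := by simp [e, hξk]
  have e3 : η ⬝ᵥ e = 0 := by simp [e, hk]
  have h1 := IsElem.one_add_col ξ' k hξk
  have h2 := IsElem.one_add_row η k hk
  have h3 := IsElem.one_add_col (-ξ') k (by simp [hξk])
  have h4 := IsElem.one_add_row (-η) k (by simp [hk])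
  have h5 := IsElem.one_add_row (ξ k • η) k (by simp [hk])
  have h6 := one_add_mul_eq_commutator (P := vecMulVec ξ' e) (Q := vecMulVec e η)
    (by rw [vecMulVec_mul_vecMulVec, e2]; simp) (by rw [vecMulVec_mul_vecMulVec, e3]; simp)
    (by rw [vecMulVec_mul_vecMulVec, hηξ]; simp)
  -- With `ξ'` equal to `ξ` without its `k`-th entry, `1 + ξ' η` is the commutator of a column
  -- matrix and a row matrix through `e_k`. The remaining part of `ξ` contributes a last row matrix.
  have key : 1 + vecMulVec ξ η = (1 + vecMulVec ξ' e) * (1 + vecMulVec e η) *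
      (1 + vecMulVec (-ξ') e) * (1 + vecMulVec e (-η)) * (1 + vecMulVec e (ξ k • η)) := by
    have hξ : ξ = ξ' + ξ k • e := by
      simp [hξ', e, ← Pi.single_smul]
    rw [neg_vecMulVec, vecMulVec_neg, ← sub_eq_add_neg, ← sub_eq_add_neg, h6,
      vecMulVec_mul_vecMulVec, e1, one_smul, one_add_vecMulVec_mul _ _ _ _ e3]
    conv_lhs => rw [hξ]
    rw [add_vecMulVec, smul_vecMulVec, vecMulVec_smul, add_assoc]
  rw [key]
  exact (((h1.mul h2).mul h3).mul h4).mul h5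

theorem IsElem.one_add_vecMulVec_sum {ι : Type*} (s : Finset ι) {ξ : Fin m → A}
    {η : ι → Fin m → A} (h : ∀ i ∈ s, η i ⬝ᵥ ξ = 0) (h' : ∀ i ∈ s, IsElem (1 + vecMulVec ξ (η i))) :
    IsElem (1 + vecMulVec ξ (∑ i ∈ s, η i)) := by
  classical
  induction s using Finset.induction_on with
  | empty => simpa using IsElem.one
  | insert i s his ih =>
    have h1 := (h' i (Finset.mem_insert_self i s)).mul
      (ih (fun j hj => h j (Finset.mem_insert_of_mem hj))
        (fun j hj => h' j (Finset.mem_insert_of_mem hj)))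
    rw [one_add_vecMulVec_mul _ _ _ _ (h i (Finset.mem_insert_self i s))] at h1
    rwa [Finset.sum_insert his, vecMulVec_add, ← add_assoc]

/-- Suslin: `1 + ξ η` is elementary if `ξ` is unimodular, `η ξ = 0` and the size is at least 3. -/
theorem IsElem.one_add_vecMulVec (hm : 3 ≤ m) {ξ η ζ : Fin m → A} (h : η ⬝ᵥ ξ = 0)
    (hζ : ζ ⬝ᵥ ξ = 1) : IsElem (1 + vecMulVec ξ η) := by
  -- The Koszul relations: `η ξ = 0` and `ζ ξ = 1` make `η` the sum of the rows `η_i ζ_j (ξ_j e_i -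
  -- ξ_i e_j)`. Each is orthogonal to `ξ` and supported on two entries, so it has a zero entry as `m
  -- ≥ 3`.
  let θ : Fin m × Fin m → Fin m → A := fun p =>
    (η p.1 * ζ p.2) • (Pi.single p.1 (ξ p.2) - Pi.single p.2 (ξ p.1))
  have hθ : ∑ p, θ p = η := by
    rw [Fintype.sum_prod_type]
    ext k
    simp only [Finset.sum_apply, θ, Pi.smul_apply, Pi.sub_apply, smul_eq_mul, mul_sub,
      Finset.sum_sub_distrib, Pi.single_apply]
    simp only [mul_ite, mul_zero, Finset.sum_ite_irrel, Finset.sum_const_zero,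
      Finset.sum_ite_eq, Finset.mem_univ, if_true]
    have e1 : ∑ j, η k * ζ j * ξ j = η k := by
      simp only [mul_assoc, ← Finset.mul_sum]
      rw [show ∑ j, ζ j * ξ j = 1 from hζ, mul_one]
    have e2 : ∑ i, η i * ζ k * ξ i = 0 := by
      have : ∑ i, η i * ζ k * ξ i = ζ k * ∑ i, η i * ξ i := by
        rw [Finset.mul_sum]; exact Finset.sum_congr rfl fun i _ => by ring
      rw [this, show ∑ j, η j * ξ j = 0 from h, mul_zero]
    rw [e1, e2, sub_zero]
  rw [← hθ]
  have h0 : ∀ p, θ p ⬝ᵥ ξ = 0 := fun p => by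
    simp [θ, sub_dotProduct, mul_comm]
  refine .one_add_vecMulVec_sum _ (fun p _ => h0 p) fun p _ => ?_
  obtain ⟨k, hk⟩ : ∃ k, k ∉ ({p.1, p.2} : Finset (Fin m)) := by
    by_contra! hc
    have := Finset.card_le_card (fun k _ => hc k : (Finset.univ : Finset (Fin m)) ⊆ {p.1, p.2})
    have h2 := Finset.card_le_two (a := p.1) (b := p.2)
    simp only [Finset.card_univ, Fintype.card_fin] at this
    omega
  simp only [Finset.mem_insert, Finset.mem_singleton, not_or] at hk
  exact .one_add_vecMulVec_of_eq_zero (h0 p) (k := k) (by simp [θ, hk.1, hk.2])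

/-- Conjugating a transvection by `g` gives `1 + ξ η`, with `ξ` the `i`-th column of `g` and `η` a
multiple of the `j`-th row of `g⁻¹`. The `i`-th row of `g⁻¹` shows that `ξ` is unimodular. -/
theorem E_normal (hm : 3 ≤ m) (A : Type*) [CommRing A] : (E m A).Normal := by
  refine ⟨fun h hh g => ?_⟩
  rw [← isElem_val] at hh ⊢
  have hg : g.1 * (g⁻¹).1 = 1 := congrArg Subtype.val (mul_inv_cancel g)
  have hg' : (g⁻¹).1 * g.1 = 1 := congrArg Subtype.val (inv_mul_cancel g)
  change IsElem (g.1 * h.1 * (g⁻¹).1)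
  generalize h.1 = M at hh
  refine hh.induction (P := fun M => IsElem (g.1 * M * (g⁻¹).1)) ?_ ?_ ?_
  · rw [mul_one, hg]; exact .one
  · intro M N h1 h2
    have := h1.mul h2
    rwa [show g.1 * M * (g⁻¹).1 * (g.1 * N * (g⁻¹).1) = g.1 * M * ((g⁻¹).1 * g.1) * N * (g⁻¹).1 by
      simp only [mul_assoc], hg', mul_one, mul_assoc g.1 M N] at this
  · intro i j c hij
    have hent : ∀ a b, (g⁻¹).1 a ⬝ᵥ (fun k => g.1 k b) = (1 : Matrix (Fin m) (Fin m) A) a b :=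
      fun a b => by rw [← hg']; rfl
    rw [transvection_eq_one_add_vecMulVec', mul_add, add_mul, mul_one, hg, mul_vecMulVec,
      vecMulVec_mul]
    refine .one_add_vecMulVec hm (ζ := (g⁻¹).1 i) ?_ ?_
    · have : (Pi.single j c ᵥ* (g⁻¹).1) = c • (g⁻¹).1 j := by
        ext; simp
      rw [this, smul_dotProduct, mulVec_single_one]
      change c • ((g⁻¹).1 j ⬝ᵥ fun k => g.1 k i) = 0
      rw [hent, one_apply_ne hij.symm, smul_zero]
    · rw [mulVec_single_one]
      change ((g⁻¹).1 i ⬝ᵥ fun k => g.1 k i) = 1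
      rw [hent, one_apply_eq]

end Normality

end UnimodularRows

namespace UnimodularRows

open Matrix

/-! ### The row `fold X v w` and its invariance properties. -/

section Fold

variable {n : ℕ} {A : Type*} [CommRing A]

/-- The row `(X (1 - X), (1 - X) v + X w)`; when unimodular, it represents the product of the
classes of `(X, v)` and `(1 - X, w)`. -/
def fold (X : A) (v w : Fin n → A) : Fin (n + 1) → A :=
  Fin.cons (X * (1 - X)) ((1 - X) • v + X • w)

theorem fold_symm (X : A) (v w : Fin n → A) : fold X v w = fold (1 - X) w v := by
  unfold fold
  rw [sub_sub_cancel, mul_comm, add_comm ((1 - X) • v)]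

theorem fold_self (X : A) (v : Fin n → A) : fold X v v = Fin.cons (X * (1 - X)) v := by
  unfold fold
  rw [← add_smul]; simp

theorem fold_add_smul_left (X : A) (v w c : Fin n → A) :
    RowEquiv (fold X v w) (fold X (v + X • c) w) :=
  (RowEquiv.cons_add_smul _ _ c).trans <| .of_eq <| by
    unfold fold; congr 1; ext i; simp; ring

theorem fold_add_smul_right (X : A) (v w c : Fin n → A) :
    RowEquiv (fold X v w) (fold X v (w + (1 - X) • c)) := by
  rw [fold_symm, fold_symm X]
  exact fold_add_smul_left _ _ _ _

/-- For a transvection on `v` with coefficient `c`, apply to the folded tail the one with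
coefficient `(1 - X) c`. The discrepancy is `X (1 - X) c (v_i - w_i)`, a multiple of the head. -/
theorem fold_vecMul_left (X : A) (v w : Fin n → A) {M : Matrix (Fin n) (Fin n) A}
    (hM : IsElem M) : RowEquiv (fold X v w) (fold X (v ᵥ* M) w) := by
  revert v
  refine hM.induction (P := fun M => ∀ v, RowEquiv (fold X v w) (fold X (v ᵥ* M) w)) ?_ ?_ ?_
  · intro v; rw [vecMul_one]; exact .refl _
  · intro M N h1 h2 v
    rw [← vecMul_vecMul]
    exact (h1 v).trans (h2 _)
  · intro i j c hij v
    rw [vecMul_transvection]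
    refine ((RowEquiv.add_single _ hij ((1 - X) * c)).cons_tail (X * (1 - X))).trans
      ((RowEquiv.cons_add_smul _ _ (Pi.single j ((v i - w i) * c))).trans (.of_eq ?_))
    unfold fold
    congr 1
    ext k
    by_cases hk : k = j
    · subst hk; simp; ring
    · simp [hk]

theorem fold_left {v v' : Fin n → A} (X : A) (w : Fin n → A) (h : RowEquiv v v') :
    RowEquiv (fold X v w) (fold X v' w) := by
  obtain ⟨M, hM, rfl⟩ := h
  exact fold_vecMul_left X v w hM

theorem fold_right {w w' : Fin n → A} (X : A) (v : Fin n → A) (h : RowEquiv w w') :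
    RowEquiv (fold X v w) (fold X v w') := by
  rw [fold_symm, fold_symm X]
  exact fold_left _ _ h

/-- When `v` and `w` agree at `k`, the folded tail has the same entry `u` there, so multiples of `u`
may be added to all other entries. This realizes both the change of the head and the change `u c (w
- v)` of the tail. -/
theorem fold_add_mul {X : A} {v w : Fin n → A} {k : Fin n} {u : A} (hv : v k = u) (h : w k = u)
    (c : A) : RowEquiv (fold X v w) (fold (X + u * c) v w) := by
  subst hv
  have hk : (fold X v w) k.succ = v k := by
    simp only [fold, Fin.cons_succ, Pi.add_apply, Pi.smul_apply, smul_eq_mul, h]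
    ring
  have h1 := RowEquiv.add_smul (fold X v w) (Fin.cons 0 (c • (w - v)) : Fin (n + 1) → A) k.succ
    (by simp [h])
  refine h1.trans ((RowEquiv.add_single _ (Fin.succ_ne_zero k)
    (c * (1 - X) - c * X - v k * c * c)).trans (.of_eq ?_))
  simp only [hk]
  ext i
  refine Fin.cases ?_ (fun j => ?_) i
  · simp [fold, h]; ring
  · simp [fold]; ring

/-- Change of the parameter `X` by a multiple of the `k`-th entry. -/
theorem fold_add_entry_mul (X : A) (v w : Fin n → A) (k : Fin n) (s c : A) :
    RowEquiv (fold X (v + Pi.single k s) (w + Pi.single k s))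
      (fold (X + ((1 - X) * v k + X * w k + s) * c)
        (v + Pi.single k (s - ((1 - X) * v k + X * w k + s) * c * (w k - v k)))
        (w + Pi.single k (s - ((1 - X) * v k + X * w k + s) * c * (w k - v k)))) := by
  obtain ⟨δ, hδ⟩ : ∃ δ, δ = w k - v k := ⟨_, rfl⟩
  obtain ⟨t, ht⟩ : ∃ t, t = (1 - X) * v k + X * w k + s := ⟨_, rfl⟩
  rw [← hδ, ← ht]
  -- Adding `X d` to `v` and `-(1 - X) d` to `w` is allowed modulo the heads and makes both `k`-th
  -- entries equal to `t`. The reverse correction is made with the new parameter, which accounts for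
  -- the shift of `s`.
  let d : Fin n → A := Pi.single k δ
  have h0 := fold_add_smul_left X (v + Pi.single k s) (w + Pi.single k s) d
  have h1 := h0.trans (fold_add_smul_right X _ _ (-d))
  have ht1 : (v + Pi.single k s + X • d : Fin n → A) k = t := by simp [ht, hδ, d]; ring
  have ht2 : (w + Pi.single k s + (1 - X) • -d : Fin n → A) k = t := by simp [ht, hδ, d]; ring
  have h2 := h1.trans (fold_add_mul ht1 ht2 c)
  have h3 := (h2.trans (fold_add_smul_left _ _ _ (-d))).trans (fold_add_smul_right _ _ _ d)
  refine h3.trans (.of_eq ?_)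
  congr 1
  · ext i
    by_cases hi : i = k
    · subst hi; simp [d]; ring
    · simp [hi, d]
  · ext i
    by_cases hi : i = k
    · subst hi; simp [d]; ring
    · simp [hi, d]

theorem RowEquiv.add_single_add_single (v : Fin n → A) {i k : Fin n} (h : i ≠ k) (s c : A) :
    RowEquiv (v + Pi.single k s) (v + Pi.single k (s + v i * c)) := by
  refine (RowEquiv.add_single _ h c).trans (.of_eq ?_)
  ext l
  by_cases hl : l = k
  · subst hl; simp [h]; ring
  · simp [hl]

/-- Choose `k` different from `i` and `j`, which is possible as `n ≥ 3`. Transvections plant `v_i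
w_j` in the `k`-th entries of both tails. With `T = (1 - X) v_k + X w_k`, the parameter can then be
moved by `(T + v_i w_j) c`. Once the planted term is removed, it can be moved by `-T c`, and the net
effect is `v_i w_j c`. -/
theorem fold_add_mul_mul (hn : 3 ≤ n) (X : A) (v w : Fin n → A) (i j : Fin n) (c : A) :
    RowEquiv (fold X v w) (fold (X + v i * w j * c) v w) := by
  obtain ⟨k, hk⟩ : ∃ k, k ∉ ({i, j} : Finset (Fin n)) := by
    by_contra! hc
    have := Finset.card_le_card (fun k _ => hc k : (Finset.univ : Finset (Fin n)) ⊆ {i, j})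
    have h2 := Finset.card_le_two (a := i) (b := j)
    simp only [Finset.card_univ, Fintype.card_fin] at this
    omega
  simp only [Finset.mem_insert, Finset.mem_singleton, not_or] at hk
  have mv : ∀ X s w' c, RowEquiv (fold X (v + Pi.single k s) w')
      (fold X (v + Pi.single k (s + v i * c)) w') := fun X s w' c =>
    fold_left _ _ (.add_single_add_single v (Ne.symm hk.1) s c)
  have mw : ∀ X s v' c, RowEquiv (fold X v' (w + Pi.single k s))
      (fold X v' (w + Pi.single k (s + w j * c))) := fun X s v' c =>
    fold_right _ _ (.add_single_add_single w (Ne.symm hk.2) s c)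
  have hz : ∀ v : Fin n → A, v + Pi.single k 0 = v := fun v => by simp
  have h1 := (mv X 0 (w + Pi.single k 0) (w j)).trans (mw X 0 _ (v i))
  rw [hz, hz, zero_add, zero_add, mul_comm (w j)] at h1
  have h2 := ((h1.trans (fold_add_entry_mul X v w k _ c)).trans (mv _ _ _ (-w j))).trans
    (mw _ _ _ (-v i))
  set t := (1 - X) * v k + X * w k + v i * w j with ht
  set X' := X + t * c with hX'
  set s := v i * w j - t * c * (w k - v k) - v i * w j with hs
  have e1 : v i * w j - t * c * (w k - v k) + v i * -w j = s := by rw [hs]; ring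
  have e2 : v i * w j - t * c * (w k - v k) + w j * -v i = s := by rw [hs]; ring
  rw [e1, e2] at h2
  have h3 := h2.trans (fold_add_entry_mul X' v w k s (-c))
  have e3 : (1 - X') * v k + X' * w k + s = (1 - X) * v k + X * w k := by
    rw [hs, hX']; ring
  rw [e3] at h3
  have h4 := (h3.trans (mv _ _ _ (w j * c * (w k - v k)))).trans
    (mw _ _ _ (v i * c * (w k - v k)))
  have e4 : s - ((1 - X) * v k + X * w k) * -c * (w k - v k) +
      v i * (w j * c * (w k - v k)) = 0 := by rw [hs, ht]; ring
  have e5 : s - ((1 - X) * v k + X * w k) * -c * (w k - v k) +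
      w j * (v i * c * (w k - v k)) = 0 := by rw [hs, ht]; ring
  rw [e4, e5, hz, hz] at h4
  convert h4 using 2
  rw [hX', ht]; ring

open scoped Pointwise in
theorem fold_of_sub_mem_mul (hn : 3 ≤ n) {X X' : A} {v w : Fin n → A}
    (h : X' - X ∈ Ideal.span (Set.range v) * Ideal.span (Set.range w)) :
    RowEquiv (fold X v w) (fold X' v w) := by
  rw [Ideal.span_mul_span'] at h
  suffices ∀ s ∈ Ideal.span (Set.range v * Set.range w), ∀ X c,
      RowEquiv (fold X v w) (fold (X + s * c) v w) by
    convert this _ h X 1 using 2; ring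
  intro s hs
  induction hs using Submodule.span_induction with
  | mem s hs =>
    obtain ⟨_, ⟨i, rfl⟩, _, ⟨j, rfl⟩, rfl⟩ := Set.mem_mul.1 hs
    exact fun X c => fold_add_mul_mul hn X v w i j c
  | zero => intro X c; simpa using RowEquiv.refl _
  | add s t _ _ h1 h2 =>
    intro X c
    have := (h1 X c).trans (h2 _ c)
    rwa [add_assoc, ← add_mul] at this
  | smul a s _ h1 =>
    intro X c
    convert h1 X (a * c) using 3
    rw [smul_eq_mul]; ring

end Fold

end UnimodularRows

namespace UnimodularRows

open Matrix

/-! ### Stable range for two rows at once. -/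

section StableRangePairs

variable {A : Type*} [CommRing A]

theorem StableRange.exists_of_finset {N : ℕ} (h : StableRange N A) {ι : Type} (s : Finset ι)
    (hs : N ≤ s.card) (a : ι → A) (J K : Ideal A)
    (H : ∀ M : Ideal A, M.IsMaximal → (∀ i ∈ s, a i ∈ M) → J ≤ M → K ≤ M → False) :
    ∃ e ∈ J, ∃ c : ι → A, (∀ i ∉ s, c i = 0) ∧
      ∀ M : Ideal A, M.IsMaximal → (∀ i ∈ s, a i + e * c i ∈ M) → K ≤ M → False := by
  classical
  obtain ⟨e, he, c, hc⟩ := h s (by simpa using hs) (fun i => a i) J K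
    (eq_top_of_maximal fun M hM hle => H M hM
      (fun i hi => hle (Ideal.mem_sup_left (Ideal.mem_sup_left (Ideal.subset_span ⟨⟨i, hi⟩, rfl⟩))))
      (le_trans (le_trans le_sup_right le_sup_left) hle) (le_trans le_sup_right hle))
  refine ⟨e, he, fun i => if hi : i ∈ s then c ⟨i, hi⟩ else 0, fun i hi => dif_neg hi, ?_⟩
  intro M hM h1 h2
  refine hM.ne_top (top_unique (hc ▸ sup_le (Ideal.span_le.2 ?_) h2))
  rintro _ ⟨⟨i, hi⟩, rfl⟩
  simpa [hi] using h1 i hi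

/-- The entries of both rows count together towards the stable range. Entries outside `s` and `t`
stay fixed, and `K` records conditions to be kept; the choice of `J` decides which changes are
admissible afterwards. -/
theorem StableRange.exists_pair {N : ℕ} (h : StableRange N A) {m n : ℕ} (s : Finset (Fin m))
    (t : Finset (Fin n)) (hs : N ≤ s.card + t.card) (v : Fin m → A) (w : Fin n → A) (J K : Ideal A)
    (H : ∀ M : Ideal A, M.IsMaximal → (∀ i ∈ s, v i ∈ M) → (∀ i ∈ t, w i ∈ M) → J ≤ M → K ≤ M →
      False) :
    ∃ e ∈ J, ∃ (c : Fin m → A) (d : Fin n → A), (∀ i ∉ s, c i = 0) ∧ (∀ i ∉ t, d i = 0) ∧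
      ∀ M : Ideal A, M.IsMaximal → (∀ i ∈ s, v i + e * c i ∈ M) → (∀ i ∈ t, w i + e * d i ∈ M) →
        K ≤ M → False := by
  obtain ⟨e, he, c, hc, hM⟩ := h.exists_of_finset (s.disjSum t) (by simpa using hs)
    (Sum.elim v w) J K (fun M hM h1 h2 h3 => H M hM
      (fun i hi => h1 (.inl i) (by simpa using hi)) (fun i hi => h1 (.inr i) (by simpa using hi))
      h2 h3)
  refine ⟨e, he, fun i => c (.inl i), fun i => c (.inr i), fun i hi => hc _ (by simpa using hi),
    fun i hi => hc _ (by simpa using hi), fun M hm h1 h2 h3 => hM M hm ?_ h3⟩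
  rintro (i | i) hi
  · exact h1 i (by simpa using hi)
  · exact h2 i (by simpa using hi)

end StableRangePairs

/-! ### Comaximal tails and admissible parameters. -/

section Config

variable {m n : ℕ} {A : Type*} [CommRing A]

/-- The ideal generated by the entries of a row. -/
def rowIdeal (v : Fin m → A) : Ideal A := Ideal.span (Set.range v)

theorem mem_rowIdeal (v : Fin m → A) (i : Fin m) : v i ∈ rowIdeal v := Ideal.subset_span ⟨i, rfl⟩

theorem mem_rowIdeal_iff {v : Fin m → A} {x : A} : x ∈ rowIdeal v ↔ ∃ c, v ⬝ᵥ c = x :=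
  mem_span_range_iff_exists_dotProduct

theorem rowIdeal_le {v : Fin m → A} {I : Ideal A} : rowIdeal v ≤ I ↔ ∀ i, v i ∈ I := by
  rw [rowIdeal, Ideal.span_le, Set.range_subset_iff]; rfl

theorem RowEquiv.rowIdeal_mono {v w : Fin m → A} (h : RowEquiv v w) : rowIdeal w ≤ rowIdeal v := by
  obtain ⟨M, _, rfl⟩ := h
  exact rowIdeal_le.2 fun i => mem_rowIdeal_iff.2 ⟨_, rfl⟩

theorem RowEquiv.rowIdeal_eq {v w : Fin m → A} (h : RowEquiv v w) : rowIdeal v = rowIdeal w :=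
  le_antisymm h.symm.rowIdeal_mono h.rowIdeal_mono

/-- The entries of `v` and `w` together generate the unit ideal. -/
def Comax (v : Fin m → A) (w : Fin n → A) : Prop :=
  ∀ M : Ideal A, M.IsMaximal → (∀ i, v i ∈ M) → (∀ i, w i ∈ M) → False

/-- `v` is unimodular modulo `x`. -/
def UnimodMod (x : A) (v : Fin m → A) : Prop :=
  ∀ M : Ideal A, M.IsMaximal → x ∈ M → (∀ i, v i ∈ M) → False

theorem Comax.symm {v : Fin m → A} {w : Fin n → A} (h : Comax v w) : Comax w v :=
  fun M hM h1 h2 => h M hM h2 h1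

theorem Comax.sup_eq_top {v : Fin m → A} {w : Fin n → A} (h : Comax v w) :
    rowIdeal v ⊔ rowIdeal w = ⊤ :=
  eq_top_of_maximal fun M hM hle => h M hM
    (fun i => hle (Ideal.mem_sup_left (mem_rowIdeal v i)))
    (fun i => hle (Ideal.mem_sup_right (mem_rowIdeal w i)))

theorem Comax.of_le {m' n' : ℕ} {v : Fin m → A} {w : Fin n → A} {v' : Fin m' → A}
    {w' : Fin n' → A} (h : Comax v w)
    (h' : rowIdeal v ⊔ rowIdeal w ≤ rowIdeal v' ⊔ rowIdeal w') : Comax v' w' :=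
  fun _ hM h1 h2 => hM.ne_top (top_unique (h.sup_eq_top ▸
    h'.trans (sup_le (rowIdeal_le.2 h1) (rowIdeal_le.2 h2))))

theorem UnimodMod.sup_eq_top {x : A} {v : Fin m → A} (h : UnimodMod x v) :
    Ideal.span {x} ⊔ rowIdeal v = ⊤ :=
  eq_top_of_maximal fun M hM hle => h M hM
    (hle (Ideal.mem_sup_left (Ideal.mem_span_singleton_self x)))
    (fun i => hle (Ideal.mem_sup_right (mem_rowIdeal v i)))

theorem UnimodMod.add_smul {x : A} {v : Fin m → A} (h : UnimodMod x v) (c : Fin m → A) :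
    UnimodMod x (v + x • c) :=
  fun M hM h1 h2 => h M hM h1 fun i =>
    (Ideal.add_mem_iff_left M (M.mul_mem_right (c i) h1)).1 (h2 i)

/-- `X` is a parameter for the product of `(x, v)` and `(y, w)`: the rows `(x, v)`, `(y, w)` can be
transformed to `(X, v)`, `(1 - X, w)`. -/
def Valid (x y : A) (v w : Fin n → A) (X : A) : Prop :=
  X - x ∈ rowIdeal v ∧ 1 - X - y ∈ rowIdeal w

theorem Valid.swap {x y : A} {v w : Fin n → A} {X : A} (h : Valid x y v w X) :
    Valid y x w v (1 - X) := ⟨h.2, by rw [sub_sub_cancel]; exact h.1⟩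

theorem Comax.exists_valid {v w : Fin n → A} (h : Comax v w) (x y : A) :
    ∃ X, Valid x y v w X := by
  obtain ⟨i, hi, j, hj, e⟩ := Submodule.mem_sup.1
    (h.sup_eq_top ▸ Submodule.mem_top : 1 - x - y ∈ rowIdeal v ⊔ rowIdeal w)
  refine ⟨x + i, by simpa using hi, ?_⟩
  rwa [show 1 - (x + i) - y = j by linear_combination -e]

/-- Two admissible parameters differ by an element of the intersection of the tail ideals. By
comaximality this is their product, where `fold_of_sub_mem_mul` applies. -/
theorem Valid.rowEquiv (hn : 3 ≤ n) {v w : Fin n → A} (h : Comax v w) {x y X X' : A}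
    (h1 : Valid x y v w X) (h2 : Valid x y v w X') : RowEquiv (fold X v w) (fold X' v w) := by
  refine fold_of_sub_mem_mul hn ?_
  change _ ∈ rowIdeal v * rowIdeal w
  rw [Ideal.mul_eq_inf_of_coprime h.sup_eq_top]
  refine ⟨?_, ?_⟩
  · rw [show X' - X = (X' - x) - (X - x) by ring]
    exact sub_mem h2.1 h1.1
  · rw [show X' - X = (1 - X - y) - (1 - X' - y) by ring]
    exact sub_mem h1.2 h2.2

/-- The comaximal pairs of tails `v, w` and `v', w'` give the same product for the heads
`x, y`. -/
def FoldEquiv (x y : A) (v w v' w' : Fin n → A) : Prop :=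
  Comax v w ∧ Comax v' w' ∧ ∃ X X', Valid x y v w X ∧ Valid x y v' w' X' ∧
    RowEquiv (fold X v w) (fold X' v' w')

namespace FoldEquiv

variable {x y : A} {v w v' w' v'' w'' : Fin n → A}

theorem refl (h : Comax v w) : FoldEquiv x y v w v w := by
  obtain ⟨X, hX⟩ := h.exists_valid x y
  exact ⟨h, h, X, X, hX, hX, .refl _⟩

theorem symm (h : FoldEquiv x y v w v' w') : FoldEquiv x y v' w' v w := by
  obtain ⟨h1, h2, X, X', h3, h4, h5⟩ := h
  exact ⟨h2, h1, X', X, h4, h3, h5.symm⟩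

theorem trans (hn : 3 ≤ n) (h : FoldEquiv x y v w v' w') (h' : FoldEquiv x y v' w' v'' w'') :
    FoldEquiv x y v w v'' w'' := by
  obtain ⟨h1, h2, X, X', h3, h4, h5⟩ := h
  obtain ⟨_, k2, Y, Y', k3, k4, k5⟩ := h'
  exact ⟨h1, k2, X, Y', h3, k4, h5.trans ((h4.rowEquiv hn h2 k3).trans k5)⟩

theorem swap (h : FoldEquiv x y v w v' w') : FoldEquiv y x w v w' v' := by
  obtain ⟨h1, h2, X, X', h3, h4, h5⟩ := h
  refine ⟨h1.symm, h2.symm, 1 - X, 1 - X', h3.swap, h4.swap, ?_⟩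
  rwa [← fold_symm, ← fold_symm]

theorem rowEquiv (hn : 3 ≤ n) (h : FoldEquiv x y v w v' w') {X X' : A} (hX : Valid x y v w X)
    (hX' : Valid x y v' w' X') : RowEquiv (fold X v w) (fold X' v' w') := by
  obtain ⟨h1, h2, Y, Y', h3, h4, h5⟩ := h
  exact (hX.rowEquiv hn h1 h3).trans (h5.trans (h4.rowEquiv hn h2 hX'))

theorem left (h : Comax v w) (hv : RowEquiv v v') : FoldEquiv x y v w v' w := by
  obtain ⟨X, hX⟩ := h.exists_valid x y
  refine ⟨h, h.of_le (by rw [hv.rowIdeal_eq]), X, X, hX, ⟨?_, hX.2⟩, fold_left X w hv⟩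
  rw [← hv.rowIdeal_eq]; exact hX.1

/-- The head `y` does not occur in `fold X v w`, but `1 - X = y + w γ` for some `γ`. Using an
auxiliary entry `l ≠ k`, the quantity `1 - X` can be added modulo the head and reduced by multiples
of entries of `w`, so that `y δ` is assembled in entry `k`. -/
theorem add_single_right (hn : 3 ≤ n) (h : Comax v w) (k : Fin n) {δ : A}
    (hδ : δ ∈ rowIdeal v) : FoldEquiv x y v w v (w + Pi.single k (y * δ)) := by
  obtain ⟨l, hlk⟩ : ∃ l, l ≠ k := by
    have : Nontrivial (Fin n) := Fin.nontrivial_iff_two_le.2 (by omega)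
    exact exists_ne k
  obtain ⟨X, hX, hX'⟩ := h.exists_valid x y
  obtain ⟨γ, hγ⟩ := mem_rowIdeal_iff.1 hX'
  have h' : Comax v (w + Pi.single k (y * δ)) := fun M hM h1 h2 => h M hM h1 fun i => by
    have h3 : (Pi.single k (y * δ) : Fin n → A) i ∈ M := by
      by_cases hi : i = k
      · subst hi; rw [Pi.single_eq_same]; exact M.mul_mem_left _ (rowIdeal_le.2 h1 hδ)
      · rw [Pi.single_eq_of_ne hi]; exact zero_mem _
    exact (Ideal.add_mem_iff_left M h3).1 (h2 i)
  let F : A → A → A → Fin (n + 1) → A := fun Y a b =>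
    fold (1 - Y) v (w + Pi.single k a + Pi.single l b)
  have mk : ∀ Y a b c, RowEquiv (F Y a b) (F Y (a + (w l + b) * c) b) := fun Y a b c =>
    fold_right _ _ ((RowEquiv.add_single _ hlk c).trans (.of_eq (by
      ext i
      by_cases hi : i = k
      · subst hi; simp [hlk, hlk.symm]; ring
      · by_cases hi' : i = l
        · subst hi'; simp [hlk]
        · simp [hi, hi'])))
  have ml : ∀ Y a b c, RowEquiv (F Y a b) (F Y a (b + (w k + a) * c)) := fun Y a b c =>
    fold_right _ _ ((RowEquiv.add_single _ hlk.symm c).trans (.of_eq (by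
      ext i
      by_cases hi : i = l
      · subst hi; simp [hlk, hlk.symm]; ring
      · by_cases hi' : i = k
        · subst hi'; simp [hlk.symm]
        · simp [hi, hi'])))
  have mY : ∀ Y a b c, RowEquiv (F Y a b) (F Y a (b + Y * c)) := fun Y a b c =>
    (fold_add_smul_right _ _ _ (Pi.single l c)).trans (.of_eq (by
      congr 1
      ext i
      by_cases hi : i = l
      · subst hi; simp; ring
      · simp [hi]))
  have mh : ∀ Y a b c, RowEquiv (F Y a b) (F (Y + δ * (w l + b) * c) a b) := fun Y a b c =>
    fold_of_sub_mem_mul hn (by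
      rw [show 1 - (Y + δ * (w l + b) * c) - (1 - Y) = (-c) * (δ * (w l + b)) by ring]
      refine Ideal.mul_mem_left _ _ (Ideal.mul_mem_mul hδ ?_)
      rw [← show (w + Pi.single k a + Pi.single l b : Fin n → A) l = w l + b by simp [hlk]]
      exact mem_rowIdeal _ l)
  let ω : A := w ⬝ᵥ Function.update γ k 0
  have hω : w ⬝ᵥ γ = ω + w k * γ k := by
    have : γ = Function.update γ k 0 + Pi.single k (γ k) := by
      ext i
      by_cases hi : i = k
      · subst hi; simp
      · simp [hi]
    conv_lhs => rw [this]
    rw [dotProduct_add, dotProduct_single]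
  -- Here `1 - X = y + ω + w_k γ_k`. The moves up to `s3` put `-ω δ` in entry `k` and `y + ω` in
  -- entry `l`; in `s4`, `δ` times entry `l` then leaves `(y + w_l) δ` in entry `k`. After the
  -- parameter is adjusted, entry `l` can be cleared and the surplus `w_l δ` removed.
  have s0 : RowEquiv (fold X v w) (F (1 - X - ω * δ * γ k) 0 0) := by
    simp only [F, Pi.single_zero, add_zero]
    refine fold_of_sub_mem_mul hn ?_
    rw [show 1 - (1 - X - ω * δ * γ k) - X = γ k * (δ * ω) by ring]
    exact Ideal.mul_mem_left _ _ (Ideal.mul_mem_mul hδ (mem_rowIdeal_iff.2 ⟨_, rfl⟩))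
  have s1 : RowEquiv (F (1 - X - ω * δ * γ k) 0 0) (F (1 - X - ω * δ * γ k) (-(ω * δ)) 0) := by
    simp only [F, Pi.single_zero, add_zero]
    refine fold_right _ _ ((RowEquiv.add_single_dot w (-(δ • Function.update γ k 0)) k
      (by simp)).trans (.of_eq ?_))
    rw [dotProduct_neg, dotProduct_smul, smul_eq_mul, mul_comm]
  have s2 := (s0.trans s1).trans (mY _ _ _ 1)
  have s3 := s2.trans (ml _ _ _ (-γ k))
  have s4 := s3.trans (mk _ _ _ δ)
  have s5 := s4.trans (mh _ _ _ (γ k))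
  have s6 := s5.trans (mY _ _ _ (-1))
  have s7 := s6.trans (ml _ _ _ (γ k))
  have s8 := s7.trans (mk _ _ _ (-δ))
  have s9 := s8.trans (mh _ _ _ (-γ k))
  have hy : X = 1 - (y + ω + w k * γ k) := by linear_combination hγ - hω
  generalize ω = ω at *
  refine ⟨h, h', X, X - y * δ * γ k, ⟨hX, hX'⟩, ⟨?_, ?_⟩, s9.trans (.of_eq ?_)⟩
  · rw [show X - y * δ * γ k - x = (X - x) - (y * γ k) * δ by ring]
    exact sub_mem hX (Ideal.mul_mem_left _ _ hδ)
  · refine mem_rowIdeal_iff.2 ⟨γ, ?_⟩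
    rw [add_dotProduct, hγ, single_dotProduct]
    ring
  · simp only [F]
    have hb : ∀ Y a b : A, b = 0 → fold (1 - Y) v (w + Pi.single k a + Pi.single l b) =
      fold (1 - Y) v (w + Pi.single k a) := by rintro Y a b rfl; simp
    rw [hb]
    · congr 1
      · rw [hy]; ring
      · congr 2; rw [hy]; ring
    · rw [hy]; ring

end FoldEquiv

end Config

end UnimodularRows

namespace UnimodularRows

open Matrix

/-! ### Independence of the choice of comaximal tails. -/

namespace FoldEquiv

variable {n : ℕ} {A : Type*} [CommRing A] {x y : A} {v w v' w' : Fin n → A}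

theorem add_smul_right (hn : 3 ≤ n) (h : Comax v w) {δ : Fin n → A}
    (hδ : ∀ i, δ i ∈ rowIdeal v) : FoldEquiv x y v w v (w + y • δ) := by
  have key : ∀ s : Finset (Fin n),
      FoldEquiv x y v w v (w + ∑ i ∈ s, Pi.single i (y * δ i)) := by
    intro s
    induction s using Finset.induction_on with
    | empty => simpa using refl h
    | insert i s his ih =>
      rw [Finset.sum_insert his, add_comm (Pi.single i _), ← add_assoc]
      exact ih.trans hn (add_single_right hn ih.2.1 i (hδ i))
  have := key Finset.univ
  have e : ∑ i, Pi.single i (y * δ i) = y • δ := Finset.univ_sum_single (y • δ)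
  rwa [e] at this

theorem add_smul_left (hn : 3 ≤ n) (h : Comax v w) {δ : Fin n → A}
    (hδ : ∀ i, δ i ∈ rowIdeal w) : FoldEquiv x y v w (v + x • δ) w :=
  (add_smul_right hn h.symm hδ).swap

/-- Change of the `j`-th entry when the other entries suffice for comaximality. -/
theorem add_single_left (h : Comax v w) (j : Fin n)
    (hj : Comax (Function.update v j 0) w) (c : A) :
    FoldEquiv x y v w (v + Pi.single j (x * c)) w := by
  obtain ⟨X, hX, hX'⟩ := hj.exists_valid x y
  obtain ⟨γ, hγ⟩ := mem_rowIdeal_iff.1 hX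
  have e : Function.update v j 0 ⬝ᵥ γ = v ⬝ᵥ Function.update γ j 0 :=
    Finset.sum_congr rfl fun i _ => by by_cases hi : i = j <;> simp [hi]
  have e' : (v + Pi.single j (x * c)) ⬝ᵥ Function.update γ j 0 = X - x := by
    rw [add_dotProduct, single_dotProduct, ← e, hγ]; simp
  rw [e] at hγ
  have h1 := RowEquiv.add_single_dot v (-c • Function.update γ j 0) j (by simp)
  rw [dotProduct_smul, hγ] at h1
  have h2 := (fold_left X w h1).trans (fold_add_smul_left X _ w (Pi.single j c))
  refine ⟨h, ?_, X, X, ⟨mem_rowIdeal_iff.2 ⟨_, hγ⟩, hX'⟩,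
    ⟨mem_rowIdeal_iff.2 ⟨_, e'⟩, hX'⟩, h2.trans (.of_eq ?_)⟩
  · refine hj.of_le (sup_le_sup_right (rowIdeal_le.2 fun i => ?_) _)
    by_cases hi : i = j
    · subst hi; simp
    · convert mem_rowIdeal (v + Pi.single j (x * c)) i using 1
      simp [hi]
  · congr 1
    ext i
    by_cases hi : i = j
    · subst hi; simp; ring
    · simp [hi]

theorem mem_of_add_mul_mem {M : Ideal A} {a b c : A} (hb : b ∈ M) (h : a + b * c ∈ M) : a ∈ M :=
  (Ideal.add_mem_iff_left M (M.mul_mem_right c hb)).1 h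

/-- Stable range reduces this to `add_single_left`. The other entries of `v` change by multiples of
`y v_j v'_j`, an elementary operation with pivot `j` for both the old and the new tail. The entries
of `w` change by `y` times elements of both tail ideals, which `add_smul_right` allows. -/
theorem add_single_left' (hn : 3 ≤ n) (hA : StableRange (n + 1) A) (hy : UnimodMod y w)
    (h : Comax v w) (j : Fin n) (c : A) (h' : Comax (v + Pi.single j (x * c)) w) :
    FoldEquiv x y v w (v + Pi.single j (x * c)) w := by
  set v' := v + Pi.single j (x * c) with hv'
  have hv'i : ∀ i, i ≠ j → v' i = v i := fun i hi => by simp [hv', hi]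
  obtain ⟨e, he, g, d, hg, -, hSR⟩ := hA.exists_pair (Finset.univ.erase j) Finset.univ
    (by simp; omega) v w (Ideal.span {y * (v j * v' j)}) ⊥ (fun M hM h1 h2 h3 _ => by
      have hwM : ∀ i, w i ∈ M := fun i => h2 i (Finset.mem_univ i)
      have hvM : ∀ i, i ≠ j → v i ∈ M := fun i hi => h1 i (by simp [hi])
      rcases hM.isPrime.mem_or_mem ((Ideal.span_singleton_le_iff_mem M).1 h3) with h4 | h4
      · exact hy M hM h4 hwM
      rcases hM.isPrime.mem_or_mem h4 with h5 | h5
      · refine h M hM (fun i => ?_) hwM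
        by_cases hi : i = j
        · exact hi ▸ h5
        · exact hvM i hi
      · refine h' M hM (fun i => ?_) hwM
        by_cases hi : i = j
        · exact hi ▸ h5
        · exact hv'i i hi ▸ hvM i hi)
  obtain ⟨t, rfl⟩ := Ideal.mem_span_singleton'.1 he
  have hgj : g j = 0 := hg j (by simp)
  let u := v + v j • ((t * y * v' j) • g)
  let u' := v' + v' j • ((t * y * v j) • g)
  have r1 : RowEquiv v u := .add_smul v _ j (by simp [hgj])
  have r2 : RowEquiv v' u' := .add_smul v' _ j (by simp [hgj])
  have hu' : u' = u + Pi.single j (x * c) := by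
    ext i
    by_cases hi : i = j
    · subst hi; simp [u, u', hgj, hv']
    · simp [u, u', hv'i i hi, hi]; ring
  have t1 : FoldEquiv x y v w u (w + y • ((t * v j * v' j) • d)) :=
    (left h r1).trans hn (add_smul_right hn (left (x := x) (y := y) h r1).2.1 fun i => by
      rw [← r1.rowIdeal_eq, Pi.smul_apply, smul_eq_mul, mul_assoc, mul_assoc, mul_left_comm]
      exact Ideal.mul_mem_right _ _ (mem_rowIdeal v j))
  have t2 : FoldEquiv x y v' w u' (w + y • ((t * v j * v' j) • d)) :=
    (left h' r2).trans hn (add_smul_right hn (left (x := x) (y := y) h' r2).2.1 fun i => by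
      rw [← r2.rowIdeal_eq, Pi.smul_apply, smul_eq_mul, mul_comm]
      exact Ideal.mul_mem_left _ _ (Ideal.mul_mem_left _ _ (mem_rowIdeal v' j)))
  refine (t1.trans hn ?_).trans hn t2.symm
  rw [hu']
  refine add_single_left t1.2.1 j (fun M hM h1 h2 => hSR M hM (fun i hi => ?_) (fun i _ => ?_)
    bot_le) c
  · have hi : i ≠ j := by simpa using hi
    have := h1 i
    rw [Function.update_of_ne hi] at this
    convert this using 1
    simp [u]; ring
  · convert h2 i using 1
    simp; ring

/-- Change of the tail `v` to a tail congruent to it modulo `x`. -/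
theorem add_smul_left_of_comax (hn : 3 ≤ n) (hA : StableRange (n + 1) A) (hy : UnimodMod y w)
    (h : Comax v w) (c : Fin n → A) (h' : Comax (v + x • c) w) :
    FoldEquiv x y v w (v + x • c) w := by
  suffices ∀ (s : Finset (Fin n)) (v w c : Fin n → A), (∀ i ∉ s, c i = 0) → UnimodMod y w →
      Comax v w → Comax (v + x • c) w → FoldEquiv x y v w (v + x • c) w from
    this Finset.univ v w c (fun i hi => (hi (Finset.mem_univ i)).elim) hy h h'
  intro s
  induction s using Finset.induction_on with
  | empty =>
    intro v w c hc hy h h'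
    have : c = 0 := funext fun i => hc i (Finset.notMem_empty i)
    subst this
    simpa using refl h
  | insert j s hjs ih =>
    intro v w c hc hy h h'
    -- Below, the `n` entries of `w` need at least one further free entry, indexed by `s`, to reach
    -- the stable range `n + 1`.
    obtain rfl | hs := s.eq_empty_or_nonempty
    · have : x • c = Pi.single j (x * c j) := by
        ext i
        by_cases hi : i = j
        · subst hi; simp
        · simp [hi, hc i (by simpa using hi)]
      rw [this] at h' ⊢
      exact add_single_left' hn hA hy h j _ h'
    set v1 := v + x • c with hv1
    have hv1i : ∀ i, i ∉ insert j s → v1 i = v i := fun i hi => by simp [hv1, hc i hi]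
    -- The ideal `K` holds the target entry at `j` and the entries that never move. The conclusion
    -- is thus comaximality after changing only entry `j`, the intermediate point for the induction.
    -- The factors `v_j` and `θ` of `e` make the perturbation admissible from the old and from the
    -- new tail.
    obtain ⟨e, he, g, d, hg, -, hSR⟩ := hA.exists_pair s Finset.univ
      (by have := hs.card_pos; simp; omega) v w
      (Ideal.span {y * v j} * Ideal.span (v1 '' s))
      (Ideal.span (insert (v1 j) (v '' {i | i ∉ insert j s}))) (fun M hM h1 h2 h3 h4 => by
        have hwM : ∀ i, w i ∈ M := fun i => h2 i (Finset.mem_univ i)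
        rw [Ideal.span_le] at h4
        have hjM : v1 j ∈ M := h4 (Set.mem_insert _ _)
        have hoM : ∀ i, i ∉ insert j s → v i ∈ M := fun i hi =>
          h4 (Set.mem_insert_of_mem _ ⟨i, hi, rfl⟩)
        rcases (Ideal.IsPrime.mul_le hM.isPrime).1 h3 with h5 | h5
        · rcases hM.isPrime.mem_or_mem ((Ideal.span_singleton_le_iff_mem M).1 h5) with h6 | h6
          · exact hy M hM h6 hwM
          · refine h M hM (fun i => ?_) hwM
            by_cases hi : i ∈ s
            · exact h1 i hi
            by_cases hi' : i = j
            · exact hi' ▸ h6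
            · exact hoM i (by simp [hi, hi'])
        · refine h' M hM (fun i => ?_) hwM
          by_cases hi : i ∈ s
          · exact h5 (Ideal.subset_span ⟨i, hi, rfl⟩)
          by_cases hi' : i = j
          · exact hi' ▸ hjM
          · rw [hv1i i (by simp [hi, hi'])]; exact hoM i (by simp [hi, hi']))
    obtain ⟨θ, hθ, rfl⟩ := Ideal.mem_span_singleton_mul.1 he
    have hθ' : θ ∈ rowIdeal v1 := Ideal.span_mono (Set.image_subset_range _ _) hθ
    have hgj : g j = 0 := hg j hjs
    let u := v + v j • ((y * θ) • g)
    let u1 := v1 + v1 j • ((y * θ) • g)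
    have r : RowEquiv v u := .add_smul v _ j (by simp [hgj])
    have r1 : RowEquiv v1 u1 := .add_smul v1 _ j (by simp [hgj])
    set w' := w + y • ((v j * θ) • d) with hw'
    have t : FoldEquiv x y v w u w' :=
      (left h r).trans hn (add_smul_right hn (left (x := x) (y := y) h r).2.1 fun i => by
        rw [← r.rowIdeal_eq, Pi.smul_apply, smul_eq_mul, mul_assoc]
        exact Ideal.mul_mem_right _ _ (mem_rowIdeal v j))
    have t1 : FoldEquiv x y v1 w u1 w' :=
      (left h' r1).trans hn (add_smul_right hn (left (x := x) (y := y) h' r1).2.1 fun i => by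
        rw [← r1.rowIdeal_eq, Pi.smul_apply, smul_eq_mul]
        exact Ideal.mul_mem_right _ _ (Ideal.mul_mem_left _ _ hθ'))
    have hyw' : UnimodMod y w' := hy.add_smul _
    have hu2 : Comax (u + Pi.single j (x * c j)) w' := fun M hM h1 h2 => by
      have hu : ∀ i, i ≠ j → u i ∈ M := fun i hi => by simpa [hi] using h1 i
      refine hSR M hM (fun i hi => ?_) (fun i _ => ?_) (Ideal.span_le.2 ?_)
      · convert hu i (fun e => hjs (e ▸ hi)) using 1
        simp [u]; ring
      · convert h2 i using 1
        simp [hw']; ring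
      · refine Set.insert_subset ?_ ?_
        · convert h1 j using 1
          simp [hv1, u, hgj]
        · rintro _ ⟨i, hi, rfl⟩
          have hi : i ∉ insert j s := hi
          rw [Finset.mem_insert, not_or] at hi
          convert hu i hi.1 using 1
          simp [u, hg i hi.2]
    have t2 := add_single_left' hn hA hyw' t.2.1 j (c j) hu2
    have hu1 : u1 = u + Pi.single j (x * c j) +
        x • Function.update (c + c j • ((y * θ) • g)) j 0 := by
      ext i
      by_cases hi : i = j
      · subst hi; simp [u, u1, hgj, hv1]
      · simp [u, u1, hi, hv1]; ring
    have t3 := ih (u + Pi.single j (x * c j)) w' (Function.update (c + c j • ((y * θ) • g)) j 0)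
      (fun i hi => by
        by_cases hij : i = j
        · subst hij; simp
        · simp [hij, hg i hi, hc i (by simp [hi, hij])]) hyw' hu2 (hu1 ▸ t1.2.1)
    rw [← hu1] at t3
    exact ((t.trans hn t2).trans hn t3).trans hn t1.symm

/-- The product only depends on the two rows up to changes of the tails modulo the heads. -/
theorem of_comax (hn : 3 ≤ n) (hA : StableRange (n + 1) A) (hx : UnimodMod x v)
    (hy : UnimodMod y w) (h : Comax v w) (c d : Fin n → A) (h' : Comax (v + x • c) (w + y • d)) :
    FoldEquiv x y v w (v + x • c) (w + y • d) := by
  have hx1 := hx.add_smul c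
  obtain ⟨v1, hv1⟩ : ∃ v1, v1 = v + x • c := ⟨_, rfl⟩
  obtain ⟨w1, hw1⟩ : ∃ w1, w1 = w + y • d := ⟨_, rfl⟩
  rw [← hv1] at hx1
  rw [← hv1, ← hw1] at h' ⊢
  -- The perturbation is divisible by `x y` and by some `θ` in the ideals of both `v` and `w1`. The
  -- perturbed pair then differs from each end by moves of the preceding kinds, one tail at a time.
  obtain ⟨e, he, a, b, -, -, hSR⟩ := hA.exists_pair Finset.univ Finset.univ (by simp; omega) v1 w
    (Ideal.span {x * y} * (rowIdeal v * rowIdeal w1)) ⊥ (fun M hM h1 h2 h3 _ => by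
      have hvM : ∀ i, v1 i ∈ M := fun i => h1 i (Finset.mem_univ i)
      have hwM : ∀ i, w i ∈ M := fun i => h2 i (Finset.mem_univ i)
      rcases (Ideal.IsPrime.mul_le hM.isPrime).1 h3 with h5 | h5
      · rcases hM.isPrime.mem_or_mem ((Ideal.span_singleton_le_iff_mem M).1 h5) with h6 | h6
        · exact hx1 M hM h6 hvM
        · exact hy M hM h6 hwM
      rcases (Ideal.IsPrime.mul_le hM.isPrime).1 h5 with h6 | h6
      · exact h M hM (rowIdeal_le.1 h6) hwM
      · exact h' M hM hvM (rowIdeal_le.1 h6))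
  obtain ⟨θ, hθ, rfl⟩ := Ideal.mem_span_singleton_mul.1 he
  have hθ1 : θ ∈ rowIdeal v := (Ideal.mul_le_left : rowIdeal v * rowIdeal w1 ≤ _) hθ
  have hθ2 : θ ∈ rowIdeal w1 := (Ideal.mul_le_right : rowIdeal v * rowIdeal w1 ≤ _) hθ
  have t1 : FoldEquiv x y v w v (w + y • ((x * θ) • b)) := add_smul_right hn h fun i => by
    rw [Pi.smul_apply, smul_eq_mul]
    exact Ideal.mul_mem_right _ _ (Ideal.mul_mem_left _ _ hθ1)
  have t4 : FoldEquiv x y v1 w1 (v1 + x • ((y * θ) • a)) w1 := add_smul_left hn h' fun i => by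
    rw [Pi.smul_apply, smul_eq_mul]
    exact Ideal.mul_mem_right _ _ (Ideal.mul_mem_left _ _ hθ2)
  have e1 : v1 + x • ((y * θ) • a) = v + x • (c + (y * θ) • a) := by
    rw [hv1, smul_add, add_assoc]
  have e2 : w1 = w + y • ((x * θ) • b) + y • (d - (x * θ) • b) := by
    rw [hw1, smul_sub, add_assoc, add_sub_cancel]
  have h2 : Comax (v1 + x • ((y * θ) • a)) (w + y • ((x * θ) • b)) := fun M hM h1 h2 => by
    refine hSR M hM (fun i _ => ?_) (fun i _ => ?_) bot_le
    · convert h1 i using 1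
      simp; ring
    · convert h2 i using 1
      simp; ring
  have t2 := add_smul_left_of_comax (x := x) hn hA (hy.add_smul _) t1.2.1 (c + (y * θ) • a)
    (by rw [← e1]; exact h2)
  rw [← e1] at t2
  have t3 := (add_smul_left_of_comax (x := y) hn hA (hx1.add_smul ((y * θ) • a)) h2.symm
    (d - (x * θ) • b) (by rw [← e2]; exact t4.2.1.symm)).swap
  rw [← e2] at t3
  exact ((t1.trans hn t2).trans hn t3).trans hn t4.symm

end FoldEquiv

end UnimodularRows

namespace UnimodularRows

open Matrix

/-! ### Products of rows and their invariance under elementary operations. -/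

section Product

variable {m n : ℕ} {A : Type*} [CommRing A]

/-- `r` represents the product of the rows `(x, v)` and `(y, w)`. -/
def IsProd (x : A) (v : Fin n → A) (y : A) (w : Fin n → A) (r : Fin (n + 1) → A) : Prop :=
  ∃ (c d : Fin n → A) (X : A), Comax (v + x • c) (w + y • d) ∧
    Valid x y (v + x • c) (w + y • d) X ∧ RowEquiv (fold X (v + x • c) (w + y • d)) r

variable {x y : A} {v w : Fin n → A} {r r' : Fin (n + 1) → A}

theorem IsProd.symm (h : IsProd x v y w r) : IsProd y w x v r := by
  obtain ⟨c, d, X, h1, h2, h3⟩ := h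
  exact ⟨d, c, 1 - X, h1.symm, h2.swap, by rwa [← fold_symm]⟩

theorem IsProd.unique (hn : 3 ≤ n) (hA : StableRange (n + 1) A) (hx : UnimodMod x v)
    (hy : UnimodMod y w) (h : IsProd x v y w r) (h' : IsProd x v y w r') : RowEquiv r r' := by
  obtain ⟨c, d, X, h1, h2, h3⟩ := h
  obtain ⟨c', d', X', h1', h2', h3'⟩ := h'
  have e1 : v + x • c' = v + x • c + x • (c' - c) := by rw [smul_sub]; abel
  have e2 : w + y • d' = w + y • d + y • (d' - d) := by rw [smul_sub]; abel
  have := FoldEquiv.of_comax hn hA (hx.add_smul c) (hy.add_smul d) h1 (c' - c) (d' - d)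
    (by rw [← e1, ← e2]; exact h1')
  rw [← e1, ← e2] at this
  exact h3.symm.trans ((this.rowEquiv hn h2 h2').trans h3')

/-- Comaximal tails exist, even without changing the `a`-th entry of the first one. -/
theorem exists_comax_add_smul (hn : 3 ≤ n) (hA : StableRange (n + 1) A) (hx : UnimodMod x v)
    (hy : UnimodMod y w) (a : Fin n) :
    ∃ c d : Fin n → A, c a = 0 ∧ Comax (v + x • c) (w + y • d) := by
  obtain ⟨e, he, c, d, hc, -, hSR⟩ := hA.exists_pair (Finset.univ.erase a) Finset.univ
    (by simp; omega) v w (Ideal.span {x * y}) (Ideal.span {v a}) (fun M hM h1 h2 h3 h4 => by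
      rw [Ideal.span_singleton_le_iff_mem] at h3 h4
      rcases hM.isPrime.mem_or_mem h3 with h | h
      · refine hx M hM h fun i => ?_
        by_cases hi : i = a
        · exact hi ▸ h4
        · exact h1 i (by simp [hi])
      · exact hy M hM h fun i => h2 i (Finset.mem_univ i))
  obtain ⟨t, rfl⟩ := Ideal.mem_span_singleton'.1 he
  have hca : c a = 0 := hc a (by simp)
  refine ⟨(t * y) • c, (t * x) • d, by simp [hca], fun M hM h1 h2 => hSR M hM (fun i _ => ?_)
    (fun i _ => ?_) ((Ideal.span_singleton_le_iff_mem M).2 ?_)⟩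
  · convert h1 i using 1
    simp; ring
  · convert h2 i using 1
    simp; ring
  · simpa [hca] using h1 a

theorem exists_isProd (hn : 3 ≤ n) (hA : StableRange (n + 1) A) (hx : UnimodMod x v)
    (hy : UnimodMod y w) : ∃ r, IsProd x v y w r := by
  obtain ⟨c, d, -, h⟩ := exists_comax_add_smul hn hA hx hy ⟨0, by omega⟩
  obtain ⟨X, hX⟩ := h.exists_valid x y
  exact ⟨_, c, d, X, h, hX, .refl _⟩

/-- Rows not contained in a maximal ideal. -/
def UniRow (p : Fin m → A) : Prop := ∀ M : Ideal A, M.IsMaximal → (∀ i, p i ∈ M) → False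

theorem uniRow_cons : UniRow (Fin.cons x v : Fin (n + 1) → A) ↔ UnimodMod x v := by
  simp only [UniRow, UnimodMod, Fin.forall_fin_succ, Fin.cons_zero, Fin.cons_succ]
  exact ⟨fun h M hM h1 h2 => h M hM ⟨h1, h2⟩, fun h M hM h1 => h M hM h1.1 h1.2⟩

theorem UniRow.rowIdeal_eq_top {p : Fin m → A} (h : UniRow p) : rowIdeal p = ⊤ :=
  eq_top_of_maximal fun M hM hle => h M hM (rowIdeal_le.1 hle)

theorem uniRow_iff {p : Fin m → A} : UniRow p ↔ ∃ w, p ⬝ᵥ w = 1 := by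
  rw [← mem_rowIdeal_iff, ← Ideal.eq_top_iff_one]
  exact ⟨UniRow.rowIdeal_eq_top, fun h M hM h1 => hM.ne_top (top_unique (h ▸ rowIdeal_le.2 h1))⟩

theorem RowEquiv.uniRow {p q : Fin m → A} (h : RowEquiv p q) (hp : UniRow p) : UniRow q :=
  fun _ hM hq => hM.ne_top (top_unique
    ((h.rowIdeal_eq ▸ hp.rowIdeal_eq_top : rowIdeal q = ⊤) ▸ rowIdeal_le.2 hq))

theorem IsProd.add_smul_tail (h : IsProd x v y w r) (b : Fin n → A) :
    IsProd x (v + x • b) y w r := by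
  obtain ⟨c, d, X, h⟩ := h
  refine ⟨c - b, d, X, ?_⟩
  rwa [smul_sub, show v + x • b + (x • c - x • b) = v + x • c by abel]

theorem IsProd.of_rowEquiv_tail (hn : 3 ≤ n) {v' : Fin n → A} (hv : RowEquiv v v')
    (h : IsProd x v y w r) : IsProd x v' y w r := by
  obtain ⟨M, hM, rfl⟩ := hv
  obtain ⟨c, d, X, h1, h2, h3⟩ := h
  have e : v ᵥ* M + x • (c ᵥ* M) = (v + x • c) ᵥ* M := by rw [add_vecMul, smul_vecMul]
  have t := FoldEquiv.left (x := x) (y := y) h1 (hM.rowEquiv (v + x • c))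
  obtain ⟨X', hX'⟩ := t.2.1.exists_valid x y
  refine ⟨c ᵥ* M, d, X', ?_⟩
  rw [e]
  exact ⟨t.2.1, hX', (t.rowEquiv hn h2 hX').symm.trans h3⟩

/-- Comaximal tails can be found without touching entry `a`. Then `v_a` stays in the tail ideal, so
the same parameter serves the head `x + v_a s`. The tails taken modulo the two heads differ by an
operation with pivot `a`. -/
theorem IsProd.add_entry_mul (hn : 3 ≤ n) (hA : StableRange (n + 1) A) (hx : UnimodMod x v)
    (hy : UnimodMod y w) (h : IsProd x v y w r) (a : Fin n) (s : A) :
    IsProd (x + v a * s) v y w r := by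
  obtain ⟨c, d, hca, h1⟩ := exists_comax_add_smul hn hA hx hy a
  obtain ⟨X, hX⟩ := h1.exists_valid x y
  have hr := IsProd.unique hn hA hx hy ⟨c, d, X, h1, hX, .refl _⟩ h
  have hva : (v + x • c) a = v a := by simp [hca]
  have hX' : Valid (x + v a * s) y (v + x • c) (w + y • d) X := by
    refine ⟨?_, hX.2⟩
    rw [← sub_sub]
    exact sub_mem hX.1 (Ideal.mul_mem_right _ _ (hva ▸ mem_rowIdeal (v + x • c) a))
  have hv : RowEquiv (v + x • c) (v + (x + v a * s) • c) := by
    refine (RowEquiv.add_smul _ (s • c) a (by simp [hca])).trans (.of_eq ?_)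
    rw [hva, add_smul, mul_smul, add_assoc]
  have t := FoldEquiv.left (x := x + v a * s) (y := y) h1 hv
  obtain ⟨X', h'⟩ := t.2.1.exists_valid (x + v a * s) y
  exact ⟨c, d, X', t.2.1, h', (t.rowEquiv hn hX' h').symm.trans hr⟩

/-- A transvection from head to tail is absorbed by the freedom modulo the head, one inside the tail
acts on `v` alone, and one from tail to head is `IsProd.add_entry_mul`. -/
theorem IsProd.of_rowEquiv (hn : 3 ≤ n) (hA : StableRange (n + 1) A) {x' : A} {v' : Fin n → A}
    (h : RowEquiv (Fin.cons x v : Fin (n + 1) → A) (Fin.cons x' v')) (hx : UnimodMod x v)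
    (hy : UnimodMod y w) (hr : IsProd x v y w r) : IsProd x' v' y w r := by
  suffices ∀ p q : Fin (n + 1) → A, RowEquiv p q → UniRow p →
      IsProd (p 0) (fun i => p i.succ) y w r → IsProd (q 0) (fun i => q i.succ) y w r from
    this _ _ h (uniRow_cons.2 hx) hr
  rintro p q ⟨M, hM, rfl⟩
  clear h hx hr
  revert p
  refine hM.induction (P := fun M => IsElem M ∧ ∀ p : Fin (n + 1) → A, UniRow p →
    IsProd (p 0) (fun i => p i.succ) y w r →
      IsProd ((p ᵥ* M) 0) (fun i => (p ᵥ* M) i.succ) y w r) ?_ ?_ ?_ |>.2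
  · exact ⟨.one, fun p _ hp => by simpa only [vecMul_one] using hp⟩
  · rintro M N ⟨e1, h1⟩ ⟨e2, h2⟩
    refine ⟨e1.mul e2, fun p hp hr => ?_⟩
    rw [← vecMul_vecMul]
    exact h2 _ ((e1.rowEquiv p).uniRow hp) (h1 p hp hr)
  · intro i j s hij
    refine ⟨.transvection hij s, fun p hp hr => ?_⟩
    obtain ⟨x, v, rfl⟩ : ∃ x v, p = Fin.cons x v := ⟨p 0, Fin.tail p, (Fin.cons_self_tail p).symm⟩
    rw [vecMul_transvection]
    rw [uniRow_cons] at hp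
    simp only [Fin.cons_zero, Fin.cons_succ] at hr
    obtain ⟨x', v', e, h⟩ : ∃ x' v', (Fin.cons x v + Pi.single j ((Fin.cons x v : Fin (n + 1) → A)
        i * s) : Fin (n + 1) → A) = Fin.cons x' v' ∧ IsProd x' v' y w r := by
      induction i using Fin.cases with
      | zero =>
        induction j using Fin.cases with
        | zero => exact (hij rfl).elim
        | succ b =>
          refine ⟨x, v + x • Pi.single b s, ?_, hr.add_smul_tail _⟩
          ext i
          refine Fin.cases ?_ (fun i => ?_) i
          · simp
          · simp only [Fin.cons_succ, Fin.cons_zero, Pi.add_apply, Pi.smul_apply, Pi.single_apply,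
              Fin.succ_inj, smul_eq_mul, mul_ite, mul_zero]
      | succ a =>
        induction j using Fin.cases with
        | zero =>
          refine ⟨x + v a * s, v, ?_, hr.add_entry_mul hn hA hp hy a s⟩
          ext i
          refine Fin.cases ?_ (fun i => ?_) i <;> simp
        | succ b =>
          have hab : a ≠ b := fun e => hij (e ▸ rfl)
          refine ⟨x, v + Pi.single b (v a * s), ?_, hr.of_rowEquiv_tail hn (.add_single v hab s)⟩
          ext i
          refine Fin.cases ?_ (fun i => ?_) i
          · simp
          · simp only [Fin.cons_succ, Pi.add_apply, Pi.single_apply, Fin.succ_inj]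
    rw [e]
    simpa using h

/-- If the heads already sum to `1`, the tails need not be comaximal: making them so changes them
modulo `X` and `1 - X`, which does not affect the class of the fold. -/
theorem isProd_fold (hn : 3 ≤ n) (hA : StableRange (n + 1) A) {X : A} (hx : UnimodMod X v)
    (hy : UnimodMod (1 - X) w) : IsProd X v (1 - X) w (fold X v w) := by
  obtain ⟨c, d, -, h⟩ := exists_comax_add_smul hn hA hx hy ⟨0, by omega⟩
  exact ⟨c, d, X, h, ⟨by simp, by simp⟩,
    ((fold_add_smul_left X v w c).trans (fold_add_smul_right X _ w d)).symm⟩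

theorem uniRow_fold {X : A} (hx : UnimodMod X v) (hy : UnimodMod (1 - X) w) :
    UniRow (fold X v w) := by
  unfold fold
  rw [uniRow_cons]
  intro M hM h1 h2
  have key : ∀ (X : A) (v w : Fin n → A), UnimodMod X v → X ∈ M →
      (∀ i, (1 - X) * v i + X * w i ∈ M) → False := fun X v w hx hX h => hx M hM hX fun i => by
    have h3 := FoldEquiv.mem_of_add_mul_mem hX (h i)
    refine (hM.isPrime.mem_or_mem h3).resolve_left fun h4 => hM.ne_top ?_
    rw [Ideal.eq_top_iff_one]
    simpa using M.add_mem h4 hX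
  rcases hM.isPrime.mem_or_mem h1 with h | h
  · exact key X v w hx h h2
  · refine key (1 - X) w v hy h fun i => ?_
    convert h2 i using 1
    simp; ring

end Product

/-! ### The multiplication on classes of unimodular rows. -/

section Class

variable {m n : ℕ} {A : Type*} [CommRing A]

/-- The element of `Um_m(A)` given by a unimodular row. -/
def UniRow.toUm {p : Fin m → A} (h : UniRow p) : Um m A := ⟨p, uniRow_iff.1 h⟩

theorem UniRow.toUm_val {p : Fin m → A} (h : UniRow p) : h.toUm.1 = p := rfl

open Classical in
/-- The class of a row modulo elementary operations (the base point if it is not unimodular). -/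
noncomputable def cls (p : Fin (n + 1) → A) : UmModE (n + 1) A :=
  if h : UniRow p then .mk h.toUm else .mk (baseRow n A)

theorem uniRow_val (p : Um m A) : UniRow p.1 := uniRow_iff.2 p.2

theorem mk_eq_cls (p : Um (n + 1) A) : UmModE.mk p = cls p.1 := by
  rw [cls, dif_pos (uniRow_val p)]; rfl

theorem mk_eq_mk_iff {p q : Um m A} : UmModE.mk p = UmModE.mk q ↔ RowEquiv p.1 q.1 := by
  refine Quotient.eq.trans ⟨?_, ?_⟩
  · rintro ⟨g, hg, rfl⟩
    exact ⟨g.1, ⟨g, hg, rfl⟩, rfl⟩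
  · rintro ⟨_, ⟨g, hg, rfl⟩, h⟩
    exact ⟨g, hg, Subtype.ext h⟩

theorem cls_eq_iff {p q : Fin (n + 1) → A} (hp : UniRow p) (hq : UniRow q) :
    cls p = cls q ↔ RowEquiv p q := by
  rw [cls, cls, dif_pos hp, dif_pos hq, mk_eq_mk_iff, hp.toUm_val, hq.toUm_val]

theorem RowEquiv.cls_eq {p q : Fin (n + 1) → A} (h : RowEquiv p q) : cls p = cls q := by
  by_cases hp : UniRow p
  · exact (cls_eq_iff hp (h.uniRow hp)).2 h
  · rw [cls, cls, dif_neg hp, dif_neg fun hq => hp (h.symm.uniRow hq)]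

theorem exists_cls_eq (α : UmModE (n + 1) A) : ∃ x v, UnimodMod x v ∧ cls (Fin.cons x v) = α := by
  induction α using Quotient.inductionOn with
  | h p =>
    refine ⟨p.1 0, Fin.tail p.1, ?_, ?_⟩
    · rw [← uniRow_cons, Fin.cons_self_tail]; exact uniRow_val p
    · rw [Fin.cons_self_tail]; exact (mk_eq_cls p).symm

/-- The product of classes of unimodular rows. -/
@[reducible]
noncomputable def umModEMul : Mul (UmModE (n + 1) A) where
  mul α β := Classical.epsilon (h := ⟨α⟩) fun γ => ∃ x v y w r, UnimodMod x v ∧ UnimodMod y w ∧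
    cls (Fin.cons x v) = α ∧ cls (Fin.cons y w) = β ∧ cls r = γ ∧ IsProd x v y w r

attribute [local instance] umModEMul

/-- Invariance of `IsProd` in both arguments, together with uniqueness of its value, makes the
choice in `umModEMul` immaterial. -/
theorem IsProd.cls_mul (hn : 3 ≤ n) (hA : StableRange (n + 1) A) {x y : A} {v w : Fin n → A}
    {r : Fin (n + 1) → A} (hx : UnimodMod x v) (hy : UnimodMod y w) (h : IsProd x v y w r) :
    cls (Fin.cons x v) * cls (Fin.cons y w) = cls r := by
  obtain ⟨x', v', y', w', r', h1, h2, h3, h4, h5, h6⟩ :=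
    Classical.epsilon_spec_aux (α := UmModE (n + 1) A) ⟨cls r⟩ (fun γ => ∃ x' v' y' w' r',
      UnimodMod x' v' ∧ UnimodMod y' w' ∧
      cls (Fin.cons x' v') = cls (Fin.cons x v : Fin (n + 1) → A) ∧
      cls (Fin.cons y' w') = cls (Fin.cons y w : Fin (n + 1) → A) ∧
      cls r' = γ ∧ IsProd x' v' y' w' r') ⟨cls r, x, v, y, w, r, hx, hy, rfl, rfl, rfl, h⟩
  refine Eq.trans h5.symm ?_
  rw [cls_eq_iff (uniRow_cons.2 h1) (uniRow_cons.2 hx)] at h3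
  rw [cls_eq_iff (uniRow_cons.2 h2) (uniRow_cons.2 hy)] at h4
  have h7 := ((h6.of_rowEquiv hn hA h3 h1 h2).symm.of_rowEquiv hn hA h4 h2 hx).symm
  exact (h7.unique hn hA hx hy h).cls_eq

theorem cls_mul_cls (hn : 3 ≤ n) (hA : StableRange (n + 1) A) {X : A} {v w : Fin n → A}
    (hx : UnimodMod X v) (hy : UnimodMod (1 - X) w) :
    cls (Fin.cons X v) * cls (Fin.cons (1 - X) w) = cls (fold X v w) :=
  (isProd_fold hn hA hx hy).cls_mul hn hA hx hy

theorem umModE_mul_comm (hn : 3 ≤ n) (hA : StableRange (n + 1) A) (α β : UmModE (n + 1) A) :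
    α * β = β * α := by
  obtain ⟨x, v, hx, rfl⟩ := exists_cls_eq α
  obtain ⟨y, w, hy, rfl⟩ := exists_cls_eq β
  obtain ⟨r, hr⟩ := exists_isProd hn hA hx hy
  rw [hr.cls_mul hn hA hx hy, hr.symm.cls_mul hn hA hy hx]

/-- Any two classes have representatives with a common tail and heads with sum one. -/
theorem exists_common_tail (hn : 3 ≤ n) (hA : StableRange (n + 1) A) (α β : UmModE (n + 1) A) :
    ∃ X u, UnimodMod X u ∧ UnimodMod (1 - X) u ∧ cls (Fin.cons X u) = α ∧
      cls (Fin.cons (1 - X) u) = β := by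
  obtain ⟨x, v, hx, rfl⟩ := exists_cls_eq α
  obtain ⟨y, w, hy, rfl⟩ := exists_cls_eq β
  obtain ⟨c, d, -, h⟩ := exists_comax_add_smul hn hA hx hy ⟨0, by omega⟩
  obtain ⟨X, hX⟩ := h.exists_valid x y
  set v1 := v + x • c with hv1
  set w1 := w + y • d with hw1
  -- The common tail is the folded one: it is congruent to `v1` modulo `X` and to `w1` modulo `1 -
  -- X`.
  have e1 : RowEquiv (Fin.cons x v : Fin (n + 1) → A) (Fin.cons X ((1 - X) • v1 + X • w1)) := by
    refine ((RowEquiv.cons_add_smul x v c).trans (.cons_of_sub_mem hX.1)).trans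
      ((RowEquiv.cons_add_smul X v1 (w1 - v1)).trans (.of_eq ?_))
    congr 1
    ext i; simp; ring
  have e2 : RowEquiv (Fin.cons y w : Fin (n + 1) → A)
      (Fin.cons (1 - X) ((1 - X) • v1 + X • w1)) := by
    refine ((RowEquiv.cons_add_smul y w d).trans (.cons_of_sub_mem hX.2)).trans
      ((RowEquiv.cons_add_smul (1 - X) w1 (v1 - w1)).trans (.of_eq ?_))
    congr 1
    ext i; simp; ring
  exact ⟨X, _, uniRow_cons.1 (e1.uniRow (uniRow_cons.2 hx)),
    uniRow_cons.1 (e2.uniRow (uniRow_cons.2 hy)), e1.cls_eq.symm, e2.cls_eq.symm⟩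

end Class

end UnimodularRows

namespace UnimodularRows

open Matrix

/-! ### The group axioms. -/

section Group

variable {m n k : ℕ} {A : Type*} [CommRing A]

attribute [local instance] umModEMul

theorem cls_cons_of_apply_eq_one {x : A} {v : Fin n → A} {a : Fin n} (h : v a = 1) :
    cls (Fin.cons x v : Fin (n + 1) → A) = cls (baseRow n A).1 := by
  have h1 : (1 : A) ∈ Ideal.span (Set.range v) := h ▸ mem_rowIdeal v a
  have h2 : 1 - x ∈ Ideal.span (Set.range v) := (Ideal.eq_top_iff_one _).2 h1 ▸ trivial
  exact ((RowEquiv.cons_of_sub_mem h2).trans (.cons_of_dvd fun i => one_dvd _)).cls_eq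

theorem unimodMod_of_apply_eq_one (x : A) {v : Fin n → A} {a : Fin n} (h : v a = 1) :
    UnimodMod x v := fun M hM _ h2 => hM.ne_top ((Ideal.eq_top_iff_one M).2 (h ▸ h2 a))

theorem exists_ne_fin (hn : 3 ≤ n) (b : Fin n) : ∃ a, a ≠ b := by
  have : Nontrivial (Fin n) := Fin.nontrivial_iff_two_le.2 (by omega)
  exact exists_ne b

theorem umModE_one_mul (hn : 3 ≤ n) (hA : StableRange (n + 1) A) (α : UmModE (n + 1) A) :
    cls (baseRow n A).1 * α = α := by
  obtain ⟨y, w, hy, rfl⟩ := exists_cls_eq α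
  obtain ⟨a, hab⟩ := exists_ne_fin hn ⟨0, by omega⟩
  set b : Fin n := ⟨0, by omega⟩
  let e : Fin n → A := Pi.single a 1
  have he : e a = 1 := by simp [e]
  have h := cls_mul_cls hn hA (unimodMod_of_apply_eq_one (1 - y) he) (w := w)
    (by rwa [sub_sub_cancel])
  rw [cls_cons_of_apply_eq_one he, sub_sub_cancel] at h
  rw [h]
  unfold fold
  rw [sub_sub_cancel]
  -- With the base class written as `(1 - y, e_a)`, the fold has head `(1 - y) y` and `a`-th tail
  -- entry `1 - (1 - y)(1 - w_a)`. The factor `1 - y` can therefore be moved to entry `b`, and what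
  -- remains agrees with `(y, w)` modulo `y`.
  refine RowEquiv.cls_eq ((RowEquiv.shift_cons hab (r := 1 - w a) ?_).trans
    (.cons_of_dvd fun i => ?_))
  · simp [e]; ring
  · by_cases hi : i = b
    · subst hi
      refine ⟨w b * (2 - y), ?_⟩
      simp [e, hab.symm]; ring
    · by_cases hia : i = a
      · subst hia
        refine ⟨w i - 1, ?_⟩
        simp [e, hi]; ring
      · refine ⟨w i, ?_⟩
        simp [e, hi, hia]; ring

theorem UnimodMod.of_dvd {x y : A} {v : Fin n → A} (h : UnimodMod x v) (hy : y ∣ x) :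
    UnimodMod y v := fun M hM h1 h2 => h M hM (M.mem_of_dvd hy h1) h2

/-- Splitting off a factor from the head of a row. -/
theorem cls_mul_head (hn : 3 ≤ n) (hA : StableRange (n + 1) A) {x y ξ : A} (hxy : y = 1 - x * ξ)
    {u : Fin n → A} (hu : UnimodMod (x * y) u) (b : Fin n) :
    cls (Fin.cons (x * y) u) =
      cls (Fin.cons x u) * cls (Fin.cons y (Function.update u b (x * u b))) := by
  obtain ⟨a, hab⟩ := exists_ne_fin hn b
  have hux : UnimodMod x u := hu.of_dvd (Dvd.intro _ rfl)
  -- This replaces `ξ` by `ξ' = 1 + x τ`, congruent to it modulo the entries of `u`, and `y` by `y'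
  -- = 1 - x ξ'`.
  obtain ⟨s, hs, t, ht, hst⟩ := Submodule.mem_sup.1
    (hux.sup_eq_top ▸ Submodule.mem_top : ξ - 1 ∈ Ideal.span {x} ⊔ rowIdeal u)
  obtain ⟨τ, rfl⟩ := Ideal.mem_span_singleton'.1 hs
  obtain ⟨k, rfl⟩ := mem_rowIdeal_iff.1 ht
  obtain ⟨ξ', hξ'⟩ : ∃ ξ', ξ' = 1 + x * τ := ⟨_, rfl⟩
  obtain ⟨y', hy'⟩ : ∃ y', y' = 1 - x * ξ' := ⟨_, rfl⟩
  have hyy : y' = y + x * (u ⬝ᵥ k) := by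
    rw [hy', hξ', hxy]; linear_combination -x * hst
  -- The tail `N` is made for the relation between `(x ξ', N)` and `(1 - x ξ', N)`. Its `a`-th entry
  -- is `1` modulo `ξ'`, so `ξ'` may leave the head for entry `b`. Then `N`, with entry `b`
  -- multiplied by `ξ'`, is `u` modulo `x y'`, while `N_b` itself is `x u_b` modulo `y'`.
  have hN : ∃ N : Fin n → A, N = Function.update (Function.update u a
    (u a - x * y' * τ * (1 - u a))) b ((1 - x ^ 2 * τ) * u b) := ⟨_, rfl⟩
  obtain ⟨N, hN⟩ := hN
  have hNa : N a = 1 - ξ' * ((1 - x ^ 2 * τ) * (1 - u a)) := by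
    rw [hN, Function.update_of_ne hab, Function.update_self, hy', hξ']; ring
  have hNb : N b = (1 - x ^ 2 * τ) * u b := by rw [hN, Function.update_self]
  have hNi : ∀ i, i ≠ a → i ≠ b → N i = u i := fun i h1 h2 => by
    rw [hN, Function.update_of_ne h2, Function.update_of_ne h1]
  have hdvd : ∀ z, z ∣ x * y' → ∀ i, z ∣ u i - Function.update N b (ξ' * N b) i := by
    rintro z hz i
    refine hz.trans ?_
    by_cases hi : i = b
    · subst hi
      refine ⟨-(u i * τ), ?_⟩
      rw [Function.update_self, hNb, hy', hξ']; ring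
    by_cases hi' : i = a
    · subst hi'
      refine ⟨τ * (1 - u i), ?_⟩
      rw [Function.update_of_ne hi, hNa, hy', hξ']; ring
    · rw [Function.update_of_ne hi, hNi i hi' hi, sub_self]; exact dvd_zero _
  have e1 : RowEquiv (Fin.cons (x * y) u : Fin (n + 1) → A)
      (Fin.cons (x * ξ' * (1 - x * ξ')) N) := by
    refine (RowEquiv.cons_of_sub_mem (y := x * y') ?_).trans (RowEquiv.symm ?_)
    · rw [hyy, show x * (y + x * (u ⬝ᵥ k)) - x * y = x ^ 2 * (u ⬝ᵥ k) by ring]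
      exact Ideal.mul_mem_left _ _ (mem_rowIdeal_iff.2 ⟨k, rfl⟩)
    · rw [← hy', show x * ξ' * y' = ξ' * (x * y') by ring]
      exact (RowEquiv.shift_cons hab hNa).trans (.cons_of_dvd (hdvd _ dvd_rfl))
  have e2 : RowEquiv (Fin.cons (x * ξ') N : Fin (n + 1) → A) (Fin.cons x u) := by
    rw [mul_comm x]
    exact (RowEquiv.shift_cons hab hNa).trans (.cons_of_dvd (hdvd _ (Dvd.intro _ rfl)))
  have e3 : RowEquiv (Fin.cons (1 - x * ξ') N : Fin (n + 1) → A)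
      (Fin.cons y (Function.update u b (x * u b))) := by
    rw [← hy']
    refine (RowEquiv.cons_of_dvd (w := Function.update u b (x * u b)) fun i => ?_).trans
      (.cons_of_sub_mem ?_)
    · by_cases hi : i = b
      · subst hi
        refine ⟨-u i, ?_⟩
        rw [Function.update_self, hNb, hy', hξ']; ring
      by_cases hi' : i = a
      · subst hi'
        refine ⟨x * τ * (1 - u i), ?_⟩
        rw [Function.update_of_ne hi, hNa, hy', hξ']; ring
      · rw [Function.update_of_ne hi, hNi i hi' hi, sub_self]; exact dvd_zero _
    · rw [hyy, sub_add_cancel_left, neg_mem_iff, dotProduct, Finset.mul_sum]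
      refine sum_mem fun i _ => ?_
      rw [← mul_assoc]
      refine Ideal.mul_mem_right _ _ ?_
      by_cases hi : i = b
      · subst hi
        have := mem_rowIdeal (Function.update u i (x * u i)) i
        rwa [Function.update_self] at this
      · have := mem_rowIdeal (Function.update u b (x * u b)) i
        rw [Function.update_of_ne hi] at this
        exact Ideal.mul_mem_left _ _ this
  have hNu := uniRow_cons.1 (e1.uniRow (uniRow_cons.2 hu))
  rw [e1.cls_eq, ← fold_self, ← cls_mul_cls hn hA (hNu.of_dvd (Dvd.intro _ rfl))
    (hNu.of_dvd (Dvd.intro_left _ rfl)), e2.cls_eq, e3.cls_eq]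

theorem umModE_exists_inv (hn : 3 ≤ n) (hA : StableRange (n + 1) A) (α : UmModE (n + 1) A) :
    ∃ β, α * β = cls (baseRow n A).1 := by
  obtain ⟨x, v, hx, rfl⟩ := exists_cls_eq α
  obtain ⟨s, hs, t, ht, hst⟩ := Submodule.mem_sup.1
    (hx.sup_eq_top ▸ Submodule.mem_top : (1 : A) ∈ Ideal.span {x} ⊔ rowIdeal v)
  obtain ⟨ξ, rfl⟩ := Ideal.mem_span_singleton'.1 hs
  -- Modulo the entries of `v`, `ξ` is inverse to `x`, so `z = 1 + x ξ² (1 - x)` satisfies `x z = 1`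
  -- there. It also has the shape `1 - x *` required by `cls_mul_head`, and `(x z, v)` is the base
  -- class.
  obtain ⟨z, hz⟩ : ∃ z, z = 1 - x * -(ξ ^ 2 * (1 - x)) := ⟨_, rfl⟩
  have h1 : 1 - x * z ∈ rowIdeal v := by
    rw [show 1 - x * z = (1 - x) * (1 + ξ * x) * t by
      rw [hz]; linear_combination (-(1 - x) * (1 + ξ * x)) * hst]
    exact Ideal.mul_mem_left _ _ ht
  have hu : UnimodMod (x * z) v := fun M hM h2 h3 => hM.ne_top ((Ideal.eq_top_iff_one M).2 (by
    have := M.add_mem (rowIdeal_le.2 h3 h1) h2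
    simpa using this))
  refine ⟨_, (cls_mul_head hn hA hz hu ⟨0, by omega⟩).symm.trans (RowEquiv.cls_eq ?_)⟩
  exact (RowEquiv.cons_of_sub_mem h1).trans (.cons_of_dvd fun i => one_dvd _)

theorem smul_cons_add_smul_cons (a b c d : A) (v w : Fin k → A) :
    a • (Fin.cons c v : Fin (k + 1) → A) + b • (Fin.cons d w : Fin (k + 1) → A) =
      Fin.cons (a * c + b * d) (a • v + b • w) := by
  ext i
  refine Fin.cases ?_ (fun i => ?_) i <;> simp

/-- The product in the second coordinate. -/
theorem cls_mul_cls_snd (hk : 2 ≤ k) (hA : StableRange (k + 1 + 1) A) {X Y : A} {v w : Fin k → A}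
    (hv : UnimodMod X (Fin.cons Y v : Fin (k + 1) → A))
    (hw : UnimodMod X (Fin.cons (1 - Y) w : Fin (k + 1) → A)) :
    UnimodMod X (Fin.cons (Y * (1 - Y)) ((1 - Y) • v + Y • w) : Fin (k + 1) → A) ∧
    cls (Fin.cons X (Fin.cons Y v : Fin (k + 1) → A)) *
      cls (Fin.cons X (Fin.cons (1 - Y) w : Fin (k + 1) → A)) =
      cls (Fin.cons X (Fin.cons (Y * (1 - Y)) ((1 - Y) • v + Y • w) : Fin (k + 1) → A)) := by
  have h1 := RowEquiv.swap_cons_cons X Y v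
  have h2 := RowEquiv.swap_cons_cons X (1 - Y) w
  have hv' := uniRow_cons.1 (h1.uniRow (uniRow_cons.2 hv))
  have hw' := uniRow_cons.1 (h2.uniRow (uniRow_cons.2 hw))
  have h3 := RowEquiv.swap_cons_cons X (Y * (1 - Y)) ((1 - Y) • v + Y • w)
  have e : fold Y (Fin.cons (-X) v : Fin (k + 1) → A) (Fin.cons (-X) w) =
      Fin.cons (Y * (1 - Y)) (Fin.cons (-X) ((1 - Y) • v + Y • w) : Fin (k + 1) → A) := by
    rw [fold, smul_cons_add_smul_cons, show (1 - Y) * -X + Y * -X = -X by ring]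
  refine ⟨uniRow_cons.1 (h3.symm.uniRow ?_), ?_⟩
  · rw [← e]; exact uniRow_fold hv' hw'
  · rw [h1.cls_eq, h2.cls_eq, h3.cls_eq, cls_mul_cls (by omega) hA hv' hw', e]

/-- The product in the first coordinate. -/
theorem cls_mul_cls_fst (hk : 2 ≤ k) (hA : StableRange (k + 1 + 1) A) {X Y : A} {v w : Fin k → A}
    (hv : UnimodMod X (Fin.cons Y v : Fin (k + 1) → A))
    (hw : UnimodMod (1 - X) (Fin.cons Y w : Fin (k + 1) → A)) :
    UnimodMod (X * (1 - X)) (Fin.cons Y ((1 - X) • v + X • w) : Fin (k + 1) → A) ∧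
    cls (Fin.cons X (Fin.cons Y v : Fin (k + 1) → A)) *
      cls (Fin.cons (1 - X) (Fin.cons Y w : Fin (k + 1) → A)) =
      cls (Fin.cons (X * (1 - X)) (Fin.cons Y ((1 - X) • v + X • w) : Fin (k + 1) → A)) := by
  have e : fold X (Fin.cons Y v : Fin (k + 1) → A) (Fin.cons Y w) =
      Fin.cons (X * (1 - X)) (Fin.cons Y ((1 - X) • v + X • w) : Fin (k + 1) → A) := by
    rw [fold, smul_cons_add_smul_cons, show (1 - X) * Y + X * Y = Y by ring]
  refine ⟨uniRow_cons.1 ?_, ?_⟩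
  · rw [← e]; exact uniRow_fold hv hw
  · rw [cls_mul_cls (by omega) hA hv hw, e]

theorem RowEquiv.cons_cons_add (x y : A) (v a b : Fin k → A) :
    RowEquiv (Fin.cons x (Fin.cons y v : Fin (k + 1) → A) : Fin (k + 1 + 1) → A)
      (Fin.cons x (Fin.cons y (v + (x • a + y • b)) : Fin (k + 1) → A)) := by
  refine ((RowEquiv.cons_add_smul y v b).cons_tail x).trans
    ((RowEquiv.cons_add_smul x _ (Fin.cons 0 a : Fin (k + 1) → A)).trans (.of_eq ?_))
  congr 1
  ext i
  refine Fin.cases ?_ (fun i => ?_) i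
  · simp
  · simp; ring

theorem RowEquiv.cons_cons_of_mem {x y : A} {v c : Fin k → A}
    (h : ∀ i, c i ∈ Ideal.span {x, y}) :
    RowEquiv (Fin.cons x (Fin.cons y v : Fin (k + 1) → A) : Fin (k + 1 + 1) → A)
      (Fin.cons x (Fin.cons y (v + c) : Fin (k + 1) → A)) := by
  choose a b hab using fun i => Ideal.mem_span_pair.1 (h i)
  refine (RowEquiv.cons_cons_add x y v a b).trans (.of_eq ?_)
  congr 2
  ext i
  simp [← hab, mul_comm]

theorem RowEquiv.cons_cons_of_sub_mem {x y x' y' : A} {v : Fin k → A} (hx : x' - x ∈ rowIdeal v)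
    (hy : y' - y ∈ rowIdeal v) :
    RowEquiv (Fin.cons x (Fin.cons y v : Fin (k + 1) → A) : Fin (k + 1 + 1) → A)
      (Fin.cons x' (Fin.cons y' v : Fin (k + 1) → A)) := by
  refine ((RowEquiv.cons_of_sub_mem hy).cons_tail x).trans (.cons_of_sub_mem ?_)
  refine (rowIdeal_le.2 fun i => ?_ : rowIdeal v ≤ _) hx
  exact Ideal.subset_span ⟨i.succ, by simp⟩

/-- `v` is unimodular modulo `x` and `y`. -/
theorem unimodMod_cons {x y : A} {v : Fin k → A} :
    UnimodMod x (Fin.cons y v : Fin (k + 1) → A) ↔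
      ∀ M : Ideal A, M.IsMaximal → Ideal.span {x, y} ≤ M → (∀ i, v i ∈ M) → False := by
  simp only [UnimodMod, Fin.forall_fin_succ, Fin.cons_zero, Fin.cons_succ, Ideal.span_le,
    Set.insert_subset_iff, Set.singleton_subset_iff, SetLike.mem_coe]
  exact ⟨fun h M hM h1 h2 => h M hM h1.1 ⟨h1.2, h2⟩, fun h M hM h1 h2 => h M hM ⟨h1, h2.1⟩ h2.2⟩

/-- Two tails of length `k` can be made comaximal. -/
theorem exists_comax_of_ideals (hk : 2 ≤ k) (hA : StableRange (k + 1 + 1) A) {v w : Fin k → A}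
    {P Q J : Ideal A} (hP : ∀ M : Ideal A, M.IsMaximal → P ≤ M → (∀ i, v i ∈ M) → False)
    (hQ : ∀ M : Ideal A, M.IsMaximal → Q ≤ M → (∀ i, w i ∈ M) → False)
    (hJ : ∀ M : Ideal A, M.IsMaximal → J ≤ M → (∀ i, v i ∈ M) → (∀ i, w i ∈ M) → False) :
    ∃ c d : Fin k → A, (∀ i, c i ∈ P ∧ c i ∈ J) ∧ (∀ i, d i ∈ Q ∧ d i ∈ J) ∧
      Comax (v + c) (w + d) := by
  -- Two entries are set aside in each row; the tails still have `2 k ≥ k + 2` entries together.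
  obtain ⟨e, he, c, d, -, -, hSR⟩ := hA.exists_pair Finset.univ Finset.univ (by simp; omega) v w
    (P * Q * J) ⊥ (fun M hM h1 h2 h3 _ => by
      rcases (Ideal.IsPrime.mul_le hM.isPrime).1 h3 with h | h
      · rcases (Ideal.IsPrime.mul_le hM.isPrime).1 h with h | h
        · exact hP M hM h fun i => h1 i (Finset.mem_univ i)
        · exact hQ M hM h fun i => h2 i (Finset.mem_univ i)
      · exact hJ M hM h (fun i => h1 i (Finset.mem_univ i)) fun i => h2 i (Finset.mem_univ i))
  have h1 : e ∈ J := (Ideal.mul_le_right : P * Q * J ≤ J) he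
  have h2 : e ∈ P * Q := (Ideal.mul_le_left : P * Q * J ≤ P * Q) he
  have h3 : e ∈ P := (Ideal.mul_le_left : P * Q ≤ P) h2
  have h4 : e ∈ Q := (Ideal.mul_le_right : P * Q ≤ Q) h2
  exact ⟨e • c, e • d, fun i => ⟨P.mul_mem_right _ h3, J.mul_mem_right _ h1⟩,
    fun i => ⟨Q.mul_mem_right _ h4, J.mul_mem_right _ h1⟩,
    fun M hM h5 h6 => hSR M hM (fun i _ => h5 i) (fun i _ => h6 i) bot_le⟩

theorem exists_cls_cons_cons_eq (α : UmModE (k + 1 + 1) A) :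
    ∃ x y v, UnimodMod x (Fin.cons y v : Fin (k + 1) → A) ∧
      cls (Fin.cons x (Fin.cons y v : Fin (k + 1) → A)) = α := by
  obtain ⟨x, v, h⟩ := exists_cls_eq α
  refine ⟨x, v 0, Fin.tail v, ?_⟩
  rwa [Fin.cons_self_tail]

theorem Comax.isCoprime {v w : Fin k → A} (h : Comax v w) :
    IsCoprime (rowIdeal v) (rowIdeal w) := Ideal.isCoprime_iff_sup_eq.2 h.sup_eq_top

theorem Comax.add_right {v w c : Fin k → A} (h : Comax v w) (hc : ∀ i, c i ∈ rowIdeal v) :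
    Comax v (w + c) := fun M hM h1 h2 => h M hM h1 fun i =>
  (Ideal.add_mem_iff_left M (rowIdeal_le.2 h1 (hc i))).1 (h2 i)

theorem exists_sub_mem_of_isCoprime {I J : Ideal A} (h : IsCoprime I J) (a b : A) :
    ∃ x, x - a ∈ I ∧ x - b ∈ J := by
  obtain ⟨i, hi, j, hj, e⟩ := Submodule.mem_sup.1
    (Ideal.isCoprime_iff_sup_eq.1 h ▸ Submodule.mem_top : b - a ∈ I ⊔ J)
  refine ⟨a + i, by simpa using hi, ?_⟩
  rw [show a + i - b = -j by linear_combination e]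
  exact neg_mem hj

theorem exists_sub_mem_of_comax {u v w : Fin k → A} (h1 : Comax u v) (h2 : Comax u w)
    (h3 : Comax v w) (a b c : A) :
    ∃ x, x - a ∈ rowIdeal u ∧ x - b ∈ rowIdeal v ∧ x - c ∈ rowIdeal w := by
  obtain ⟨y, hy1, hy2⟩ := exists_sub_mem_of_isCoprime h1.isCoprime a b
  obtain ⟨x, hx1, hx2⟩ := exists_sub_mem_of_isCoprime
    (h2.isCoprime.mul_left h3.isCoprime) y c
  refine ⟨x, ?_, ?_, hx2⟩
  · rw [← sub_add_sub_cancel x y a]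
    exact add_mem ((Ideal.mul_le_left : rowIdeal u * rowIdeal v ≤ _) hx1) hy1
  · rw [← sub_add_sub_cancel x y b]
    exact add_mem ((Ideal.mul_le_right : rowIdeal u * rowIdeal v ≤ _) hx1) hy2

/-- The interchange law. By the Chinese remainder theorem the rows become `(X, Y, v)`, `(X, 1-Y,
u)`, `(1-X, 1-Y, w)`; the fourth corner `(1-X, Y, 1, …)` is trivial. Folding this square first along
`X` and then along `Y`, or in the other order, gives the same row. -/
theorem umModE_mul_assoc_of_comax (hk : 2 ≤ k) (hA : StableRange (k + 1 + 1) A)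
    {p p' t t' z z' : A} {v u w : Fin k → A} (hp : UnimodMod p (Fin.cons p' v : Fin (k + 1) → A))
    (ht : UnimodMod t (Fin.cons t' u : Fin (k + 1) → A))
    (hz : UnimodMod z (Fin.cons z' w : Fin (k + 1) → A))
    (h1 : Comax v u) (h2 : Comax v w) (h3 : Comax u w) :
    cls (Fin.cons p (Fin.cons p' v : Fin (k + 1) → A)) *
      cls (Fin.cons t (Fin.cons t' u : Fin (k + 1) → A)) *
      cls (Fin.cons z (Fin.cons z' w : Fin (k + 1) → A)) =
    cls (Fin.cons p (Fin.cons p' v : Fin (k + 1) → A)) *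
      (cls (Fin.cons t (Fin.cons t' u : Fin (k + 1) → A)) *
      cls (Fin.cons z (Fin.cons z' w : Fin (k + 1) → A))) := by
  obtain ⟨X, x1, x2, x3⟩ := exists_sub_mem_of_comax h1 h2 h3 p t (1 - z)
  obtain ⟨Y, y1, y2, y3⟩ := exists_sub_mem_of_comax h1 h2 h3 p' (1 - t') (1 - z')
  have neg : ∀ {I : Ideal A} {a b : A}, a - (1 - b) ∈ I → 1 - a - b ∈ I := fun {I a b} h => by
    rw [show 1 - a - b = -(a - (1 - b)) by ring]; exact neg_mem h
  have ep := RowEquiv.cons_cons_of_sub_mem x1 y1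
  have et := RowEquiv.cons_cons_of_sub_mem x2 (neg y2)
  have ez := RowEquiv.cons_cons_of_sub_mem (neg x3) (neg y3)
  replace hp := uniRow_cons.1 (ep.uniRow (uniRow_cons.2 hp))
  replace ht := uniRow_cons.1 (et.uniRow (uniRow_cons.2 ht))
  replace hz := uniRow_cons.1 (ez.uniRow (uniRow_cons.2 hz))
  rw [ep.cls_eq, et.cls_eq, ez.cls_eq]
  have ho : (Fin.cons Y 1 : Fin (k + 1) → A) (Fin.succ ⟨0, by omega⟩) = 1 :=
    Fin.cons_succ _ _ _
  have he := unimodMod_of_apply_eq_one (1 - X) ho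
  have hn : 3 ≤ k + 1 := by omega
  obtain ⟨a1, a2⟩ := cls_mul_cls_fst hk hA hp he
  obtain ⟨b1, b2⟩ := cls_mul_cls_fst hk hA ht hz
  obtain ⟨c1, c2⟩ := cls_mul_cls_snd hk hA hp ht
  obtain ⟨d1, d2⟩ := cls_mul_cls_snd hk hA he hz
  rw [cls_cons_of_apply_eq_one ho, umModE_mul_comm hn hA, umModE_one_mul hn hA] at a2
  rw [cls_cons_of_apply_eq_one ho, umModE_one_mul hn hA] at d2
  rw [b2, c2, a2, d2, (cls_mul_cls_fst hk hA c1 d1).2, (cls_mul_cls_snd hk hA a1 b1).2]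
  congr 3
  ext i
  simp only [Pi.add_apply, Pi.smul_apply, smul_eq_mul]
  ring

theorem umModE_mul_assoc (hn : 3 ≤ n) (hA : StableRange (n + 1) A) (α γ δ : UmModE (n + 1) A) :
    α * γ * δ = α * (γ * δ) := by
  obtain ⟨k, rfl⟩ : ∃ k, n = k + 1 := ⟨n - 1, by omega⟩
  have hk : 2 ≤ k := by omega
  obtain ⟨p, p', v, hp, rfl⟩ := exists_cls_cons_cons_eq α
  obtain ⟨t, t', u, ht, rfl⟩ := exists_cls_cons_cons_eq γ
  obtain ⟨z, z', w, hz, rfl⟩ := exists_cls_cons_cons_eq δ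
  have mv : ∀ {x y : A} {v c : Fin k → A}, UnimodMod x (Fin.cons y v : Fin (k + 1) → A) →
      (∀ i, c i ∈ Ideal.span {x, y}) →
      UnimodMod x (Fin.cons y (v + c) : Fin (k + 1) → A) ∧
        cls (Fin.cons x (Fin.cons y v : Fin (k + 1) → A)) =
          cls (Fin.cons x (Fin.cons y (v + c) : Fin (k + 1) → A)) := fun h hc =>
    have e := RowEquiv.cons_cons_of_mem hc
    ⟨uniRow_cons.1 (e.uniRow (uniRow_cons.2 h)), e.cls_eq⟩
  obtain ⟨c, d, hc, hd, h1⟩ := exists_comax_of_ideals (J := ⊤) hk hA (unimodMod_cons.1 hp)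
    (unimodMod_cons.1 ht) (fun M hM h => (hM.ne_top (top_unique h)).elim)
  obtain ⟨hp, ep⟩ := mv hp fun i => (hc i).1
  obtain ⟨ht, et⟩ := mv ht fun i => (hd i).1
  rw [ep, et]
  clear ep et hc hd
  generalize v + c = v at *
  generalize u + d = u at *
  -- Taking changes in the ideal of `u` keeps `v` and `u` comaximal; in the next round the changes
  -- lie in the ideal of `v`, preserving both earlier relations.
  obtain ⟨c, d, hc, hd, h2⟩ := exists_comax_of_ideals (J := rowIdeal u) hk hA
    (unimodMod_cons.1 hp) (unimodMod_cons.1 hz)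
    (fun M hM h h' _ => h1 M hM h' (rowIdeal_le.1 h))
  obtain ⟨hp, ep⟩ := mv hp fun i => (hc i).1
  obtain ⟨hz, ez⟩ := mv hz fun i => (hd i).1
  rw [ep, ez]
  replace h1 := (h1.symm.add_right fun i => (hc i).2).symm
  clear ep ez hc hd
  generalize v + c = v at *
  generalize w + d = w at *
  obtain ⟨c, d, hc, hd, h3⟩ := exists_comax_of_ideals (J := rowIdeal v) hk hA
    (unimodMod_cons.1 ht) (unimodMod_cons.1 hz)
    (fun M hM h h' _ => h1 M hM (rowIdeal_le.1 h) h')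
  obtain ⟨ht, et⟩ := mv ht fun i => (hc i).1
  obtain ⟨hz, ez⟩ := mv hz fun i => (hd i).1
  rw [et, ez]
  exact umModE_mul_assoc_of_comax hk hA hp ht hz (h1.add_right fun i => (hc i).2)
    (h2.add_right fun i => (hd i).2) h3

/-- The group structure on `Um_{n+1}(A)/E_{n+1}(A)`. -/
@[reducible]
noncomputable def umModEGroup (hn : 3 ≤ n) (hA : StableRange (n + 1) A) :
    CommGroup (UmModE (n + 1) A) where
  mul_assoc := umModE_mul_assoc hn hA
  one := .mk (baseRow n A)
  one_mul α := by
    change UmModE.mk (baseRow n A) * α = α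
    rw [mk_eq_cls, umModE_one_mul hn hA]
  mul_one α := by
    change α * UmModE.mk (baseRow n A) = α
    rw [umModE_mul_comm hn hA, mk_eq_cls, umModE_one_mul hn hA]
  inv α := (umModE_exists_inv hn hA α).choose
  inv_mul_cancel α := by
    change _ = UmModE.mk (baseRow n A)
    rw [umModE_mul_comm hn hA, mk_eq_cls]
    exact (umModE_exists_inv hn hA α).choose_spec
  mul_comm := umModE_mul_comm hn hA

end Group

/-! ### Comparison with the universal weak Mennicke symbol. -/

section WMS

variable {n : ℕ} {A : Type*} [CommRing A]

attribute [local instance] umModEMul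

theorem wmsMap_mk (p : Um (n + 1) A) :
    wmsMap n A (UmModE.mk p) = PresentedGroup.of (rels := wmsRels n A) p := rfl

/-- Representatives with a common tail and heads `X`, `1 - X` turn the product into an instance of
the defining relation of `WMS`. -/
theorem wmsMap_mul (hn : 3 ≤ n) (hA : StableRange (n + 1) A) (α β : UmModE (n + 1) A) :
    wmsMap n A (α * β) = wmsMap n A α * wmsMap n A β := by
  obtain ⟨X, u, h1, h2, rfl, rfl⟩ := exists_common_tail hn hA β α
  have h3 := uniRow_fold h1 h2
  rw [umModE_mul_comm hn hA, cls_mul_cls hn hA h1 h2]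
  rw [fold_self] at h3 ⊢
  have e : ∀ {p : Fin (n + 1) → A} (h : UniRow p), cls p = .mk h.toUm := fun h => dif_pos h
  rw [e h3, e (uniRow_cons.2 h1), e (uniRow_cons.2 h2), wmsMap_mk, wmsMap_mk, wmsMap_mk]
  have := PresentedGroup.one_of_mem (rels := wmsRels n A) (Or.inr ⟨X, u, (uniRow_cons.2 h2).toUm,
    (uniRow_cons.2 h1).toUm, h3.toUm, rfl, rfl, rfl, rfl⟩)
  rw [map_mul, map_inv, mul_inv_eq_one, map_mul] at this
  exact this.symm

/-- The isomorphism `wms`. -/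
noncomputable def wmsEquiv (hn : 3 ≤ n) (hA : StableRange (n + 1) A) :
    letI := umModEGroup hn hA
    UmModE (n + 1) A ≃* WMS n A :=
  letI := umModEGroup hn hA
  have key : ∀ r ∈ wmsRels n A,
      FreeGroup.lift (UmModE.mk : Um (n + 1) A → UmModE (n + 1) A) r = 1 := by
    rintro r (⟨v, g, hg, rfl⟩ | ⟨x, v, p, q, s, hp, hq, hs, rfl⟩)
    · rw [map_mul, map_inv, FreeGroup.lift_apply_of, FreeGroup.lift_apply_of, mul_inv_eq_one]
      exact Quotient.sound ⟨g, hg, rfl⟩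
    · rw [map_mul, map_inv, map_mul, FreeGroup.lift_apply_of, FreeGroup.lift_apply_of,
        FreeGroup.lift_apply_of, mul_inv_eq_one, mul_comm, mk_eq_cls, mk_eq_cls, mk_eq_cls,
        hp, hq, hs, ← fold_self]
      refine cls_mul_cls hn hA (uniRow_cons.1 ?_) (uniRow_cons.1 ?_)
      · rw [← hq]; exact uniRow_val q
      · rw [← hp]; exact uniRow_val p
  { toFun := wmsMap n A
    invFun := PresentedGroup.toGroup key
    left_inv := fun α => by
      induction α using Quotient.inductionOn with
      | h p => exact PresentedGroup.toGroup.of key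
    right_inv := fun x => by
      let ψ : UmModE (n + 1) A →* WMS n A :=
        MonoidHom.mk' (wmsMap n A) (wmsMap_mul hn hA)
      have : ψ.comp (PresentedGroup.toGroup key) = MonoidHom.id _ :=
        PresentedGroup.ext fun p => by
          rw [MonoidHom.comp_apply, PresentedGroup.toGroup.of]; rfl
      exact DFunLike.congr_fun this x
    map_mul' := wmsMap_mul hn hA }

end WMS

end UnimodularRows

namespace UnimodularRows

open Matrix

/-! ### Diagonal times elementary matrices, and Schur complements. -/

section GE

variable {k : ℕ} {R : Type*} [CommRing R]

theorem IsElem.det {M : Matrix (Fin k) (Fin k) R} (hM : IsElem M) : M.det = 1 := by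
  obtain ⟨g, _, rfl⟩ := hM
  exact g.2

/-- Whitehead's lemma for diagonal matrices of size two. -/
theorem IsElem.diagonal {i j : Fin k} (hij : i ≠ j) {a b : R} (hab : a * b = 1) :
    IsElem (Matrix.diagonal (Function.update (Function.update 1 i a) j b)) := by
  have h : IsElem (Matrix.transvection i j a * Matrix.transvection j i (-b) *
      Matrix.transvection i j a * Matrix.transvection i j (-1) * Matrix.transvection j i 1 *
      Matrix.transvection i j (-1)) :=
    ((((((IsElem.transvection hij a).mul (.transvection hij.symm (-b))).mul
      (.transvection hij a)).mul (.transvection hij (-1))).mul (.transvection hij.symm 1)).mul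
      (.transvection hij (-1)))
  convert h using 1
  refine Matrix.ext_of_single_vecMul fun l => ?_
  generalize (Pi.single l 1 : Fin k → R) = p
  simp only [← vecMul_vecMul, vecMul_transvection]
  ext m
  rw [vecMul_diagonal]
  by_cases hmj : m = j
  · subst hmj
    simp [hij, hij.symm]
    linear_combination (-p i) * hab
  by_cases hmi : m = i
  · subst hmi
    simp [hij, hij.symm]
    linear_combination (a * p m + p j) * hab
  simp [hmi, hmj]

/-- The diagonal matrix with given units on the diagonal. -/
def unitDiagonal (u : Fin k → Rˣ) : Matrix (Fin k) (Fin k) R :=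
  Matrix.diagonal fun i => (u i : R)

theorem unitDiagonal_mul (u v : Fin k → Rˣ) :
    unitDiagonal (u * v) = unitDiagonal u * unitDiagonal v := by
  unfold unitDiagonal
  rw [diagonal_mul_diagonal]
  simp

theorem unitDiagonal_one : unitDiagonal (1 : Fin k → Rˣ) = 1 := by
  simp [unitDiagonal]

theorem IsElem.mul_unitDiagonal {M : Matrix (Fin k) (Fin k) R} (hM : IsElem M) (u : Fin k → Rˣ) :
    ∃ N, IsElem N ∧ M * unitDiagonal u = unitDiagonal u * N := by
  refine hM.induction (P := fun M => ∃ N, IsElem N ∧ M * unitDiagonal u = unitDiagonal u * N)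
    ⟨1, .one, by simp⟩ ?_ ?_
  · rintro M M' ⟨N, h1, h2⟩ ⟨N', h1', h2'⟩
    exact ⟨N * N', h1.mul h1', by rw [mul_assoc, h2', ← mul_assoc, h2, mul_assoc]⟩
  · intro i j c hij
    refine ⟨_, .transvection hij (((u i)⁻¹ : Rˣ) * c * u j), ?_⟩
    simp only [Matrix.transvection, mul_add, add_mul, one_mul, mul_one]
    congr 1
    ext a b
    rw [unitDiagonal, Matrix.mul_diagonal, Matrix.diagonal_mul, single_apply, single_apply]
    split_ifs with h
    · obtain ⟨rfl, rfl⟩ := h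
      rw [← mul_assoc, ← mul_assoc, Units.mul_inv, one_mul]
    · simp

/-- Products of an invertible diagonal matrix and an elementary one. -/
def IsGE (M : Matrix (Fin k) (Fin k) R) : Prop :=
  ∃ (u : Fin k → Rˣ) (N : Matrix (Fin k) (Fin k) R), IsElem N ∧ M = unitDiagonal u * N

theorem IsElem.isGE {M : Matrix (Fin k) (Fin k) R} (hM : IsElem M) : IsGE M :=
  ⟨1, M, hM, by rw [unitDiagonal_one, one_mul]⟩

theorem isGE_unitDiagonal (u : Fin k → Rˣ) : IsGE (unitDiagonal u) :=
  ⟨u, 1, .one, by simp⟩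

theorem IsGE.mul {M M' : Matrix (Fin k) (Fin k) R} (h : IsGE M) (h' : IsGE M') : IsGE (M * M') := by
  obtain ⟨u, N, hN, rfl⟩ := h
  obtain ⟨u', N', hN', rfl⟩ := h'
  obtain ⟨N1, hN1, e⟩ := hN.mul_unitDiagonal u'
  refine ⟨u * u', N1 * N', hN1.mul hN', ?_⟩
  rw [mul_assoc, ← mul_assoc N, e, unitDiagonal_mul, mul_assoc, mul_assoc]

theorem blockMatrix_unitDiagonal (u : Fin k → Rˣ) :
    blockMatrix (unitDiagonal u) = unitDiagonal (Fin.cons 1 u) := by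
  ext i j
  refine Fin.cases ?_ (fun i => ?_) i <;> refine Fin.cases ?_ (fun j => ?_) j <;>
    simp [blockMatrix, unitDiagonal, Matrix.diagonal_apply, Fin.succ_ne_zero,
      (Fin.succ_ne_zero _).symm]

theorem IsGE.blockMatrix {M : Matrix (Fin k) (Fin k) R} (h : IsGE M) : IsGE (blockMatrix M) := by
  obtain ⟨u, N, hN, rfl⟩ := h
  exact ⟨Fin.cons 1 u, _, hN.blockMatrix, by rw [blockMatrix_mul, blockMatrix_unitDiagonal]⟩

/-- A matrix in `IsGE` is determined by its determinant up to elementary matrices. -/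
theorem IsGE.exists_eq {M : Matrix (Fin k) (Fin k) R} (h : IsGE M) (j : Fin k) :
    ∃ N, IsElem N ∧ M = Matrix.diagonal (Function.update 1 j M.det) * N := by
  obtain ⟨u, N, hN, rfl⟩ := h
  have h1 : ∀ i (c : Rˣ), ∃ N, IsElem N ∧
      unitDiagonal (Pi.mulSingle i c) = N * unitDiagonal (Pi.mulSingle j c) := by
    intro i c
    by_cases hij : i = j
    · subst hij; exact ⟨1, .one, by simp⟩
    · refine ⟨_, .diagonal hij c.mul_inv, ?_⟩
      unfold unitDiagonal
      rw [diagonal_mul_diagonal]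
      congr 1
      ext l
      by_cases hl : l = j
      · subst hl; simp [Ne.symm hij]
      · by_cases hl' : l = i
        · subst hl'; simp [hij]
        · simp [hl, hl']
  have key : ∀ s : Finset (Fin k), ∃ N, IsElem N ∧
      unitDiagonal (∏ i ∈ s, Pi.mulSingle i (u i)) =
        unitDiagonal (Pi.mulSingle j (∏ i ∈ s, u i)) * N := by
    intro s
    induction s using Finset.induction_on with
    | empty => exact ⟨1, .one, by simp⟩
    | insert i s his ih =>
      obtain ⟨N', hN', e⟩ := ih
      obtain ⟨N1, hN1, e1⟩ := h1 i (u i)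
      obtain ⟨N2, hN2, e2⟩ := hN1.mul_unitDiagonal (Pi.mulSingle j (u i * ∏ i ∈ s, u i))
      refine ⟨N2 * N', hN2.mul hN', ?_⟩
      rw [Finset.prod_insert his, Finset.prod_insert his, unitDiagonal_mul, e, e1, ← mul_assoc,
        mul_assoc N1, ← unitDiagonal_mul, ← Pi.mulSingle_mul, e2, mul_assoc]
  obtain ⟨N', hN', e⟩ := key Finset.univ
  rw [Finset.univ_prod_mulSingle] at e
  refine ⟨N' * N, hN'.mul hN, ?_⟩
  have hd : (unitDiagonal u).det = ∏ i, (u i : R) := det_diagonal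
  rw [det_mul, hN.det, mul_one, hd, ← mul_assoc, e]
  congr 2
  unfold unitDiagonal
  congr 1
  ext l
  by_cases hl : l = j
  · subst hl; simp
  · simp [hl]

/-- The matrix `a K - c b` of a block matrix `(a b; c K)`. -/
def schur (H : Matrix (Fin (k + 1)) (Fin (k + 1)) R) : Matrix (Fin k) (Fin k) R :=
  Matrix.of fun i j => H 0 0 * H i.succ j.succ - H i.succ 0 * H 0 j.succ

/-- Left multiplication by a block triangular matrix with diagonal blocks `1` and `H₀₀ I` clears the
first column without inverting the corner. -/
theorem mul_det_schur (H : Matrix (Fin (k + 1)) (Fin (k + 1)) R) :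
    H 0 0 * (schur H).det = H 0 0 ^ k * H.det := by
  let P : Matrix (Fin (k + 1)) (Fin (k + 1)) R := Matrix.of
    (Fin.cons (Fin.cons 1 0) fun i => Fin.cons (-H i.succ 0) ((H 0 0 • (1 : Matrix _ _ R)) i))
  have hP : P.det = H 0 0 ^ k := by
    have h : P.submatrix Fin.succ Fin.succ = H 0 0 • (1 : Matrix (Fin k) (Fin k) R) := by
      ext i j; simp [P]
    rw [Matrix.det_succ_row_zero, Fin.sum_univ_succ]
    rw [Fin.succAbove_zero, h]
    simp [P]
  have hPH : (P * H).det = H 0 0 * (schur H).det := by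
    have h0 : ∀ i : Fin k, (P * H) i.succ 0 = 0 := fun i => by
      simp [P, Matrix.mul_apply, Fin.sum_univ_succ, Matrix.one_apply]; ring
    have h : (P * H).submatrix Fin.succ Fin.succ = schur H := by
      ext i j
      simp [P, schur, Matrix.mul_apply, Fin.sum_univ_succ, Matrix.one_apply]; ring
    rw [Matrix.det_succ_column_zero, Fin.sum_univ_succ]
    rw [Fin.succAbove_zero, h]
    simp only [h0, mul_zero, zero_mul, Finset.sum_const_zero, add_zero]
    simp [P, Matrix.mul_apply, Fin.sum_univ_succ]
  rw [← hPH, det_mul, hP]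

/-- Block Gaussian elimination with an invertible corner `u`: the block left over is `u⁻¹` times the
Schur matrix, and the scalar goes into the diagonal factor. -/
theorem isGE_of_schur {H : Matrix (Fin (k + 1)) (Fin (k + 1)) R} (hu : IsUnit (H 0 0))
    (h : IsGE (schur H)) : IsGE H := by
  obtain ⟨u, hu⟩ := hu
  let ξ : Fin (k + 1) → R := Fin.cons 0 fun i => (u⁻¹ : Rˣ) * H i.succ 0
  let η : Fin (k + 1) → R := Fin.cons 0 fun j => (u⁻¹ : Rˣ) * H 0 j.succ
  have hH : H = (1 + vecMulVec ξ (Pi.single 0 1)) *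
      (unitDiagonal (Fin.cons u fun _ => u⁻¹) *
        (blockMatrix (schur H) * (1 + vecMulVec (Pi.single 0 1) η))) := by
    have e : ∀ i j, (unitDiagonal (Fin.cons u fun _ => u⁻¹) *
        (blockMatrix (schur H) * (1 + vecMulVec (Pi.single 0 1) η)) :
          Matrix (Fin (k + 1)) (Fin (k + 1)) R) i j =
        ((Fin.cons u (fun _ => u⁻¹) : Fin (k + 1) → Rˣ) i : R) * (blockMatrix (schur H) i j +
          blockMatrix (schur H) i 0 * η j) := fun i j => by
      rw [unitDiagonal, diagonal_mul, mul_add, mul_one, mul_vecMulVec, Matrix.add_apply,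
        vecMulVec_apply, mulVec_single_one]
      rfl
    have huu : (u : R) * (u⁻¹ : Rˣ) = 1 := u.mul_inv
    ext i j
    rw [add_mul, one_mul, vecMulVec_mul, Matrix.add_apply, vecMulVec_apply, single_one_vecMul]
    rw [row_apply, e, e]
    refine Fin.cases ?_ (fun i => ?_) i <;> refine Fin.cases ?_ (fun j => ?_) j
    · simp [ξ, η, blockMatrix, hu]
    · simp [ξ, η, blockMatrix]
    · simp [ξ, η, blockMatrix]
      linear_combination (-H i.succ 0) * huu
    · simp [ξ, η, blockMatrix, schur, ← hu]
      linear_combination (-H i.succ j.succ) * huu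
  rw [hH]
  exact (IsElem.one_add_col ξ 0 rfl).isGE.mul ((isGE_unitDiagonal _).mul
    (h.blockMatrix.mul (IsElem.one_add_row η 0 rfl).isGE))

theorem schur_map {S : Type*} [CommRing S] (f : R →+* S)
    (H : Matrix (Fin (k + 1)) (Fin (k + 1)) R) : (schur H).map f = schur (H.map f) := by
  ext i j
  simp [schur]

end GE

/-! ### Making a matrix diagonal times elementary modulo a suitable head. -/

section Splitting

variable {n : ℕ} {A : Type*} [CommRing A]

/-- After a change of `w` modulo `y` and `t` there is an element `s`, a unit modulo `w`, whose
invertibility makes `H` a product of a diagonal and an elementary matrix. -/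
theorem exists_isGE_of_isUnit (hA : StableRange (n + 1) A) {y : A} (k : ℕ) :
    ∀ (H : Matrix (Fin k) (Fin k) A) (t : A) (w : Fin n → A), UnimodMod y w → UnimodMod t w →
      UnimodMod H.det w → ∃ (d : Fin n → A) (s : A), UnimodMod s (w + (y * t) • d) ∧
        ∀ {R : Type _} [CommRing R] (f : A →+* R), IsUnit (f s) → IsGE (H.map f) := by
  induction k with
  | zero =>
    intro H t w _ _ _
    refine ⟨0, 1, fun M hM h _ => hM.ne_top ((Ideal.eq_top_iff_one M).2 h), fun f _ => ?_⟩
    rw [show H.map f = 1 from Subsingleton.elim _ _]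
    exact IsElem.one.isGE
  | succ k ih =>
    intro H t w hy ht hH
    -- The corner and the `n` entries of `w` reach the stable range. The corner changes by a
    -- combination of the rest of its row, hence by a column operation. The factors `y`, `t` and
    -- `det H` keep these three unimodular modulo the new `w`.
    obtain ⟨e, he, c, d, -, -, hSR⟩ := hA.exists_pair (m := 1) Finset.univ Finset.univ
      (by simp [add_comm]) (fun _ => H 0 0) w
      (Ideal.span {y * t * H.det} * rowIdeal fun j : Fin k => H 0 j.succ) ⊥
      (fun M hM h1 h2 h3 _ => by
        have hw : ∀ i, w i ∈ M := fun i => h2 i (Finset.mem_univ i)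
        rcases (Ideal.IsPrime.mul_le hM.isPrime).1 h3 with h | h
        · rcases hM.isPrime.mem_or_mem ((Ideal.span_singleton_le_iff_mem M).1 h) with h | h
          · rcases hM.isPrime.mem_or_mem h with h | h
            · exact hy M hM h hw
            · exact ht M hM h hw
          · exact hH M hM h hw
        · refine hH M hM ?_ hw
          rw [det_succ_row_zero]
          refine sum_mem fun j _ => Ideal.mul_mem_right _ _ (Ideal.mul_mem_left _ _ ?_)
          refine Fin.cases (h1 0 (Finset.mem_univ 0)) (fun j => rowIdeal_le.1 h j) j)
    obtain ⟨θ, hθ, rfl⟩ := Ideal.mem_span_singleton_mul.1 he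
    obtain ⟨b, rfl⟩ := mem_rowIdeal_iff.1 hθ
    set θ := (fun j : Fin k => H 0 j.succ) ⬝ᵥ b with hθ'
    let ζ : Fin (k + 1) → A := Fin.cons 0 ((y * t * H.det * c 0) • b)
    let e0 : Fin (k + 1) → A := Pi.single 0 1
    have hζ : IsElem (1 + vecMulVec ζ e0) := .one_add_col ζ 0 rfl
    obtain ⟨N, hN, hζN, -⟩ := hζ.exists_inv
    set H1 := H * (1 + vecMulVec ζ e0) with hH1
    have hdet : H1.det = H.det := by rw [hH1, det_mul, hζ.det, mul_one]
    have h00 : H1 0 0 = H 0 0 + y * t * H.det * θ * c 0 := by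
      rw [hH1, mul_add, mul_one, mul_vecMulVec, Matrix.add_apply, vecMulVec_apply]
      simp [mulVec, ζ, e0, dotProduct, Fin.sum_univ_succ, hθ', Finset.mul_sum, Finset.sum_mul]
      exact Finset.sum_congr rfl fun i _ => by ring
    set w1 := w + (y * t) • ((H.det * θ) • d) with hw1
    have h0w : UnimodMod (H1 0 0) w1 := fun M hM h1 h2 => hSR M hM
      (fun i _ => by rw [Subsingleton.elim i 0, ← h00]; exact h1)
      (fun i _ => by
        convert h2 i using 1
        simp [hw1]; ring) bot_le
    have hyw : UnimodMod y w1 := by rw [hw1, mul_smul]; exact hy.add_smul _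
    have htw : UnimodMod t w1 := by rw [hw1, mul_comm y, mul_smul]; exact ht.add_smul _
    have hmul : ∀ {a b : A} {w : Fin n → A}, UnimodMod a w → UnimodMod b w → UnimodMod (a * b) w :=
      fun ha hb M hM h1 h2 => (hM.isPrime.mem_or_mem h1).elim (ha M hM · h2) (hb M hM · h2)
    have hdw : UnimodMod (schur H1).det w1 := fun M hM h1 h2 => by
      have h3 : H1 0 0 ^ k * H1.det ∈ M := mul_det_schur H1 ▸ M.mul_mem_left _ h1
      rcases hM.isPrime.mem_or_mem h3 with h | h
      · exact h0w M hM (hM.isPrime.mem_of_pow_mem _ h) h2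
      · rw [hdet] at h
        refine hH M hM h fun i => ?_
        have h4 := h2 i
        rw [hw1] at h4
        refine (Ideal.add_mem_iff_left M ?_).1 h4
        simp only [Pi.smul_apply, smul_eq_mul]
        exact M.mul_mem_left _ (M.mul_mem_right _ (M.mul_mem_right _ h))
    -- Including the corner in `t` ensures that later changes of the tail keep it unimodular; the
    -- final `s` is the product of all corners.
    obtain ⟨d', s, hs, hsf⟩ := ih (schur H1) (t * H1 0 0) w1 hyw (hmul htw h0w) hdw
    have e1 : w1 + (y * (t * H1 0 0)) • d' = w + (y * t) • ((H.det * θ) • d + H1 0 0 • d') := by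
      rw [hw1]
      ext i
      simp only [Pi.add_apply, Pi.smul_apply, smul_eq_mul]
      ring
    refine ⟨(H.det * θ) • d + H1 0 0 • d', H1 0 0 * s, hmul ?_ ?_, fun f hf => ?_⟩
    · rw [← e1, show y * (t * H1 0 0) = H1 0 0 * (y * t) by ring, mul_smul]
      exact h0w.add_smul _
    · rw [← e1]; exact hs
    · rw [map_mul] at hf
      have h1 := isUnit_of_mul_isUnit_left hf
      have h2 := hsf f (isUnit_of_mul_isUnit_right hf)
      rw [schur_map] at h2
      have h3 := (isGE_of_schur (H := H1.map f) h1 h2).mul (hN.map f).isGE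
      rwa [← Matrix.map_mul, hH1, mul_assoc, hζN, mul_one] at h3

end Splitting

end UnimodularRows

namespace UnimodularRows

open Matrix

/-! ### The class of `p g`: multiplicativity of the row map. -/

section RowMap

variable {m n : ℕ} {A : Type*} [CommRing A]

attribute [local instance] umModEMul

theorem RowEquiv.vecMul (hm : 3 ≤ m) (g : SL m A) {p q : Fin m → A} (h : RowEquiv p q) :
    RowEquiv (p ᵥ* g.1) (q ᵥ* g.1) := by
  obtain ⟨_, ⟨e, he, rfl⟩, rfl⟩ := h
  refine ⟨_, ⟨g⁻¹ * e * g⁻¹⁻¹, (E_normal hm A).conj_mem e he g⁻¹, rfl⟩, ?_⟩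
  have h : g * (g⁻¹ * e * g⁻¹⁻¹) = e * g := by group
  rw [vecMul_vecMul, vecMul_vecMul]
  exact congrArg (fun f : SL m A => p ᵥ* f.1) h

/-- This minor is a cofactor of `g⁻¹`, and the adjugate of `g⁻¹` is `g`. -/
theorem det_submatrix_inv (g : SL (n + 1) A) :
    ((g⁻¹).1.submatrix Fin.succ Fin.succ).det = g.1 0 0 := by
  have h := adjugate_fin_succ_eq_det_submatrix (g⁻¹).1 0 0
  rw [show (g⁻¹).1.adjugate = g.1 from congrArg Subtype.val (inv_inv g)] at h
  simpa using h.symm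

/-- If `x` is a unit modulo the head, the factor `x` may be moved from one entry of the tail to
another one. -/
theorem RowEquiv.shift_cons_tail {x y r : A} (hy : y = 1 - x * r) {v w : Fin n → A} {a b : Fin n}
    (hab : a ≠ b) (ha : v a = x * w a) (hb : w b = x * v b) (h : ∀ i, i ≠ a → i ≠ b → w i = v i) :
    RowEquiv (Fin.cons y v : Fin (n + 1) → A) (Fin.cons y w) := by
  refine (RowEquiv.shift (i := a.succ) (j := b.succ) (l := 0) (q := x) (r := r) (a := w a)
    (by simpa using hab) (Fin.succ_ne_zero _) (Fin.succ_ne_zero _)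
    (by simpa using hy) (by simpa using ha)).trans (.of_eq ?_)
  rw [← Fin.cons_update, ← Fin.cons_update, Fin.cons_succ]
  congr 1
  ext i
  by_cases hib : i = b
  · subst hib; simp [hb]
  by_cases hia : i = a
  · subst hia; simp [hab]
  · simp [hia, hib, h i hia hib]

/-- With `u = x w + y v` for a suitable `w`, `cls_mul_head` identifies the right side with the class
of `(x y, u) = y g₀ + (0, x w)`. Multiplied by `g⁻¹` this row becomes `(z, (x w) H)`. Modulo `z` the
matrix `H` is `diag(x, 1, …, 1)` times an elementary one, which leads back to `(y, a)`. Normality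
allows the resulting equivalence to be multiplied by `g`. -/
theorem cls_vecMul_of_isGE.{u} {A : Type u} [CommRing A] (hn : 3 ≤ n) (hA : StableRange (n + 1) A)
    (g : SL (n + 1) A) {x y s κ : A} {v a : Fin n → A} (hg : g.1 0 = Fin.cons x v)
    (hy : y = 1 - x * (s * κ)) (hya : UnimodMod y a)
    (hs : ∀ {R : Type u} [CommRing R] (f : A →+* R), IsUnit (f s) →
      IsGE (((g⁻¹).1.submatrix Fin.succ Fin.succ).map f)) :
    cls ((Fin.cons y a : Fin (n + 1) → A) ᵥ* g.1) = cls (g.1 0) * cls (Fin.cons y a) := by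
  have hgg : g.1 * (g⁻¹).1 = 1 := congrArg Subtype.val (mul_inv_cancel g)
  have hgg' : (g⁻¹).1 * g.1 = 1 := congrArg Subtype.val (inv_mul_cancel g)
  have hdet := det_submatrix_inv g
  set H := (g⁻¹).1.submatrix Fin.succ Fin.succ with hH
  have hxv : UnimodMod x v := by
    rw [← uniRow_cons, ← hg]; exact uniRow_val (firstRow g)
  rw [hg, Fin.cons_zero] at hdet
  obtain ⟨ξ, hξ⟩ : ∃ ξ, ξ = s * κ := ⟨_, rfl⟩
  rw [← hξ] at hy
  let i0 : Fin n := ⟨0, by omega⟩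
  let i1 : Fin n := ⟨1, by omega⟩
  have h01 : i0 ≠ i1 := by simp [i0, i1]
  -- Modulo `y`, `ξ` is inverse to `x`. The powers of `ξ` compensate the factor `x²` at `i0` and `x`
  -- elsewhere in the target tail.
  obtain ⟨w, hw⟩ : ∃ w, w = Function.update (ξ • a) i0 (ξ ^ 2 * a i0) := ⟨_, rfl⟩
  have hw0 : w i0 = ξ ^ 2 * a i0 := by rw [hw, Function.update_self]
  have hwi : ∀ i, i ≠ i0 → w i = ξ * a i := fun i hi => by
    rw [hw, Function.update_of_ne hi]; rfl
  have hwξ : ∀ i, ξ ∣ w i := fun i => by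
    by_cases hi : i = i0
    · rw [hi, hw0, pow_two, mul_assoc]; exact Dvd.intro _ rfl
    · rw [hwi i hi]; exact Dvd.intro _ rfl
  obtain ⟨u, hu⟩ : ∃ u, u = x • w + y • v := ⟨_, rfl⟩
  -- the target tail `(x² w₀, x w₁, …)`
  have htail : ∀ i, y ∣ a i - Function.update (x • w) i0 (x * (x * w i0)) i := fun i => by
    by_cases hi : i = i0
    · subst hi
      refine ⟨(1 + x * ξ) * a i0, ?_⟩
      rw [Function.update_self, hw0, hy]; ring
    · refine ⟨a i, ?_⟩
      rw [Function.update_of_ne hi, Pi.smul_apply, smul_eq_mul, hwi i hi, hy]; ring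
  have e1 : RowEquiv (Fin.cons y (Function.update (x • w) i0 (x * (x * w i0))) : Fin (n + 1) → A)
      (Fin.cons y a) := .cons_of_dvd htail
  have e2 : RowEquiv (Fin.cons y (Function.update u i0 (x * u i0)) : Fin (n + 1) → A)
      (Fin.cons y a) := by
    refine .trans (.cons_of_dvd fun i => ?_) e1
    by_cases hi : i = i0
    · subst hi
      refine ⟨-x * v i0, ?_⟩
      rw [Function.update_self, Function.update_self, hu]
      simp; ring
    · refine ⟨-v i, ?_⟩
      rw [Function.update_of_ne hi, Function.update_of_ne hi, hu]
      simp
  have e3 : RowEquiv (Fin.cons x u : Fin (n + 1) → A) (Fin.cons x v) :=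
    .cons_of_dvd fun i => ⟨-w i + ξ * v i, by rw [hu, hy]; simp; ring⟩
  have hxu : UnimodMod x u := uniRow_cons.1 (e3.symm.uniRow (uniRow_cons.2 hxv))
  have hyu : UnimodMod y u := fun M hM h1 h2 =>
    uniRow_cons.1 (e2.symm.uniRow (uniRow_cons.2 hya)) M hM h1 fun i => by
      by_cases hi : i = i0
      · subst hi; rw [Function.update_self]; exact M.mul_mem_left _ (h2 i0)
      · rw [Function.update_of_ne hi]; exact h2 i
  have hxyu : UnimodMod (x * y) u := fun M hM h1 h2 =>
    (hM.isPrime.mem_or_mem h1).elim (hxu M hM · h2) (hyu M hM · h2)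
  have main := cls_mul_head hn hA hy hxyu i0
  rw [e3.cls_eq, e2.cls_eq] at main
  rw [hg, ← main]
  refine RowEquiv.cls_eq ?_
  -- the row `(x y, u) g⁻¹`
  obtain ⟨k, hk⟩ : ∃ k : Fin n → A, k = fun i => (g⁻¹).1 i.succ 0 := ⟨_, rfl⟩
  have hrow : (Fin.cons (x * y) u : Fin (n + 1) → A) ᵥ* (g⁻¹).1 =
      Fin.cons (y + x * (w ⬝ᵥ k)) ((x • w) ᵥ* H) := by
    have h1 : (Fin.cons (x * y) u : Fin (n + 1) → A) = y • g.1 0 + Fin.cons 0 (x • w) := by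
      rw [hg]
      ext i
      refine Fin.cases ?_ (fun i => ?_) i
      · simp [mul_comm]
      · simp [hu, add_comm]
    have h2 : g.1 0 ᵥ* (g⁻¹).1 = Pi.single 0 1 := by
      have : g.1 0 = Pi.single 0 1 ᵥ* g.1 := by rw [single_one_vecMul]; rfl
      rw [this, vecMul_vecMul, hgg, vecMul_one]
    rw [h1, add_vecMul, smul_vecMul, h2]
    ext i
    refine Fin.cases ?_ (fun i => ?_) i
    · simp [Matrix.vecMul, dotProduct, Fin.sum_univ_succ, hk, Finset.mul_sum, mul_assoc]
    · simp [Matrix.vecMul, dotProduct, Fin.sum_univ_succ, hH]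
  obtain ⟨z, hz⟩ : ∃ z, z = y + x * (w ⬝ᵥ k) := ⟨_, rfl⟩
  rw [← hz] at hrow
  -- All entries of `w` are divisible by `ξ = s κ`, so `z` has the form `1 - x s κ (1 - c)` and `s`
  -- is invertible modulo `z`.
  have hsz : IsUnit (Ideal.Quotient.mk (Ideal.span {z}) s) := by
    obtain ⟨c, hc⟩ : ξ ∣ w ⬝ᵥ k := Finset.dvd_sum fun i _ => (hwξ i).mul_right _
    refine IsUnit.of_mul_eq_one (Ideal.Quotient.mk (Ideal.span {z}) (x * κ * (1 - c))) ?_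
    rw [← map_mul, ← map_one (Ideal.Quotient.mk (Ideal.span {z})), Ideal.Quotient.eq,
      Ideal.mem_span_singleton]
    exact ⟨-1, by rw [hz, hc, hy, hξ]; ring⟩
  obtain ⟨N, hN, hHN⟩ := (hs (Ideal.Quotient.mk (Ideal.span {z})) hsz).exists_eq i0
  have e4 : RowEquiv (Fin.cons z ((x • w) ᵥ* H) : Fin (n + 1) → A)
      (Fin.cons z (Function.update (x • w) i0 (x * (x * w i0)))) := by
    refine RowEquiv.symm (RowEquiv.cons_of_mod ⟨N, hN, ?_⟩)
    have h1 : Ideal.Quotient.mk (Ideal.span {z}) ∘ ((x • w) ᵥ* H) =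
        (Ideal.Quotient.mk (Ideal.span {z}) ∘ (x • w)) ᵥ*
          H.map (Ideal.Quotient.mk (Ideal.span {z})) :=
      funext fun i => RingHom.map_vecMul (Ideal.Quotient.mk (Ideal.span {z})) H (x • w) i
    have h2 : (H.map (Ideal.Quotient.mk (Ideal.span {z}))).det =
        Ideal.Quotient.mk (Ideal.span {z}) x := by
      rw [← hdet, RingHom.map_det]; rfl
    rw [h1, hHN, h2, ← vecMul_vecMul]
    congr 1
    ext i
    rw [vecMul_diagonal]
    by_cases hi : i = i0
    · subst hi; simp; ring
    · simp [hi]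
  -- Passing from head `z` to `y` means removing `x (w k)`. The term at `i0` is not directly
  -- available, since the tail has `x² w₀` there. So the other terms go first, leaving the head `1 -
  -- x r`; the extra `x` is moved to `i1`, the last term removed, and `x` moved back.
  obtain ⟨r, hr⟩ : ∃ r, r = ξ - w i0 * k i0 := ⟨_, rfl⟩
  have e5 : RowEquiv (Fin.cons z (Function.update (x • w) i0 (x * (x * w i0))) : Fin (n + 1) → A)
      (Fin.cons (1 - x * r) (Function.update (x • w) i0 (x * (x * w i0)))) := by
    refine .cons_of_sub_mem ?_
    have h1 : w ⬝ᵥ k = w i0 * k i0 + ∑ i ∈ Finset.univ.erase i0, w i * k i :=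
      (Finset.add_sum_erase _ _ (Finset.mem_univ i0)).symm
    rw [show 1 - x * r - z = -∑ i ∈ Finset.univ.erase i0, x * w i * k i by
      rw [hr, hz, h1, hy]; simp only [mul_assoc, ← Finset.mul_sum]; ring]
    refine neg_mem (sum_mem fun i hi => Ideal.mul_mem_right _ _ (Ideal.subset_span ⟨i, ?_⟩))
    rw [Function.update_of_ne (Finset.ne_of_mem_erase hi)]; rfl
  have e6 : RowEquiv
      (Fin.cons (1 - x * r) (Function.update (x • w) i0 (x * (x * w i0))) : Fin (n + 1) → A)
      (Fin.cons (1 - x * r) (Function.update (x • w) i1 (x * (x * w i1)))) :=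
    .shift_cons_tail rfl h01 (by simp [h01]) (by simp [h01.symm]) fun i h h' => by simp [h, h']
  have e7 : RowEquiv
      (Fin.cons (1 - x * r) (Function.update (x • w) i1 (x * (x * w i1))) : Fin (n + 1) → A)
      (Fin.cons y (Function.update (x • w) i1 (x * (x * w i1)))) := by
    refine .cons_of_sub_mem ?_
    rw [show y - (1 - x * r) = x * w i0 * -k i0 by rw [hr, hy]; ring]
    refine Ideal.mul_mem_right _ _ (Ideal.subset_span ⟨i0, ?_⟩)
    rw [Function.update_of_ne h01]; rfl
  have e8 : RowEquiv
      (Fin.cons y (Function.update (x • w) i1 (x * (x * w i1))) : Fin (n + 1) → A)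
      (Fin.cons y (Function.update (x • w) i0 (x * (x * w i0)))) :=
    .shift_cons_tail hy h01.symm (by simp [h01.symm]) (by simp [h01]) fun i h h' => by simp [h, h']
  have e9 := (((((e4.trans e5).trans e6).trans e7).trans e8).trans e1).symm
  rw [← hrow] at e9
  have e10 := e9.vecMul (by omega) g
  rwa [vecMul_vecMul, hgg', vecMul_one] at e10

/-- After a change of `w` modulo `y`, some multiple of `x s` is `1` modulo the tail, with `s`
supplied by the splitting lemma. Hence `y` can be replaced by an element of the form `1 - x s κ`. -/
theorem cls_vecMul_of_unimodMod (hn : 3 ≤ n) (hA : StableRange (n + 1) A) (g : SL (n + 1) A)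
    {x y : A} {v w : Fin n → A} (hg : g.1 0 = Fin.cons x v) (hx : UnimodMod x w)
    (hy : UnimodMod y w) :
    cls ((Fin.cons y w : Fin (n + 1) → A) ᵥ* g.1) = cls (g.1 0) * cls (Fin.cons y w) := by
  have hdet := det_submatrix_inv g
  rw [hg, Fin.cons_zero] at hdet
  obtain ⟨d, s, hs, hs'⟩ := exists_isGE_of_isUnit hA n ((g⁻¹).1.submatrix Fin.succ Fin.succ) x w hy
    hx (hdet ▸ hx)
  obtain ⟨w1, hw1⟩ : ∃ w1, w1 = w + (y * x) • d := ⟨_, rfl⟩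
  rw [← hw1] at hs
  have hx1 : UnimodMod x w1 := by
    rw [hw1, mul_comm, mul_smul]; exact hx.add_smul _
  have hxs : UnimodMod (x * s) w1 := fun M hM h1 h2 =>
    (hM.isPrime.mem_or_mem h1).elim (hx1 M hM · h2) (hs M hM · h2)
  obtain ⟨a, ha, b, hb, hab⟩ := Submodule.mem_sup.1
    (hxs.sup_eq_top ▸ Submodule.mem_top : (1 : A) ∈ Ideal.span {x * s} ⊔ rowIdeal w1)
  obtain ⟨k, rfl⟩ := Ideal.mem_span_singleton'.1 ha
  have e1 : RowEquiv (Fin.cons y w : Fin (n + 1) → A) (Fin.cons y w1) :=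
    .cons_of_dvd fun i => ⟨x * d i, by rw [hw1]; simp [mul_assoc]⟩
  have e2 : RowEquiv (Fin.cons y w1 : Fin (n + 1) → A)
      (Fin.cons (1 - x * (s * (k * (1 - y)))) w1) := by
    refine .cons_of_sub_mem ?_
    rw [show 1 - x * (s * (k * (1 - y))) - y = (1 - y) * b by linear_combination (y - 1) * hab]
    exact Ideal.mul_mem_left _ _ hb
  have e := e1.trans e2
  rw [e.cls_eq, (e.vecMul (by omega) g).cls_eq]
  exact cls_vecMul_of_isGE hn hA g hg rfl
    (uniRow_cons.1 (e.uniRow (uniRow_cons.2 hy))) hs'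

theorem exists_unimodMod_add (hA : StableRange (n + 1) A) {x y : A} {v w : Fin n → A}
    (hx : UnimodMod x v) (hy : UnimodMod y w) :
    ∃ e ∈ rowIdeal v, y ∣ e ∧ ∃ (c : A) (d : Fin n → A), UnimodMod (x + e * c) (w + e • d) := by
  obtain ⟨e, he, c, d, -, -, hM⟩ := hA.exists_pair (m := 1) Finset.univ Finset.univ
    (by simp [add_comm]) (fun _ => x) w (rowIdeal v * Ideal.span {y}) ⊥ (by
      intro M hM h1 h2 h3 _
      rcases hM.isPrime.mul_le.1 h3 with h | h
      · exact hx M hM (h1 0 (Finset.mem_univ _)) (rowIdeal_le.1 h)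
      · exact hy M hM (h (Ideal.mem_span_singleton_self y)) fun i => h2 i (Finset.mem_univ _))
  obtain ⟨h1, h2⟩ := Ideal.mul_le_inf he
  refine ⟨e, h1, Ideal.mem_span_singleton.1 h2, c 0, d, ?_⟩
  intro M hm h1 h2
  refine hM M hm (fun i _ => ?_) (fun i _ => h2 i) bot_le
  rw [Subsingleton.elim i 0]
  exact h1

/-- It remains to make the head of `g₀` unimodular modulo the tail of `p`. Stable range does this by
changing `x` modulo its own tail, which replaces `g` by `g C` with `C` elementary, and `w` modulo
`y`. -/
theorem cls_vecMul (hn : 3 ≤ n) (hA : StableRange (n + 1) A) (g : SL (n + 1) A)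
    {p : Fin (n + 1) → A} (hp : UniRow p) : cls (p ᵥ* g.1) = cls (g.1 0) * cls p := by
  obtain ⟨x, v, hg⟩ : ∃ x v, g.1 0 = (Fin.cons x v : Fin (n + 1) → A) :=
    ⟨_, _, (Fin.cons_self_tail _).symm⟩
  obtain ⟨y, w, rfl⟩ : ∃ y w, p = (Fin.cons y w : Fin (n + 1) → A) :=
    ⟨_, _, (Fin.cons_self_tail _).symm⟩
  have hxv : UnimodMod x v := by
    rw [← uniRow_cons, ← hg]; exact uniRow_val (firstRow g)
  have hyw := uniRow_cons.1 hp
  obtain ⟨e, hev, ⟨f, hf⟩, c, d, hcd⟩ := exists_unimodMod_add hA hxv hyw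
  have e1 : RowEquiv (Fin.cons y w : Fin (n + 1) → A) (Fin.cons y (w + e • d)) :=
    .cons_of_dvd fun i => ⟨f * d i, by simp [hf, mul_assoc]⟩
  have e2 : RowEquiv (Fin.cons x v : Fin (n + 1) → A) (Fin.cons (x + e * c) v) := by
    refine .cons_of_sub_mem ?_
    rw [add_sub_cancel_left]
    exact Ideal.mul_mem_right _ _ hev
  have hC := e2
  obtain ⟨_, ⟨C, hC, rfl⟩, h⟩ := hC
  rw [← hg] at h
  have e3 : RowEquiv ((Fin.cons y w : Fin (n + 1) → A) ᵥ* g.1)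
      ((Fin.cons y (w + e • d) : Fin (n + 1) → A) ᵥ* (g * C).1) :=
    (e1.vecMul (by omega) g).trans ⟨_, ⟨C, hC, rfl⟩, vecMul_vecMul _ _ _⟩
  have h' : (g * C).1 0 = Fin.cons (x + e * c) v := h
  rw [e3.cls_eq, cls_vecMul_of_unimodMod hn hA (g * C) h', h', hg, e1.cls_eq, e2.cls_eq]
  · exact hcd
  · exact uniRow_cons.1 (e1.uniRow hp)

end RowMap

end UnimodularRows

namespace UnimodularRows

open Matrix

/-! ### Exactness, first of pointed sets and then of groups. -/

section ExactSequence

variable {n : ℕ} {A : Type*} [CommRing A]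

attribute [local instance] umModEMul

theorem firstRow_one : firstRow (1 : SL (n + 1) A) = baseRow n A := by
  refine Subtype.ext (funext fun i => ?_)
  refine Fin.cases ?_ (fun i => ?_) i
  · simp [firstRow, baseRow]
  · simp [firstRow, baseRow, one_apply, (Fin.succ_ne_zero i).symm]

theorem baseRow_act (g : SL (n + 1) A) : (baseRow n A).act g = firstRow g := by
  rw [← firstRow_one, ← firstRow_mul, one_mul]

/-- Such a `g` is a column matrix times a block matrix; since `n + 1 ≥ 3`, normality carries the
elementary factor across the block. -/
theorem exists_blockHom (hn : 2 ≤ n) {g : SL (n + 1) A} (hg : firstRow g = baseRow n A) :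
    ∃ N : SL n A, (blockHom n A N)⁻¹ * g ∈ E (n + 1) A := by
  have h0 : g.1 0 = Fin.cons 1 0 := congrArg Subtype.val hg
  have h00 : g.1 0 0 = 1 := by rw [h0, Fin.cons_zero]
  have h0s : ∀ j : Fin n, g.1 0 j.succ = 0 := fun j => by rw [h0, Fin.cons_succ]; rfl
  have hdet : (g.1.submatrix Fin.succ Fin.succ).det = 1 := by
    have h := g.2
    rw [det_succ_row_zero, Fin.sum_univ_succ] at h
    simpa [h0] using h
  obtain ⟨B, hB⟩ : ∃ B, B = blockHom n A ⟨_, hdet⟩ := ⟨_, rfl⟩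
  have hL : IsElem (1 + vecMulVec (Fin.cons 0 fun i : Fin n => g.1 i.succ 0 : Fin (n + 1) → A)
      (Pi.single 0 1)) := .one_add_col _ 0 rfl
  obtain ⟨L, hL, hL'⟩ := hL
  have h : g = L * B := by
    refine Subtype.ext ?_
    change g.1 = L.1 * B.1
    rw [hL', hB]
    change _ = _ * UnimodularRows.blockMatrix (g.1.submatrix Fin.succ Fin.succ)
    ext i j
    refine Fin.cases ?_ (fun i => ?_) i <;> refine Fin.cases ?_ (fun j => ?_) j <;>
      simp [UnimodularRows.blockMatrix, mul_apply, Fin.sum_univ_succ, vecMulVec_apply, one_apply,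
        h00, h0s, Fin.succ_ne_zero]
  refine ⟨⟨_, hdet⟩, ?_⟩
  rw [← hB, h, ← mul_assoc]
  simpa using (E_normal (by omega) A).conj_mem L hL B⁻¹

theorem exactAt_stabMap (hn : 2 ≤ n) :
    ExactAt (stabMap n A) (rowMap n A) (UmModE.mk (baseRow n A)) := by
  intro y
  refine ⟨fun h => ?_, ?_⟩
  · induction y using Quotient.inductionOn' with
    | h g =>
      obtain ⟨C, hC, h⟩ := Quotient.exact h
      rw [← firstRow_mul] at h
      obtain ⟨N, hN⟩ := exists_blockHom hn h
      refine ⟨(N : SLmodE n A), QuotientGroup.eq.2 ?_⟩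
      have := (E (n + 1) A).mul_mem hN ((E (n + 1) A).inv_mem hC)
      rwa [← mul_assoc, mul_inv_cancel_right] at this
  · rintro ⟨x, rfl⟩
    induction x using Quotient.inductionOn' with
    | h N => rfl

theorem projMap_mk_eq_iff {p q : Um (n + 1) A} :
    projMap (n + 1) A (UmModE.mk p) = projMap (n + 1) A (UmModE.mk q) ↔
      ∃ g : SL (n + 1) A, p.act g = q := by
  refine ⟨fun h => ?_, ?_⟩
  · obtain ⟨g, -, h⟩ := Quotient.exact h
    exact ⟨g, h⟩
  · rintro ⟨g, h⟩
    exact Quotient.sound ⟨g, Subgroup.mem_top g, h⟩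

theorem exactAt_rowMap :
    ExactAt (rowMap n A) (projMap (n + 1) A) (UmModSL.mk (baseRow n A)) := by
  intro y
  induction y using Quotient.inductionOn with
  | h p =>
    change projMap (n + 1) A (UmModE.mk p) = projMap (n + 1) A (UmModE.mk (baseRow n A)) ↔ _
    rw [eq_comm, projMap_mk_eq_iff]
    refine ⟨?_, ?_⟩
    · rintro ⟨g, rfl⟩
      exact ⟨(g : SLmodE (n + 1) A), by rw [baseRow_act]; rfl⟩
    · rintro ⟨x, h⟩
      induction x using Quotient.inductionOn' with
      | h g =>
        obtain ⟨C, -, h⟩ := Quotient.exact h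
        exact ⟨g * C, by rw [baseRow_act, firstRow_mul, h]⟩

theorem projMap_surjective : Function.Surjective (projMap (n + 1) A) := by
  intro y
  induction y using Quotient.inductionOn with
  | h p => exact ⟨UmModE.mk p, rfl⟩

theorem mk_act (hn : 3 ≤ n) (hA : StableRange (n + 1) A) (p : Um (n + 1) A) (g : SL (n + 1) A) :
    UmModE.mk (p.act g) = UmModE.mk (firstRow g) * UmModE.mk p := by
  rw [mk_eq_cls, mk_eq_cls, mk_eq_cls]
  exact cls_vecMul hn hA g (uniRow_val p)

theorem rowMap_mul (hn : 3 ≤ n) (hA : StableRange (n + 1) A) [(E (n + 1) A).Normal]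
    (a b : SLmodE (n + 1) A) : rowMap n A (a * b) = rowMap n A a * rowMap n A b := by
  induction a using QuotientGroup.induction_on with
  | H a =>
    induction b using QuotientGroup.induction_on with
    | H b =>
      -- `mk_act` yields the factors in reverse order, so commutativity is needed.
      rw [umModE_mul_comm hn hA]
      exact mk_act hn hA (firstRow a) b

/-- By `mk_act`, `g` acts on classes as multiplication by the class of its first row, so the
`SL`-orbits are the cosets of the image of the row map. -/
theorem projMap_eq_iff (hn : 3 ≤ n) (hA : StableRange (n + 1) A) (α β : UmModE (n + 1) A) :
    projMap (n + 1) A α = projMap (n + 1) A β ↔ ∃ a, β = rowMap n A a * α := by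
  induction α using Quotient.inductionOn with
  | h p =>
    induction β using Quotient.inductionOn with
    | h q =>
      change projMap _ _ (UmModE.mk p) = projMap _ _ (UmModE.mk q) ↔
        ∃ a, UmModE.mk q = rowMap n A a * UmModE.mk p
      rw [projMap_mk_eq_iff]
      refine ⟨?_, ?_⟩
      · rintro ⟨g, rfl⟩
        exact ⟨(g : SLmodE (n + 1) A), mk_act hn hA p g⟩
      · rintro ⟨a, h⟩
        induction a using Quotient.inductionOn' with
        | h g =>
          obtain ⟨C, -, h⟩ := Quotient.exact (h.trans (mk_act hn hA p g).symm)
          exact ⟨g * C⁻¹, by rw [Um.act_mul, ← h, ← Um.act_mul, mul_inv_cancel, Um.act_one]⟩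

end ExactSequence

theorem exists_group_exact {n : ℕ} {A : Type*} [CommRing A] (hn : 3 ≤ n) (hA : StableRange (n + 1) A) :
    ∃ (_ : (E n A).Normal) (_ : (E (n + 1) A).Normal)
      (_ : Group (UmModE (n + 1) A)) (_ : Group (UmModSL (n + 1) A))
      (wms : UmModE (n + 1) A ≃* WMS n A)
      (f₁ : SLmodE n A →* SLmodE (n + 1) A)
      (f₂ : SLmodE (n + 1) A →* UmModE (n + 1) A)
      (f₃ : UmModE (n + 1) A →* UmModSL (n + 1) A),
      ⇑wms = wmsMap n A ∧ ⇑f₁ = stabMap n A ∧ ⇑f₂ = rowMap n A ∧ ⇑f₃ = projMap (n + 1) A ∧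
      f₁.range = f₂.ker ∧ f₂.range = f₃.ker ∧ Function.Surjective f₃ := by
  have i₁ := E_normal hn A
  have i₂ := E_normal (m := n + 1) (by omega) A
  let i₃ := umModEGroup hn hA
  let f₁ : SLmodE n A →* SLmodE (n + 1) A :=
    QuotientGroup.map _ _ (blockHom n A) fun _ h => blockHom_mem_E h
  let f₂ : SLmodE (n + 1) A →* UmModE (n + 1) A := .mk' (rowMap n A) (rowMap_mul hn hA)
  have key : ∀ α β, projMap (n + 1) A α = projMap (n + 1) A β ↔ α⁻¹ * β ∈ f₂.range := by
    intro α β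
    rw [projMap_eq_iff hn hA]
    refine exists_congr fun a => ?_
    change _ ↔ rowMap n A a = α⁻¹ * β
    rw [eq_inv_mul_iff_mul_eq, mul_comm, eq_comm]
  -- The image of the row map is normal because the group is commutative. Its quotient is in
  -- bijection with `Um/SL`, which receives its group structure from there.
  let F : UmModE (n + 1) A ⧸ f₂.range → UmModSL (n + 1) A :=
    Quotient.lift (projMap (n + 1) A) fun α β h =>
      (key α β).2 (QuotientGroup.leftRel_apply.1 h)
  have hF : Function.Bijective F := by
    refine ⟨fun x y h => ?_, fun y => ?_⟩
    · induction x using QuotientGroup.induction_on with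
      | H α =>
        induction y using QuotientGroup.induction_on with
        | H β => exact QuotientGroup.eq.2 ((key α β).1 h)
    · obtain ⟨α, rfl⟩ := projMap_surjective y
      exact ⟨(α : UmModE (n + 1) A ⧸ f₂.range), rfl⟩
  let e := Equiv.ofBijective F hF
  let i₄ : Group (UmModSL (n + 1) A) := e.symm.group
  let f₃ : UmModE (n + 1) A →* UmModSL (n + 1) A :=
    e.symm.mulEquiv.symm.toMonoidHom.comp (QuotientGroup.mk' f₂.range)
  have h₁ : ⇑f₁ = stabMap n A := by
    funext x
    induction x using QuotientGroup.induction_on with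
    | H g => rfl
  have h₃ : ⇑f₃ = projMap (n + 1) A := rfl
  refine ⟨i₁, i₂, i₃.toGroup, i₄, wmsEquiv hn hA, f₁, f₂, f₃, rfl, h₁, rfl, h₃, ?_, ?_, ?_⟩
  · ext y
    rw [MonoidHom.mem_ker, MonoidHom.mem_range]
    exact h₁ ▸ (exactAt_stabMap (by omega) y).symm
  · ext y
    rw [MonoidHom.mem_ker, MonoidHom.mem_range, ← map_one f₃]
    exact (exactAt_rowMap y).symm
  · rw [h₃]; exact projMap_surjective

end UnimodularRows

open UnimodularRows in
theorem mainTheorem9 (A : Type*) [CommRing A] (d : ℕ) (hd : ringKrullDim A = d)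
    (n : ℕ) (hn : 2 ≤ n) :
    -- an exact sequence of pointed sets
    (stabMap n A ((1 : SL n A) : SLmodE n A) = ((1 : SL (n + 1) A) : SLmodE (n + 1) A) ∧
      rowMap n A ((1 : SL (n + 1) A) : SLmodE (n + 1) A) = UmModE.mk (baseRow n A) ∧
      projMap (n + 1) A (UmModE.mk (baseRow n A)) = UmModSL.mk (baseRow n A) ∧
      ExactAt (stabMap n A) (rowMap n A) (UmModE.mk (baseRow n A)) ∧
      ExactAt (rowMap n A) (projMap (n + 1) A) (UmModSL.mk (baseRow n A)) ∧
      Function.Surjective (projMap (n + 1) A)) ∧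
    -- an exact sequence of groups, the group law of `Um_{n+1}(A)/E_{n+1}(A)` being that of
    -- `WMS_{n+1}(A)`, carried over by the bijection `wms`
    (n = d → 3 ≤ d →
      ∃ (_ : (E n A).Normal) (_ : (E (n + 1) A).Normal)
        (_ : Group (UmModE (n + 1) A)) (_ : Group (UmModSL (n + 1) A))
        (wms : UmModE (n + 1) A ≃* WMS n A)
        (f₁ : SLmodE n A →* SLmodE (n + 1) A)
        (f₂ : SLmodE (n + 1) A →* UmModE (n + 1) A)
        (f₃ : UmModE (n + 1) A →* UmModSL (n + 1) A),
        ⇑wms = wmsMap n A ∧ ⇑f₁ = stabMap n A ∧ ⇑f₂ = rowMap n A ∧ ⇑f₃ = projMap (n + 1) A ∧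
        f₁.range = f₂.ker ∧ f₂.range = f₃.ker ∧ Function.Surjective f₃) := by
  refine ⟨⟨congrArg _ (map_one (blockHom n A)), congrArg UmModE.mk firstRow_one, rfl,
    exactAt_stabMap hn, exactAt_rowMap, projMap_surjective⟩, ?_⟩
  rintro rfl h3
  -- Dimension `n` gives stable range `n + 1`, the length of the rows.
  exact exists_group_exact h3
    (stableRange_of_ringKrullDim_lt (by rw [hd]; exact_mod_cast Nat.lt_succ_self n))
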